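/- For $\alpha\ge 0$ let $T_\alpha:[0,1]\to[0,1]$ be the Pomeau–Manneville map $T_\alpha(x)=x(1+2^\alpha x^\alpha)$ for $x\in[0,1/2)$ and $T_\alpha(x)=2x-1$ for $x\in[1/2,1]$ (with $x^0=1$, so that $T_0$ is the angle-doubling map). For $\beta>0$ let $\mathcal C_*(\beta)$ be the set of all continuous, Lebesgue integrable $g:(0,1]\to[0,\infty)$ such that $g$ is decreasing, $x\mapsto x^{\beta+1}g(x)$ is increasing (both in the weak sense), and $g(x)\le 2^{\beta}(2+\beta)x^{-\beta}\int_0^1 g$ for all $x\in(0,1]$. For a function $f:[0,1]\to\mathbb R^d$ put $\|f\|_{\mathrm{Lip}}=\max_a\sup_x|f_a(x)|+\max_a\sup_{x\ne y}|f_a(x)-f_a(y)|/|x-y|$, and for $h:\mathbb R^d\to\mathbb R$ let $\|D^kh\|_\infty$ be the largest supremum norm of a partial derivative of $h$ of order $k$. Given parameters $(\alpha_n)_{n\ge1}$ and a Borel probability measure $\mu$ on $[0,1]$, let $\widetilde T_0=\mathrm{id}$, $\widetilde T_n=T_{\alpha_n}\circ\cdots\circ T_{\alpha_1}$, and $$W=W(N)=\frac1{\sqrt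 N}\sum_{i=0}^{N-1}\Bigl(f\circ\widetilde T_i-\int f\circ\widetilde T_i\,d\mu\Bigr),\qquad \Sigma_N=\int W\otimes W\,d\mu ,$$ where $(v\otimes w)_{ab}=v_aw_b$. For a positive definite matrix $\Sigma$ let $\Phi_{\Sigma}(h)$ denote the expectation of $h$ with respect to the centred normal distribution $\mathcal N(0,\Sigma)$. **Theorem.** Let $0<\beta_*<1/3$, $d\ge1$ and $L,M\ge0$. There is a constant $C>0$, depending only on $\beta_*,d,L,M$ (in particular independent of $N$), such that the following holds. Let $0\le\alpha_n\le\beta_*$ for all $n\ge1$, let $\mu$ be a probability measure on $[0,1]$ whose density with respect to Lebesgue measure belongs to $\mathcal C_*(\beta_*)$, let $N\ge2$, and let $f:[0,1]\to\mathbb R^d$ be Lipschitz continuous with $\|f\|_{\mathrm{Lip}}\le L$ and such that $\Sigma_N$ is positive definite. Then for every three times differentiable $h:\mathbb R^d\to\mathbb R$ with $\max_{k=1,2,3}\|D^kh\|_\infty\le M$, $$\Bigl|\int h(W)\,d\mu-\Phi_{\Sigma_N}(h)\Bigr|\le C\,N^{\beta_*-\frac12}(\log N)^{\frac1{\beta_*}}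 .$$ -/

import Mathlib

open MeasureTheory ProbabilityTheory unitInterval
open scoped NNReal ENNReal

namespace Intermittent

lemma pm_mem (α : ℝ≥0) (x : I) :
    (if (x : ℝ) < 1 / 2 then (x : ℝ) * (1 + 2 ^ (α : ℝ) * (x : ℝ) ^ (α : ℝ))
      else 2 * (x : ℝ) - 1) ∈ Set.Icc (0 : ℝ) 1 := by
  obtain ⟨x, hx0, hx1⟩ := x
  dsimp only
  split_ifs with h
  · have h1 : (2 : ℝ) ^ (α : ℝ) * x ^ (α : ℝ) ≤ 1 := by
      rw [← Real.mul_rpow (by norm_num) hx0]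
      exact Real.rpow_le_one (by positivity) (by linarith) α.2
    have h0 : 0 ≤ (2 : ℝ) ^ (α : ℝ) * x ^ (α : ℝ) := by positivity
    constructor
    · positivity
    · nlinarith
  · rw [not_lt] at h
    constructor <;> linarith

/-- The Pomeau–Manneville map `T_α : [0,1] → [0,1]` with parameter `α ≥ 0`
(`α = 0` gives the angle-doubling map). -/
noncomputable def pmMap (α : ℝ≥0) (x : I) : I :=
  ⟨if (x : ℝ) < 1 / 2 then (x : ℝ) * (1 + 2 ^ (α : ℝ) * (x : ℝ) ^ (α : ℝ))
    else 2 * (x : ℝ) - 1, pm_mem α x⟩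

/-- The composition `T_{α_n} ∘ ⋯ ∘ T_{α_1}`; the entry `α 0` is not used. -/
noncomputable def comp (α : ℕ → ℝ≥0) : ℕ → I → I
  | 0 => id
  | n + 1 => pmMap (α (n + 1)) ∘ comp α n

/-- The cone `C_*(β)`. Only the values of `g` on `(0,1]` matter. -/
def cone (β : ℝ) : Set (ℝ → ℝ) :=
  {g | ContinuousOn g (Set.Ioc 0 1) ∧
    IntegrableOn g (Set.Ioc 0 1) volume ∧
    (∀ x ∈ Set.Ioc (0 : ℝ) 1, 0 ≤ g x) ∧
    AntitoneOn g (Set.Ioc 0 1) ∧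
    MonotoneOn (fun x => x ^ (β + 1) * g x) (Set.Ioc 0 1) ∧
    ∀ x ∈ Set.Ioc (0 : ℝ) 1,
      g x ≤ 2 ^ β * (2 + β) * x ^ (-β) * ∫ y in Set.Ioc (0 : ℝ) 1, g y}

/-- `μ` has a density with respect to Lebesgue measure on `[0,1]` that belongs to `C_*(β)`. -/
def HasConeDensity (β : ℝ) (μ : Measure I) : Prop :=
  ∃ g ∈ cone β, μ = (volume : Measure I).withDensity (fun x => ENNReal.ofReal (g x))

variable {d : ℕ}

/-- `W(N) = N^{-1/2} ∑_{i<N} (f ∘ T̃_i - μ(f ∘ T̃_i))`. -/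
noncomputable def W (α : ℕ → ℝ≥0) (μ : Measure I) (f : I → Fin d → ℝ) (N : ℕ) (x : I) :
    Fin d → ℝ :=
  (1 / √(N : ℝ)) • ∑ i ∈ Finset.range N, (f (comp α i x) - ∫ y, f (comp α i y) ∂μ)

/-- `Σ_N = μ(W ⊗ W)`. -/
noncomputable def covMat (α : ℕ → ℝ≥0) (μ : Measure I) (f : I → Fin d → ℝ) (N : ℕ) :
    Matrix (Fin d) (Fin d) ℝ :=
  Matrix.of fun a b => ∫ x, W α μ f N x a * W α μ f N x b ∂μ

/-- `‖f‖_Lip = max_a sup |f_a| + max_a sup_{x ≠ y} |f_a(x) - f_a(y)| / |x - y|`,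
which is finite exactly when `f` is Lipschitz continuous. -/
noncomputable def lipNorm (f : I → Fin d → ℝ) : ℝ≥0∞ :=
  (⨆ (a : Fin d) (x : I), ‖f x a‖ₑ) +
    ⨆ (a : Fin d) (x : I) (y : I) (_ : x ≠ y), ‖f x a - f y a‖ₑ / edist x y

/-- `h` is three times (Fréchet) differentiable. -/
def ThriceDifferentiable (h : (Fin d → ℝ) → ℝ) : Prop :=
  ∀ k < 3, Differentiable ℝ (iteratedFDeriv ℝ k h)

/-- `‖D^k h‖_∞`: the largest supremum norm of a partial derivative of `h` of order `k`. -/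
noncomputable def derivNorm (k : ℕ) (h : (Fin d → ℝ) → ℝ) : ℝ≥0∞ :=
  ⨆ (i : Fin k → Fin d) (x : Fin d → ℝ),
    ‖iteratedFDeriv ℝ k h x (fun j => Pi.single (i j) 1)‖ₑ

/-- `Φ_S(h)`: the expectation of `h` with respect to the normal distribution `N(0, S)`. -/
noncomputable def gaussianExp (S : Matrix (Fin d) (Fin d) ℝ) (h : (Fin d → ℝ) → ℝ) : ℝ :=
  ∫ z, h (WithLp.ofLp z) ∂(multivariateGaussian 0 S)

end Intermittent

namespace Intermittent

/-- The left branch of `pmMap` on `[0,1/2]`, as a real function. -/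
noncomputable def leftMap (a : ℝ≥0) (y : ℝ) : ℝ := y * (1 + 2 ^ (a : ℝ) * y ^ (a : ℝ))

/-- The derivative of `leftMap`. -/
noncomputable def leftDeriv (a : ℝ≥0) (y : ℝ) : ℝ := 1 + (1 + a) * (2 ^ (a : ℝ) * y ^ (a : ℝ))

/-- The inverse of `leftMap` on `[0,1]`. -/
noncomputable def leftInv (a : ℝ≥0) (x : ℝ) : ℝ :=
  Function.invFunOn (leftMap a) (Set.Icc 0 (1 / 2)) x

/-- The contribution of the left branch to the transfer operator. -/
noncomputable def leftOp (a : ℝ≥0) (r : ℝ → ℝ) (x : ℝ) : ℝ :=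
  r (leftInv a x) / leftDeriv a (leftInv a x)

/-- The contribution of the right branch to the transfer operator. -/
noncomputable def rightOp (r : ℝ → ℝ) (x : ℝ) : ℝ := r ((x + 1) / 2) / 2

/-- The transfer operator of `pmMap`. -/
noncomputable def transferOp (a : ℝ≥0) (r : ℝ → ℝ) (x : ℝ) : ℝ := leftOp a r x + rightOp r x

lemma coe_pmMap_of_lt {a : ℝ≥0} {x : I} (h : (x : ℝ) < 1 / 2) :
    (pmMap a x : ℝ) = leftMap a x := by
  simp only [pmMap, leftMap, h, if_true]

lemma coe_pmMap_of_not_lt {a : ℝ≥0} {x : I} (h : ¬ (x : ℝ) < 1 / 2) :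
    (pmMap a x : ℝ) = 2 * x - 1 := by
  simp only [pmMap, h, if_false]

lemma two_mul_rpow_nonneg (a : ℝ≥0) {y : ℝ} (hy : 0 ≤ y) : 0 ≤ 2 ^ (a : ℝ) * y ^ (a : ℝ) := by
  positivity

lemma two_mul_rpow_le_one (a : ℝ≥0) {y : ℝ} (hy : 0 ≤ y) (hy2 : y ≤ 1 / 2) :
    2 ^ (a : ℝ) * y ^ (a : ℝ) ≤ 1 := by
  rw [← Real.mul_rpow (by norm_num) hy]
  exact Real.rpow_le_one (by positivity) (by linarith) a.2

lemma two_mul_rpow_mono (a : ℝ≥0) {y z : ℝ} (hy : 0 ≤ y) (hyz : y ≤ z) :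
    2 ^ (a : ℝ) * y ^ (a : ℝ) ≤ 2 ^ (a : ℝ) * z ^ (a : ℝ) := by
  have := Real.rpow_le_rpow hy hyz a.2
  gcongr

lemma leftDeriv_pos (a : ℝ≥0) {y : ℝ} (hy : 0 ≤ y) : 0 < leftDeriv a y := by
  unfold leftDeriv
  positivity

lemma strictMonoOn_leftMap (a : ℝ≥0) : StrictMonoOn (leftMap a) (Set.Ici 0) := by
  intro y hy z hz hyz
  have := two_mul_rpow_mono a hy hyz.le
  have h0 := two_mul_rpow_nonneg a hy
  have hy' : 0 ≤ y := hy
  unfold leftMap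
  nlinarith

lemma continuous_leftMap (a : ℝ≥0) : ContinuousOn (leftMap a) (Set.Ici 0) := by
  unfold leftMap
  apply ContinuousOn.mul continuousOn_id
  apply ContinuousOn.add continuousOn_const
  apply ContinuousOn.mul continuousOn_const
  exact (Real.continuous_rpow_const a.2).continuousOn

lemma leftMap_zero (a : ℝ≥0) : leftMap a 0 = 0 := by simp [leftMap]

lemma leftMap_half (a : ℝ≥0) : leftMap a (1 / 2) = 1 := by
  unfold leftMap
  rw [← Real.mul_rpow (by norm_num) (by norm_num)]
  norm_num

lemma surjOn_leftMap (a : ℝ≥0) :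
    Set.SurjOn (leftMap a) (Set.Icc 0 (1 / 2)) (Set.Icc 0 1) := by
  have := intermediate_value_Icc (show (0 : ℝ) ≤ 1 / 2 by norm_num)
    ((continuous_leftMap a).mono Set.Icc_subset_Ici_self)
  rwa [leftMap_zero, leftMap_half] at this

lemma leftInv_mem (a : ℝ≥0) {x : ℝ} (hx : x ∈ Set.Icc (0 : ℝ) 1) :
    leftInv a x ∈ Set.Icc (0 : ℝ) (1 / 2) :=
  Function.invFunOn_mem (surjOn_leftMap a hx)

lemma leftMap_leftInv (a : ℝ≥0) {x : ℝ} (hx : x ∈ Set.Icc (0 : ℝ) 1) :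
    leftMap a (leftInv a x) = x :=
  Function.invFunOn_eq (surjOn_leftMap a hx)

lemma leftInv_leftMap (a : ℝ≥0) {y : ℝ} (hy : y ∈ Set.Icc (0 : ℝ) (1 / 2)) :
    leftInv a (leftMap a y) = y :=
  ((strictMonoOn_leftMap a).mono Set.Icc_subset_Ici_self).injOn.leftInvOn_invFunOn hy

lemma leftInv_pos (a : ℝ≥0) {x : ℝ} (hx : x ∈ Set.Ioc (0 : ℝ) 1) : 0 < leftInv a x := by
  have h1 := leftInv_mem a (Set.Ioc_subset_Icc_self hx)
  have h2 := leftMap_leftInv a (Set.Ioc_subset_Icc_self hx)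
  rcases h1.1.lt_or_eq with h | h
  · exact h
  · rw [← h, leftMap_zero] at h2
    exact absurd h2 hx.1.ne

lemma leftInv_mono (a : ℝ≥0) {x y : ℝ} (hx : x ∈ Set.Icc (0 : ℝ) 1) (hy : y ∈ Set.Icc (0 : ℝ) 1)
    (hxy : x ≤ y) : leftInv a x ≤ leftInv a y := by
  rw [← (strictMonoOn_leftMap a).le_iff_le (leftInv_mem a hx).1 (leftInv_mem a hy).1,
    leftMap_leftInv a hx, leftMap_leftInv a hy]
  exact hxy

lemma hasDerivAt_leftMap (a : ℝ≥0) {y : ℝ} (hy : 0 < y) :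
    HasDerivAt (leftMap a) (leftDeriv a y) y := by
  have h1 := (Real.hasDerivAt_rpow_const (x := y) (p := (a : ℝ)) (Or.inl hy.ne'))
  have h2 := (hasDerivAt_id y).mul ((h1.const_mul (2 ^ (a : ℝ))).const_add 1)
  refine h2.congr_deriv ?_
  have : y ^ (a : ℝ) = y * y ^ ((a : ℝ) - 1) := by
    rw [Real.rpow_sub_one hy.ne']; field_simp
  simp only [leftDeriv, id, this]
  ring

lemma image_leftMap (a : ℝ≥0) : leftMap a '' Set.Ioo 0 (1 / 2) = Set.Ioo 0 1 := by
  ext x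
  constructor
  · rintro ⟨y, hy, rfl⟩
    have h1 := strictMonoOn_leftMap a (Set.mem_Ici.2 le_rfl) (Set.mem_Ici.2 hy.1.le) hy.1
    have h2 := strictMonoOn_leftMap a (Set.mem_Ici.2 hy.1.le)
      (Set.mem_Ici.2 (by norm_num : (0 : ℝ) ≤ 1 / 2)) hy.2
    rw [leftMap_zero] at h1
    rw [leftMap_half] at h2
    exact ⟨h1, h2⟩
  · intro hx
    have hx' : x ∈ Set.Icc (0 : ℝ) 1 := Set.Ioo_subset_Icc_self hx
    refine ⟨leftInv a x, ⟨leftInv_pos a ⟨hx.1, hx.2.le⟩, ?_⟩, leftMap_leftInv a hx'⟩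
    rcases (leftInv_mem a hx').2.lt_or_eq with h | h
    · exact h
    · have := leftMap_leftInv a hx'
      rw [h, leftMap_half] at this
      exact absurd this.symm hx.2.ne

lemma image_rightMap : (fun y : ℝ => 2 * y - 1) '' Set.Ioo (1 / 2) 1 = Set.Ioo 0 1 := by
  ext x
  constructor
  · rintro ⟨y, hy, rfl⟩
    exact ⟨by linarith [hy.1], by linarith [hy.2]⟩
  · intro hx
    exact ⟨(x + 1) / 2, ⟨by linarith [hx.1], by linarith [hx.2]⟩, by ring⟩

lemma hasDerivAt_rightMap (y : ℝ) : HasDerivAt (fun y : ℝ => 2 * y - 1) 2 y := by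
  simpa using ((hasDerivAt_id y).const_mul 2).sub_const 1

/-- Extension of a function on the unit interval to the real line. -/
noncomputable def realExt (F : I → ℝ) (x : ℝ) : ℝ := F (Set.projIcc 0 1 zero_le_one x)

lemma realExt_coe (F : I → ℝ) (x : I) : realExt F x = F x := by
  simp [realExt, Set.projIcc_val]

lemma integral_unitInterval (F : I → ℝ) : ∫ x, F x = ∫ x in Set.Ioo (0 : ℝ) 1, realExt F x := by
  rw [← integral_Icc_eq_integral_Ioo, ← integral_subtype_comap measurableSet_Icc]
  simp only [realExt_coe]
  rfl

lemma integrable_unitInterval (F : I → ℝ) :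
    Integrable F ↔ IntegrableOn (realExt F) (Set.Ioo (0 : ℝ) 1) := by
  rw [← integrableOn_Icc_iff_integrableOn_Ioo]
  rw [IntegrableOn, ← map_comap_subtype_coe measurableSet_Icc,
    (MeasurableEmbedding.subtype_coe measurableSet_Icc).integrable_map_iff]
  have : realExt F ∘ Subtype.val = F := by
    ext x
    exact realExt_coe F x
  rw [this]
  rfl

lemma abs_leftDeriv_mul_leftOp (a : ℝ≥0) (r : ℝ → ℝ) (B : I → ℝ) {y : ℝ}
    (hy : y ∈ Set.Ioo (0 : ℝ) (1 / 2)) :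
    |leftDeriv a y| * realExt (fun x => leftOp a r x * B x) (leftMap a y) =
      realExt (fun x => if (x : ℝ) < 1 / 2 then r x * B (pmMap a x) else 0) y := by
  have hy' : y ∈ Set.Icc (0 : ℝ) 1 := ⟨hy.1.le, by linarith [hy.2]⟩
  have hT : leftMap a y ∈ Set.Ioo (0 : ℝ) 1 := image_leftMap a ▸ Set.mem_image_of_mem _ hy
  have hT' := Set.Ioo_subset_Icc_self hT
  have e1 : pmMap a ⟨y, hy'⟩ = ⟨leftMap a y, hT'⟩ := Subtype.ext (coe_pmMap_of_lt hy.2)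
  rw [realExt, realExt, Set.projIcc_of_mem _ hy', Set.projIcc_of_mem _ hT']
  simp only [hy.2, if_true]
  rw [e1, leftOp, leftInv_leftMap a ⟨hy.1.le, hy.2.le⟩, abs_of_pos (leftDeriv_pos a hy.1.le)]
  have := (leftDeriv_pos a hy.1.le).ne'
  field_simp

lemma two_mul_rightOp (a : ℝ≥0) (r : ℝ → ℝ) (B : I → ℝ) {y : ℝ}
    (hy : y ∈ Set.Ioo (1 / 2 : ℝ) 1) :
    |(2 : ℝ)| * realExt (fun x => rightOp r x * B x) (2 * y - 1) =
      realExt (fun x => if (x : ℝ) < 1 / 2 then 0 else r x * B (pmMap a x)) y := by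
  have hy' : y ∈ Set.Icc (0 : ℝ) 1 := ⟨by linarith [hy.1], hy.2.le⟩
  have hT' : 2 * y - 1 ∈ Set.Icc (0 : ℝ) 1 := ⟨by linarith [hy.1], by linarith [hy.2]⟩
  have hn : ¬ y < 1 / 2 := not_lt.2 hy.1.le
  have e1 : pmMap a ⟨y, hy'⟩ = ⟨2 * y - 1, hT'⟩ := Subtype.ext (coe_pmMap_of_not_lt hn)
  rw [realExt, realExt, Set.projIcc_of_mem _ hy', Set.projIcc_of_mem _ hT']
  simp only [hn, if_false]
  rw [e1, rightOp, abs_of_pos (by norm_num)]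
  have : (2 * y - 1 + 1) / 2 = y := by ring
  rw [this]
  ring

lemma realExt_left_zero (a : ℝ≥0) (r : ℝ → ℝ) (B : I → ℝ) {y : ℝ} (hy : y ∈ Set.Ioo (0 : ℝ) 1)
    (h : y ∉ Set.Ioo (0 : ℝ) (1 / 2)) :
    realExt (fun x => if (x : ℝ) < 1 / 2 then r x * B (pmMap a x) else 0) y = 0 := by
  rw [realExt, Set.projIcc_of_mem _ (Set.Ioo_subset_Icc_self hy)]
  exact if_neg fun hlt => h ⟨hy.1, hlt⟩

lemma realExt_right_zero (a : ℝ≥0) (r : ℝ → ℝ) (B : I → ℝ) {y : ℝ} (hy : y ∈ Set.Ioo (0 : ℝ) 1)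
    (h : y ∉ Set.Ico (1 / 2 : ℝ) 1) :
    realExt (fun x => if (x : ℝ) < 1 / 2 then 0 else r x * B (pmMap a x)) y = 0 := by
  rw [realExt, Set.projIcc_of_mem _ (Set.Ioo_subset_Icc_self hy)]
  exact if_pos (not_le.1 fun hlt => h ⟨hlt, hy.2⟩)

lemma integral_leftOp_mul (a : ℝ≥0) (r : ℝ → ℝ) (B : I → ℝ) :
    ∫ x : I, leftOp a r x * B x =
      ∫ x : I, if (x : ℝ) < 1 / 2 then r x * B (pmMap a x) else 0 := by
  rw [integral_unitInterval, integral_unitInterval, ← image_leftMap a,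
    integral_image_eq_integral_abs_deriv_smul measurableSet_Ioo
      (fun y hy => (hasDerivAt_leftMap a hy.1).hasDerivWithinAt)
      ((strictMonoOn_leftMap a).mono fun y hy => hy.1.le).injOn]
  simp only [smul_eq_mul]
  rw [setIntegral_congr_fun measurableSet_Ioo fun y hy => abs_leftDeriv_mul_leftOp a r B hy,
    image_leftMap a]
  refine setIntegral_eq_of_subset_of_forall_sdiff_eq_zero measurableSet_Ioo
    (Set.Ioo_subset_Ioo_right (by norm_num)) (fun y hy => realExt_left_zero a r B hy.1 hy.2) |>.symm

lemma integrable_leftOp_mul (a : ℝ≥0) (r : ℝ → ℝ) (B : I → ℝ) :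
    Integrable (fun x : I => leftOp a r x * B x) ↔
      Integrable (fun x : I => if (x : ℝ) < 1 / 2 then r x * B (pmMap a x) else 0) := by
  rw [integrable_unitInterval, integrable_unitInterval, ← image_leftMap a,
    integrableOn_image_iff_integrableOn_abs_deriv_smul measurableSet_Ioo
      (fun y hy => (hasDerivAt_leftMap a hy.1).hasDerivWithinAt)
      ((strictMonoOn_leftMap a).mono fun y hy => hy.1.le).injOn]
  simp only [smul_eq_mul]
  rw [integrableOn_congr_fun (fun y hy => abs_leftDeriv_mul_leftOp a r B hy) measurableSet_Ioo,
    image_leftMap a]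
  refine ⟨fun h => ?_, fun h => h.mono_set (Set.Ioo_subset_Ioo_right (by norm_num))⟩
  exact h.of_forall_sdiff_eq_zero measurableSet_Ioo fun y hy => realExt_left_zero a r B hy.1 hy.2

lemma integral_rightOp_mul (a : ℝ≥0) (r : ℝ → ℝ) (B : I → ℝ) :
    ∫ x : I, rightOp r x * B x =
      ∫ x : I, if (x : ℝ) < 1 / 2 then 0 else r x * B (pmMap a x) := by
  rw [integral_unitInterval, integral_unitInterval, ← image_rightMap,
    integral_image_eq_integral_abs_deriv_smul measurableSet_Ioo
      (f' := fun _ => 2)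
      (fun y _ => (hasDerivAt_rightMap y).hasDerivWithinAt)
      (fun y _ z _ h => by simpa using h)]
  simp only [smul_eq_mul]
  rw [setIntegral_congr_fun measurableSet_Ioo fun y hy => two_mul_rightOp a r B hy,
    image_rightMap, ← integral_Ico_eq_integral_Ioo]
  refine setIntegral_eq_of_subset_of_forall_sdiff_eq_zero measurableSet_Ioo
    (fun y hy => ⟨by linarith [hy.1], hy.2⟩) (fun y hy => realExt_right_zero a r B hy.1 hy.2) |>.symm

lemma integrable_rightOp_mul (a : ℝ≥0) (r : ℝ → ℝ) (B : I → ℝ) :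
    Integrable (fun x : I => rightOp r x * B x) ↔
      Integrable (fun x : I => if (x : ℝ) < 1 / 2 then 0 else r x * B (pmMap a x)) := by
  rw [integrable_unitInterval, integrable_unitInterval, ← image_rightMap,
    integrableOn_image_iff_integrableOn_abs_deriv_smul measurableSet_Ioo
      (f' := fun _ => 2)
      (fun y _ => (hasDerivAt_rightMap y).hasDerivWithinAt)
      (fun y _ z _ h => by simpa using h)]
  simp only [smul_eq_mul]
  rw [integrableOn_congr_fun (fun y hy => two_mul_rightOp a r B hy) measurableSet_Ioo,
    image_rightMap, ← integrableOn_Ico_iff_integrableOn_Ioo]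
  refine ⟨fun h => ?_, fun h => h.mono_set fun y hy => ⟨by linarith [hy.1], hy.2⟩⟩
  exact h.of_forall_sdiff_eq_zero measurableSet_Ioo fun y hy => realExt_right_zero a r B hy.1 hy.2

/-- Regular densities: nonnegative integrable functions `r` on `(0,1]` such that `r` is decreasing
and `x ^ b * r x` is increasing. -/
structure Reg (b : ℝ) (r : ℝ → ℝ) : Prop where
  nonneg : ∀ x ∈ Set.Ioc (0 : ℝ) 1, 0 ≤ r x
  anti : AntitoneOn r (Set.Ioc 0 1)
  mono : MonotoneOn (fun x => x ^ b * r x) (Set.Ioc 0 1)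
  int : Integrable fun x : I => r x

/-- The integral over the unit interval. -/
noncomputable def mass (r : ℝ → ℝ) : ℝ := ∫ x : I, r x

lemma measurable_lt_half : MeasurableSet {x : I | (x : ℝ) < 1 / 2} :=
  measurableSet_lt measurable_subtype_coe measurable_const

lemma ae_mem_Ioc : ∀ᵐ x : I, (x : ℝ) ∈ Set.Ioc (0 : ℝ) 1 := by
  have : ∀ᵐ x : I, x ≠ 0 := by
    rw [ae_iff]
    simp
  filter_upwards [this] with x hx
  exact ⟨lt_of_le_of_ne x.2.1 fun h => hx (Subtype.ext h.symm), x.2.2⟩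

lemma mass_mono {r s : ℝ → ℝ} (hr : Integrable fun x : I => r x) (hs : Integrable fun x : I => s x)
    (h : ∀ x ∈ Set.Ioc (0 : ℝ) 1, r x ≤ s x) : mass r ≤ mass s := by
  refine integral_mono_ae hr hs ?_
  filter_upwards [ae_mem_Ioc] with x hx using h x hx

lemma integrable_ite_lt_half {F : I → ℝ} (hF : Integrable F) :
    Integrable fun x : I => if (x : ℝ) < 1 / 2 then F x else 0 := by
  refine (hF.indicator measurable_lt_half).congr (ae_of_all _ fun x => ?_)
  simp only [Set.indicator, Set.mem_ofPred_eq]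

lemma integrable_ite_not_lt_half {F : I → ℝ} (hF : Integrable F) :
    Integrable fun x : I => if (x : ℝ) < 1 / 2 then 0 else F x := by
  refine (hF.sub (integrable_ite_lt_half hF)).congr (ae_of_all _ fun x => ?_)
  simp only [Pi.sub_apply]
  split_ifs <;> simp

lemma integrable_leftOp (a : ℝ≥0) {r : ℝ → ℝ} (hr : Integrable fun x : I => r x) :
    Integrable fun x : I => leftOp a r x := by
  have := (integrable_leftOp_mul a r fun _ => 1).2 ?_
  · simpa using this
  · simpa only [mul_one] using integrable_ite_lt_half hr

lemma integrable_rightOp {r : ℝ → ℝ} (hr : Integrable fun x : I => r x) :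
    Integrable fun x : I => rightOp r x := by
  have := (integrable_rightOp_mul 0 r fun _ => 1).2 ?_
  · simpa using this
  · simpa only [mul_one] using integrable_ite_not_lt_half hr

lemma integrable_transferOp (a : ℝ≥0) {r : ℝ → ℝ} (hr : Integrable fun x : I => r x) :
    Integrable fun x : I => transferOp a r x :=
  (integrable_leftOp a hr).add (integrable_rightOp hr)

lemma integral_transferOp_mul (a : ℝ≥0) {r : ℝ → ℝ} {B : I → ℝ}
    (h : Integrable fun x : I => r x * B (pmMap a x)) :
    ∫ x : I, transferOp a r x * B x = ∫ x : I, r x * B (pmMap a x) := by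
  have h1 := integrable_ite_lt_half h
  have h2 := integrable_ite_not_lt_half h
  have h1' := (integrable_leftOp_mul a r B).2 h1
  have h2' := (integrable_rightOp_mul a r B).2 h2
  simp only [transferOp, add_mul]
  rw [integral_add h1' h2', integral_leftOp_mul, integral_rightOp_mul a, ← integral_add h1 h2]
  congr with x
  split_ifs <;> simp

lemma mass_transferOp (a : ℝ≥0) {r : ℝ → ℝ} (hr : Integrable fun x : I => r x) :
    mass (transferOp a r) = mass r := by
  have := integral_transferOp_mul a (r := r) (B := fun _ => 1) (by simpa using hr)
  simpa [mass] using this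

lemma mass_leftOp_add_rightOp (a : ℝ≥0) {r : ℝ → ℝ} (hr : Integrable fun x : I => r x) :
    mass (leftOp a r) + mass (rightOp r) = mass r := by
  rw [← mass_transferOp a hr]
  exact (integral_add (integrable_leftOp a hr) (integrable_rightOp hr)).symm

lemma half_add_mem {x : ℝ} (hx : x ∈ Set.Ioc (0 : ℝ) 1) : (x + 1) / 2 ∈ Set.Ioc (0 : ℝ) 1 :=
  ⟨by linarith [hx.1], by linarith [hx.2]⟩

lemma leftInv_mem_Ioc (a : ℝ≥0) {x : ℝ} (hx : x ∈ Set.Ioc (0 : ℝ) 1) :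
    leftInv a x ∈ Set.Ioc (0 : ℝ) 1 :=
  ⟨leftInv_pos a hx, by linarith [(leftInv_mem a (Set.Ioc_subset_Icc_self hx)).2]⟩

lemma leftInv_mono_Ioc (a : ℝ≥0) {x y : ℝ} (hx : x ∈ Set.Ioc (0 : ℝ) 1)
    (hy : y ∈ Set.Ioc (0 : ℝ) 1) (hxy : x ≤ y) : leftInv a x ≤ leftInv a y :=
  leftInv_mono a (Set.Ioc_subset_Icc_self hx) (Set.Ioc_subset_Icc_self hy) hxy

lemma leftDeriv_mono (a : ℝ≥0) {y z : ℝ} (hy : 0 ≤ y) (h : y ≤ z) :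
    leftDeriv a y ≤ leftDeriv a z := by
  have := two_mul_rpow_mono a hy h
  unfold leftDeriv
  gcongr

lemma leftOp_nonneg (a : ℝ≥0) {r : ℝ → ℝ} (h : ∀ x ∈ Set.Ioc (0 : ℝ) 1, 0 ≤ r x) :
    ∀ x ∈ Set.Ioc (0 : ℝ) 1, 0 ≤ leftOp a r x := fun _ hx =>
  div_nonneg (h _ (leftInv_mem_Ioc a hx)) (leftDeriv_pos a (leftInv_pos a hx).le).le

lemma rightOp_nonneg {r : ℝ → ℝ} (h : ∀ x ∈ Set.Ioc (0 : ℝ) 1, 0 ≤ r x) :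
    ∀ x ∈ Set.Ioc (0 : ℝ) 1, 0 ≤ rightOp r x := fun _ hx =>
  div_nonneg (h _ (half_add_mem hx)) (by norm_num)

lemma leftOp_anti (a : ℝ≥0) {r : ℝ → ℝ} (h : ∀ x ∈ Set.Ioc (0 : ℝ) 1, 0 ≤ r x)
    (hr : AntitoneOn r (Set.Ioc 0 1)) : AntitoneOn (leftOp a r) (Set.Ioc 0 1) := by
  intro x hx y hy hxy
  have := leftInv_mono_Ioc a hx hy hxy
  exact div_le_div₀ (h _ (leftInv_mem_Ioc a hx))
    (hr (leftInv_mem_Ioc a hx) (leftInv_mem_Ioc a hy) this)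
    (leftDeriv_pos a (leftInv_pos a hx).le) (leftDeriv_mono a (leftInv_pos a hx).le this)

lemma rightOp_anti {r : ℝ → ℝ} (hr : AntitoneOn r (Set.Ioc 0 1)) :
    AntitoneOn (rightOp r) (Set.Ioc 0 1) := by
  intro x hx y hy hxy
  have := hr (half_add_mem hx) (half_add_mem hy) (by linarith)
  unfold rightOp
  linarith

lemma one_add_rpow_div_mono {b c u v : ℝ} (hb : 1 ≤ b) (hc0 : 0 ≤ c) (hc : c ≤ b) (hu : 0 ≤ u)
    (huv : u ≤ v) : (1 + u) ^ b / (1 + c * u) ≤ (1 + v) ^ b / (1 + c * v) := by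
  have hu1 : 0 < 1 + u := by linarith
  have hcu : 0 < 1 + c * u := by positivity
  have hcv : 0 < 1 + c * v := by have := hu.trans huv; positivity
  rw [div_le_div_iff₀ hcu hcv]
  set t := (v - u) / (1 + u) with ht
  have ht0 : 0 ≤ t := div_nonneg (by linarith) hu1.le
  have hv : 1 + v = (1 + u) * (1 + t) := by rw [ht]; field_simp; ring
  have hB : 1 + b * t ≤ (1 + t) ^ b := one_add_mul_self_le_rpow_one_add (by linarith) hb
  rw [hv, Real.mul_rpow hu1.le (by linarith), mul_assoc]
  refine mul_le_mul_of_nonneg_left ?_ (Real.rpow_nonneg hu1.le b)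
  have hvt : v = u + (1 + u) * t := by linarith
  calc 1 + c * v ≤ (1 + b * t) * (1 + c * u) := by
        rw [hvt]
        have h1 : 0 ≤ (b - c) * t := mul_nonneg (by linarith) ht0
        have h2 : 0 ≤ (b - 1) * (c * u * t) := mul_nonneg (by linarith) (by positivity)
        nlinarith
    _ ≤ _ := mul_le_mul_of_nonneg_right hB hcu.le

lemma Reg.leftOp {b : ℝ} {r : ℝ → ℝ} (hr : Reg b r) {a : ℝ≥0} (ha : 1 + (a : ℝ) ≤ b) :
    Reg b (leftOp a r) where
  nonneg := leftOp_nonneg a hr.nonneg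
  anti := leftOp_anti a hr.nonneg hr.anti
  int := integrable_leftOp a hr.int
  mono := by
    have key : ∀ x ∈ Set.Ioc (0 : ℝ) 1, x ^ b * Intermittent.leftOp a r x =
        ((leftInv a x) ^ b * r (leftInv a x)) *
          ((1 + 2 ^ (a : ℝ) * (leftInv a x) ^ (a : ℝ)) ^ b /
            (1 + (1 + a) * (2 ^ (a : ℝ) * (leftInv a x) ^ (a : ℝ)))) := by
      intro x hx
      have h0 := two_mul_rpow_nonneg a (leftInv_pos a hx).le
      have hx' := leftMap_leftInv a (Set.Ioc_subset_Icc_self hx)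
      have hx2 : x ^ b = (leftInv a x) ^ b *
          (1 + 2 ^ (a : ℝ) * (leftInv a x) ^ (a : ℝ)) ^ b := by
        rw [← Real.mul_rpow (leftInv_pos a hx).le (by linarith)]
        exact congrArg (· ^ b) hx'.symm
      rw [hx2]
      simp only [Intermittent.leftOp, leftDeriv]
      ring
    intro x hx y hy hxy
    simp only
    rw [key x hx, key y hy]
    have hmono := leftInv_mono_Ioc a hx hy hxy
    have hmx := leftInv_mem_Ioc a hx
    have hmy := leftInv_mem_Ioc a hy
    have h0 := two_mul_rpow_nonneg a (leftInv_pos a hx).le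
    apply mul_le_mul (hr.mono hmx hmy hmono)
    · exact one_add_rpow_div_mono (by linarith [a.2]) (by positivity) ha
        h0 (two_mul_rpow_mono a hmx.1.le hmono)
    · positivity
    · exact mul_nonneg (Real.rpow_nonneg hmy.1.le _) (hr.nonneg _ hmy)

lemma Reg.rightOp_mono {b : ℝ} (hb : 0 ≤ b) {r : ℝ → ℝ} (hr : Reg b r) :
    MonotoneOn (fun x => x ^ (b / 2) * rightOp r x) (Set.Ioc 0 1) := by
  have key : ∀ x ∈ Set.Ioc (0 : ℝ) 1, x ^ (b / 2) * rightOp r x =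
      (x / ((x + 1) / 2) ^ 2) ^ (b / 2) * (((x + 1) / 2) ^ b * r ((x + 1) / 2)) / 2 := by
    intro x hx
    have h1 : 0 < (x + 1) / 2 := (half_add_mem hx).1
    rw [Real.div_rpow hx.1.le (by positivity), ← Real.rpow_natCast, ← Real.rpow_mul h1.le]
    have : ((2 : ℕ) : ℝ) * (b / 2) = b := by push_cast; ring
    rw [this, rightOp]
    have := (Real.rpow_pos_of_pos h1 b).ne'
    field_simp
  intro x hx y hy hxy
  simp only
  rw [key x hx, key y hy]
  have h1 := (half_add_mem hx).1
  have h2 := (half_add_mem hy).1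
  have h3 := hr.mono (half_add_mem hx) (half_add_mem hy) (by linarith)
  have h4 : x / ((x + 1) / 2) ^ 2 ≤ y / ((y + 1) / 2) ^ 2 := by
    rw [div_le_div_iff₀ (by positivity) (by positivity)]
    have : 0 ≤ (y - x) * (1 - x * y) :=
      mul_nonneg (by linarith) (by nlinarith [hx.1, hx.2, hy.1, hy.2])
    nlinarith
  have h5 : 0 ≤ x / ((x + 1) / 2) ^ 2 := div_nonneg hx.1.le (by positivity)
  have h6 := Real.rpow_le_rpow h5 h4 (show 0 ≤ b / 2 by linarith)
  have h7 := mul_le_mul h6 h3 (mul_nonneg (Real.rpow_nonneg h1.le _) (hr.nonneg _ (half_add_mem hx)))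
    (Real.rpow_nonneg (h5.trans h4) _)
  simp only at h7
  linarith

lemma one_mem_Ioc : (1 : ℝ) ∈ Set.Ioc (0 : ℝ) 1 := ⟨one_pos, le_rfl⟩

/-- A constant up to half of the minimum can be removed from the right-branch contribution of a
regular density. -/
lemma Reg.rightOp_sub {b : ℝ} (hb : 0 ≤ b) {r : ℝ → ℝ} (hr : Reg b r) {θ : ℝ} (hθ0 : 0 ≤ θ)
    (hθ : θ ≤ rightOp r 1 / 2) : Reg b (fun x => rightOp r x - θ) where
  nonneg x hx := by
    have := rightOp_anti hr.anti hx one_mem_Ioc hx.2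
    linarith
  anti := fun x hx y hy hxy => sub_le_sub_right (rightOp_anti hr.anti hx hy hxy) θ
  int := (integrable_rightOp hr.int).sub (integrable_const _)
  mono := by
    intro x hx y hy hxy
    have h1 := hr.rightOp_mono hb hx hy hxy
    simp only at h1 ⊢
    have hsq : ∀ z ∈ Set.Ioc (0 : ℝ) 1, z ^ b = (z ^ (b / 2)) ^ 2 := by
      intro z hz
      rw [← Real.rpow_natCast, ← Real.rpow_mul hz.1.le]
      congr 1
      push_cast
      ring
    rw [hsq x hx, hsq y hy]
    have hX : 0 < x ^ (b / 2) := Real.rpow_pos_of_pos hx.1 _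
    have hXY : x ^ (b / 2) ≤ y ^ (b / 2) := Real.rpow_le_rpow hx.1.le hxy (by linarith)
    have hR := rightOp_anti hr.anti hy one_mem_Ioc hy.2
    generalize x ^ (b / 2) = X at *
    generalize y ^ (b / 2) = Y at *
    generalize rightOp r x = p at *
    generalize rightOp r y = q at *
    have h2 : X * (X * p) ≤ X * (Y * q) := mul_le_mul_of_nonneg_left h1 hX.le
    have h3 : 0 ≤ (Y - X) * (Y * q - θ * (X + Y)) := by
      refine mul_nonneg (by linarith) ?_
      have : 2 * θ ≤ q := by linarith
      nlinarith
    nlinarith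

lemma Reg.rightOp {b : ℝ} (hb : 0 ≤ b) {r : ℝ → ℝ} (hr : Reg b r) : Reg b (rightOp r) := by
  have := hr.rightOp_sub hb le_rfl
    (div_nonneg (rightOp_nonneg hr.nonneg 1 one_mem_Ioc) two_pos.le)
  simpa using this

lemma Reg.add {b : ℝ} {r s : ℝ → ℝ} (hr : Reg b r) (hs : Reg b s) :
    Reg b (fun x => r x + s x) where
  nonneg x hx := add_nonneg (hr.nonneg x hx) (hs.nonneg x hx)
  anti := hr.anti.add hs.anti
  int := hr.int.add hs.int
  mono x hx y hy hxy := by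
    have := add_le_add (hr.mono hx hy hxy) (hs.mono hx hy hxy)
    simp only at this ⊢
    linarith

lemma Reg.const_mul {b c : ℝ} (hc : 0 ≤ c) {r : ℝ → ℝ} (hr : Reg b r) :
    Reg b (fun x => c * r x) where
  nonneg x hx := mul_nonneg hc (hr.nonneg x hx)
  anti := fun x hx y hy hxy => mul_le_mul_of_nonneg_left (hr.anti hx hy hxy) hc
  int := hr.int.const_mul c
  mono x hx y hy hxy := by
    have := mul_le_mul_of_nonneg_left (hr.mono hx hy hxy) hc
    simp only at this ⊢
    linarith

lemma Reg.transferOp {b : ℝ} {r : ℝ → ℝ} (hr : Reg b r) {a : ℝ≥0} (ha : 1 + (a : ℝ) ≤ b) :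
    Reg b (transferOp a r) :=
  (hr.leftOp ha).add (hr.rightOp (by linarith [a.2]))

/-- Removing a constant after one application of the transfer operator. -/
lemma Reg.transferOp_sub {b : ℝ} {r : ℝ → ℝ} (hr : Reg b r) {a : ℝ≥0} (ha : 1 + (a : ℝ) ≤ b)
    {θ : ℝ} (hθ0 : 0 ≤ θ) (hθ : θ ≤ r 1 / 4) :
    Reg b (fun x => Intermittent.transferOp a r x - θ) := by
  have h : θ ≤ Intermittent.rightOp r 1 / 2 := by
    simp only [Intermittent.rightOp]
    norm_num
    linarith
  have := (hr.leftOp ha).add (hr.rightOp_sub (by linarith [a.2]) hθ0 h)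
  simpa only [Intermittent.transferOp, add_sub_assoc] using this

lemma reg_one {b : ℝ} (hb : 0 ≤ b) : Reg b (fun _ => 1) where
  nonneg _ _ := zero_le_one
  anti := fun _ _ _ _ _ => le_rfl
  int := integrable_const _
  mono x hx y _ hxy := by simpa using Real.rpow_le_rpow hx.1.le hxy hb

lemma mass_one : mass (fun _ => 1) = 1 := by simp [mass]

/-- A regular density is bounded below by a multiple of the mass of its right-branch
contribution. -/
lemma Reg.mass_rightOp_le {b : ℝ} (hb : 0 ≤ b) {r : ℝ → ℝ} (hr : Reg b r) :
    mass (Intermittent.rightOp r) ≤ 2 ^ b * Intermittent.rightOp r 1 := by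
  have : mass (fun _ => 2 ^ b * Intermittent.rightOp r 1) = 2 ^ b * Intermittent.rightOp r 1 := by
    simp [mass]
  rw [← this]
  refine mass_mono (integrable_rightOp hr.int) (integrable_const _) fun x hx => ?_
  have h1 := half_add_mem hx
  have h2 := hr.mono h1 one_mem_Ioc h1.2
  simp only [Real.one_rpow, one_mul] at h2
  have h3 : (1 / 2 : ℝ) ^ b ≤ ((x + 1) / 2) ^ b :=
    Real.rpow_le_rpow (by norm_num) (by linarith [hx.1]) hb
  have h4 : (1 / 2 : ℝ) ^ b * r ((x + 1) / 2) ≤ r 1 :=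
    (mul_le_mul_of_nonneg_right h3 (hr.nonneg _ h1)).trans h2
  rw [Real.div_rpow zero_le_one two_pos.le, Real.one_rpow, one_div, inv_mul_le_iff₀ (by positivity)]
    at h4
  simp only [Intermittent.rightOp]
  norm_num
  linarith

/-- The transfer operator of a composition of maps; the head of the list acts first. -/
noncomputable def transferList : List ℝ≥0 → (ℝ → ℝ) → ℝ → ℝ
  | [], r => r
  | a :: l, r => transferList l (transferOp a r)

/-- The part of the transfer operator that only uses left branches. -/
noncomputable def leftList : List ℝ≥0 → (ℝ → ℝ) → ℝ → ℝ
  | [], r => r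
  | a :: l, r => leftList l (leftOp a r)

/-- Composition of maps along a list; the head of the list acts first. -/
noncomputable def compList : List ℝ≥0 → I → I
  | [], x => x
  | a :: l, x => compList l (pmMap a x)

lemma transferList_append (l l' : List ℝ≥0) (r : ℝ → ℝ) :
    transferList (l ++ l') r = transferList l' (transferList l r) := by
  induction l generalizing r with
  | nil => rfl
  | cons a l ih => exact ih _

lemma compList_append (l l' : List ℝ≥0) (x : I) :
    compList (l ++ l') x = compList l' (compList l x) := by
  induction l generalizing x with
  | nil => rfl
  | cons a l ih => exact ih _

lemma transferOp_add (a : ℝ≥0) (r s : ℝ → ℝ) :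
    transferOp a (fun x => r x + s x) = fun x => transferOp a r x + transferOp a s x := by
  funext x
  simp only [transferOp, leftOp, rightOp]
  ring

lemma transferOp_const_mul (a : ℝ≥0) (c : ℝ) (r : ℝ → ℝ) :
    transferOp a (fun x => c * r x) = fun x => c * transferOp a r x := by
  funext x
  simp only [transferOp, leftOp, rightOp]
  ring

lemma transferList_add (l : List ℝ≥0) (r s : ℝ → ℝ) :
    transferList l (fun x => r x + s x) = fun x => transferList l r x + transferList l s x := by
  induction l generalizing r s with
  | nil => rfl
  | cons a l ih => simp only [transferList, transferOp_add, ih]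

lemma transferList_const_mul (l : List ℝ≥0) (c : ℝ) (r : ℝ → ℝ) :
    transferList l (fun x => c * r x) = fun x => c * transferList l r x := by
  induction l generalizing r with
  | nil => rfl
  | cons a l ih => simp only [transferList, transferOp_const_mul, ih]

lemma transferList_sub (l : List ℝ≥0) (r s : ℝ → ℝ) :
    transferList l (fun x => r x - s x) = fun x => transferList l r x - transferList l s x := by
  have h : (fun x => r x - s x) = fun x => r x + (-1) * s x := by
    funext x
    ring
  rw [h, transferList_add, transferList_const_mul]
  funext x
  ring

lemma transferList_sum {ι : Type*} (t : Finset ι) (l : List ℝ≥0) (r : ι → ℝ → ℝ) :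
    transferList l (fun x => ∑ i ∈ t, r i x) = fun x => ∑ i ∈ t, transferList l (r i) x := by
  classical
  induction t using Finset.induction_on with
  | empty =>
    have := transferList_const_mul l 0 (fun _ => 0)
    simpa using this
  | insert i t hi ih =>
    simp only [Finset.sum_insert hi]
    rw [transferList_add, ih]

lemma transferOp_mono (a : ℝ≥0) {r s : ℝ → ℝ} (h : ∀ x ∈ Set.Ioc (0 : ℝ) 1, r x ≤ s x) :
    ∀ x ∈ Set.Ioc (0 : ℝ) 1, transferOp a r x ≤ transferOp a s x := by
  intro x hx
  have h1 := h _ (leftInv_mem_Ioc a hx)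
  have h2 := h _ (half_add_mem hx)
  have h3 := leftDeriv_pos a (leftInv_pos a hx).le
  simp only [transferOp, leftOp, rightOp]
  gcongr

lemma transferList_mono (l : List ℝ≥0) {r s : ℝ → ℝ} (h : ∀ x ∈ Set.Ioc (0 : ℝ) 1, r x ≤ s x) :
    ∀ x ∈ Set.Ioc (0 : ℝ) 1, transferList l r x ≤ transferList l s x := by
  induction l generalizing r s with
  | nil => exact h
  | cons a l ih => exact ih (transferOp_mono a h)

lemma integrable_transferList (l : List ℝ≥0) {r : ℝ → ℝ} (hr : Integrable fun x : I => r x) :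
    Integrable fun x : I => transferList l r x := by
  induction l generalizing r with
  | nil => exact hr
  | cons a l ih => exact ih (integrable_transferOp a hr)

lemma mass_transferList (l : List ℝ≥0) {r : ℝ → ℝ} (hr : Integrable fun x : I => r x) :
    mass (transferList l r) = mass r := by
  induction l generalizing r with
  | nil => rfl
  | cons a l ih => exact (ih (integrable_transferOp a hr)).trans (mass_transferOp a hr)

lemma measurable_pmMap (a : ℝ≥0) : Measurable (pmMap a) := by
  refine Measurable.subtype_mk ?_
  refine Measurable.ite measurable_lt_half ?_ ?_ <;> fun_prop

lemma measurable_compList (l : List ℝ≥0) : Measurable (compList l) := by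
  induction l with
  | nil => exact measurable_id
  | cons a l ih => exact ih.comp (measurable_pmMap a)

lemma Reg.transferList {b : ℝ} {l : List ℝ≥0} (hl : ∀ a ∈ l, 1 + (a : ℝ) ≤ b) {r : ℝ → ℝ}
    (hr : Reg b r) : Reg b (transferList l r) := by
  induction l generalizing r with
  | nil => exact hr
  | cons a l ih =>
    exact ih (fun c hc => hl c (List.mem_cons_of_mem _ hc))
      (hr.transferOp (hl a List.mem_cons_self))

/-- Decreasing densities of mass at most one dominated by `3 x ^ (-β)`. -/
structure Dominated (β : ℝ) (G : ℝ → ℝ) : Prop where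
  nonneg : ∀ x ∈ Set.Ioc (0 : ℝ) 1, 0 ≤ G x
  anti : AntitoneOn G (Set.Ioc 0 1)
  int : Integrable fun x : I => G x
  mass_le : mass G ≤ 1
  le : ∀ x ∈ Set.Ioc (0 : ℝ) 1, G x ≤ 3 * x ^ (-β)

lemma rightOp_le_mass {G : ℝ → ℝ} (h0 : ∀ x ∈ Set.Ioc (0 : ℝ) 1, 0 ≤ G x)
    (hG : AntitoneOn G (Set.Ioc 0 1)) (hi : Integrable fun x : I => G x) {x : ℝ}
    (hx : x ∈ Set.Ioc (0 : ℝ) 1) : rightOp G x ≤ mass G := by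
  have h1 : mass (leftOp 0 G) ≤ mass G := by
    have := mass_leftOp_add_rightOp 0 hi
    have h2 : 0 ≤ mass (rightOp G) := by
      refine integral_nonneg_of_ae ?_
      filter_upwards [ae_mem_Ioc] with y hy using rightOp_nonneg h0 y hy
    linarith
  have h2 : mass (fun _ => rightOp G x) = rightOp G x := by simp [mass]
  rw [← h2]
  refine le_trans (mass_mono (integrable_const _) (integrable_leftOp 0 hi) fun y hy => ?_) h1
  have h3 := leftInv_mem 0 (Set.Ioc_subset_Icc_self hy)
  have h4 : leftDeriv 0 (leftInv 0 y) = 2 := by simp [leftDeriv]; norm_num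
  have h5 := hG (leftInv_mem_Ioc 0 hy) (half_add_mem hx) (by linarith [h3.2, hx.1])
  simp only [leftOp, rightOp, h4]
  linarith

lemma Dominated.transferOp {β : ℝ} (hβ0 : 0 < β) (hβ : β < 1 / 3) {G : ℝ → ℝ}
    (hG : Dominated β G) {a : ℝ≥0} (ha : (a : ℝ) ≤ β) : Dominated β (transferOp a G) where
  nonneg x hx := add_nonneg (leftOp_nonneg a hG.nonneg x hx) (rightOp_nonneg hG.nonneg x hx)
  anti := (leftOp_anti a hG.nonneg hG.anti).add (rightOp_anti hG.anti)
  int := integrable_transferOp a hG.int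
  mass_le := (mass_transferOp a hG.int).trans_le hG.mass_le
  le x hx := by
    have hR : rightOp G x ≤ 1 :=
      (rightOp_le_mass hG.nonneg hG.anti hG.int hx).trans hG.mass_le
    have hL := hG.le _ (leftInv_mem_Ioc a hx)
    have hy := leftInv_mem a (Set.Ioc_subset_Icc_self hx)
    have hy0 := leftInv_pos a hx
    have hxy := leftMap_leftInv a (Set.Ioc_subset_Icc_self hx)
    simp only [Intermittent.transferOp, leftOp, leftDeriv, leftMap] at hxy ⊢
    set y := leftInv a x with hydef
    have hu0 := two_mul_rpow_nonneg a hy0.le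
    have hu1 := two_mul_rpow_le_one a hy0.le hy.2
    have hyu : (2 * y) ^ β ≤ 2 ^ (a : ℝ) * y ^ (a : ℝ) := by
      rw [← Real.mul_rpow two_pos.le hy0.le]
      exact Real.rpow_le_rpow_of_exponent_ge (by positivity) (by linarith [hy.2]) ha
    set u := (2 : ℝ) ^ (a : ℝ) * y ^ (a : ℝ) with hu
    have ha0 : (0 : ℝ) ≤ a := a.2
    have hX : 0 < x ^ (-β) := Real.rpow_pos_of_pos hx.1 _
    have hYX : y ^ (-β) = x ^ (-β) * (1 + u) ^ β := by
      conv_rhs => rw [← hxy]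
      rw [Real.mul_rpow hy0.le (by linarith), Real.rpow_neg (by linarith : 0 ≤ 1 + u), mul_assoc,
        inv_mul_cancel₀ (Real.rpow_pos_of_pos (by linarith) _).ne', mul_one]
    have hB : (1 + u) ^ β ≤ 1 + β * u :=
      rpow_one_add_le_one_add_mul_self (by linarith) hβ0.le (by linarith)
    have hXu : 1 ≤ x ^ (-β) * u := by
      have h1 : x ^ β ≤ u := by
        refine le_trans (Real.rpow_le_rpow hx.1.le ?_ hβ0.le) hyu
        rw [← hxy]
        nlinarith
      rw [Real.rpow_neg hx.1.le, ← div_eq_inv_mul, le_div_iff₀ (Real.rpow_pos_of_pos hx.1 _)]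
      linarith
    have hden : 0 < 1 + (1 + (a : ℝ)) * u := by positivity
    have h1 : G y / (1 + (1 + (a : ℝ)) * u) ≤
        3 * (x ^ (-β) * (1 + β * u)) / (1 + (1 + (a : ℝ)) * u) := by
      gcongr
      refine hL.trans ?_
      rw [hYX]
      gcongr
    have h2 : 3 * (x ^ (-β) * (1 + β * u)) / (1 + (1 + (a : ℝ)) * u) + 1 ≤ 3 * x ^ (-β) := by
      rw [div_add_one hden.ne', div_le_iff₀ hden]
      generalize x ^ (-β) = X at *
      have h3 : (1 + (1 + (a : ℝ)) * u) ≤ 2 + a := by nlinarith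
      have h4 : (2 + (a : ℝ)) ≤ 3 * (1 + a - β) := by linarith
      have h5 : 3 * (1 + a - β) ≤ 3 * (1 + a - β) * (X * u) :=
        le_mul_of_one_le_right (by linarith) hXu
      nlinarith
    linarith

lemma Dominated.transferList {β : ℝ} (hβ0 : 0 < β) (hβ : β < 1 / 3) {G : ℝ → ℝ}
    (hG : Dominated β G) {l : List ℝ≥0} (hl : ∀ a ∈ l, (a : ℝ) ≤ β) :
    Dominated β (transferList l G) := by
  induction l generalizing G with
  | nil => exact hG
  | cons a l ih =>
    exact ih (hG.transferOp hβ0 hβ (hl a List.mem_cons_self))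
      (fun c hc => hl c (List.mem_cons_of_mem _ hc))

lemma integrable_rpow_unitInterval {s : ℝ} (hs : s < 1) :
    Integrable fun x : I => (x : ℝ) ^ (-s) := by
  rw [integrable_unitInterval]
  have h1 : IntegrableOn (fun x : ℝ => x ^ (-s)) (Set.Ioo 0 1) := by
    have := intervalIntegral.intervalIntegrable_rpow' (a := 0) (b := 1) (r := -s) (by linarith)
    rw [intervalIntegrable_iff_integrableOn_Ioo_of_le zero_le_one] at this
    exact this
  refine h1.congr_fun (fun x hx => ?_) measurableSet_Ioo
  rw [realExt, Set.projIcc_of_mem _ (Set.Ioo_subset_Icc_self hx)]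

lemma mass_rpow {s : ℝ} (hs : s < 1) : mass (fun x => x ^ (-s)) = (1 - s)⁻¹ := by
  rw [mass, integral_unitInterval]
  have h1 : ∫ x in Set.Ioo (0 : ℝ) 1, realExt (fun x : I => (x : ℝ) ^ (-s)) x =
      ∫ x in Set.Ioo (0 : ℝ) 1, x ^ (-s) := by
    refine setIntegral_congr_fun measurableSet_Ioo fun x hx => ?_
    simp only [realExt]
    rw [Set.projIcc_of_mem _ (Set.Ioo_subset_Icc_self hx)]
  rw [h1, ← integral_Ioc_eq_integral_Ioo, ← intervalIntegral.integral_of_le zero_le_one,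
    integral_rpow (Or.inl (by linarith)), Real.one_rpow, Real.zero_rpow (by linarith)]
  rw [neg_add_eq_sub, sub_zero, one_div]

/-- A regular dominated density of mass one is bounded below. -/
lemma Reg.le_of_mass_eq_one {β : ℝ} (hβ : β < 1 / 3) {r : ℝ → ℝ}
    (hr : Reg (1 + β) r) (hd : Dominated β r) (hm : mass r = 1) : 1 / 729 ≤ r 1 := by
  have h0 : 0 ≤ r 1 := hr.nonneg 1 one_mem_Ioc
  have key : ∀ x ∈ Set.Ioc (0 : ℝ) 1,
      r x ≤ 3 * (r 1) ^ (1 / 3 : ℝ) * x ^ (-(2 / 3) : ℝ) := by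
    intro x hx
    have hx0 := hr.nonneg x hx
    have h1 := hr.mono hx one_mem_Ioc hx.2
    simp only [Real.one_rpow, one_mul] at h1
    have h2 : r x ≤ r 1 * x ^ (-(1 + β)) := by
      rw [Real.rpow_neg hx.1.le, ← div_eq_mul_inv, le_div_iff₀ (Real.rpow_pos_of_pos hx.1 _)]
      linarith
    have h3 := hd.le x hx
    have h4 : r x = (r x) ^ (2 / 3 : ℝ) * (r x) ^ (1 / 3 : ℝ) := by
      rw [← Real.rpow_add' hx0 (by norm_num)]
      norm_num
    have h5 : (r x) ^ (2 / 3 : ℝ) ≤ 3 * x ^ (-β * (2 / 3)) := by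
      refine (Real.rpow_le_rpow hx0 h3 (by norm_num)).trans ?_
      rw [Real.mul_rpow (by norm_num) (Real.rpow_nonneg hx.1.le _), ← Real.rpow_mul hx.1.le]
      refine mul_le_mul_of_nonneg_right ?_ (Real.rpow_nonneg hx.1.le _)
      conv_rhs => rw [← Real.rpow_one 3]
      exact Real.rpow_le_rpow_of_exponent_le (by norm_num) (by norm_num)
    have h6 : (r x) ^ (1 / 3 : ℝ) ≤ (r 1) ^ (1 / 3 : ℝ) * x ^ (-(1 + β) * (1 / 3)) := by
      refine (Real.rpow_le_rpow hx0 h2 (by norm_num)).trans_eq ?_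
      rw [Real.mul_rpow h0 (Real.rpow_nonneg hx.1.le _), ← Real.rpow_mul hx.1.le]
    have h7 : x ^ (-β * (2 / 3)) * x ^ (-(1 + β) * (1 / 3)) ≤ x ^ (-(2 / 3) : ℝ) := by
      rw [← Real.rpow_add hx.1]
      exact Real.rpow_le_rpow_of_exponent_ge hx.1 hx.2 (by linarith)
    rw [h4]
    refine (mul_le_mul h5 h6 (Real.rpow_nonneg hx0 _)
      (mul_nonneg (by norm_num) (Real.rpow_nonneg hx.1.le _))).trans ?_
    calc 3 * x ^ (-β * (2 / 3)) * ((r 1) ^ (1 / 3 : ℝ) * x ^ (-(1 + β) * (1 / 3)))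
        = 3 * (r 1) ^ (1 / 3 : ℝ) * (x ^ (-β * (2 / 3)) * x ^ (-(1 + β) * (1 / 3))) := by ring
      _ ≤ _ := mul_le_mul_of_nonneg_left h7 (by positivity)
  have h1 := mass_mono hr.int
    ((integrable_rpow_unitInterval (s := 2 / 3) (by norm_num)).const_mul
      (3 * (r 1) ^ (1 / 3 : ℝ))) key
  have h2 : mass (fun x => 3 * (r 1) ^ (1 / 3 : ℝ) * x ^ (-(2 / 3) : ℝ)) =
      9 * (r 1) ^ (1 / 3 : ℝ) := by
    have := mass_rpow (s := 2 / 3) (by norm_num)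
    rw [mass] at this ⊢
    rw [integral_const_mul, this]
    norm_num
    ring
  rw [h2, hm] at h1
  have h3 : (1 / 9 : ℝ) ≤ (r 1) ^ (1 / 3 : ℝ) := by linarith
  have h4 := Real.rpow_le_rpow (by norm_num) h3 (show (0 : ℝ) ≤ 3 by norm_num)
  rw [← Real.rpow_mul h0] at h4
  norm_num at h4
  linarith

lemma dominated_one {β : ℝ} (hβ0 : 0 < β) : Dominated β (fun _ => 1) where
  nonneg _ _ := zero_le_one
  anti := fun _ _ _ _ _ => le_rfl
  int := integrable_const _
  mass_le := mass_one.le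
  le x hx := by
    have := Real.one_le_rpow_of_pos_of_le_one_of_nonpos hx.1 hx.2 (neg_nonpos.2 hβ0.le)
    linarith

lemma le_transferList_one {β : ℝ} (hβ0 : 0 < β) (hβ : β < 1 / 3) {l : List ℝ≥0}
    (hl : ∀ a ∈ l, (a : ℝ) ≤ β) {x : ℝ} (hx : x ∈ Set.Ioc (0 : ℝ) 1) :
    1 / 729 ≤ transferList l (fun _ => 1) x := by
  have h1 : Reg (1 + β) (transferList l fun _ => 1) :=
    (reg_one (by linarith)).transferList fun a ha => by linarith [hl a ha]
  refine le_trans ?_ (h1.anti hx one_mem_Ioc hx.2)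
  refine h1.le_of_mass_eq_one hβ ((dominated_one hβ0).transferList hβ0 hβ hl) ?_
  rw [mass_transferList l (integrable_const _), mass_one]

/-- The mass that has visited the right half of the interval spreads out evenly. -/
lemma Reg.escape {β : ℝ} (hβ0 : 0 < β) (hβ : β < 1 / 3) {l : List ℝ≥0}
    (hl : ∀ a ∈ l, (a : ℝ) ≤ β) {r : ℝ → ℝ} (hr : Reg (1 + β) r) {x : ℝ}
    (hx : x ∈ Set.Ioc (0 : ℝ) 1) :
    1 / 2916 * (mass r - mass (leftList l r)) ≤ Intermittent.transferList l r x := by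
  induction l generalizing r with
  | nil => simpa [leftList, Intermittent.transferList] using hr.nonneg x hx
  | cons a l ih =>
    have ha := hl a List.mem_cons_self
    have hl' : ∀ c ∈ l, (c : ℝ) ≤ β := fun c hc => hl c (List.mem_cons_of_mem _ hc)
    have h1 := ih hl' (hr.leftOp (a := a) (by linarith))
    have h2 := hr.mass_rightOp_le (by linarith)
    have h0 := rightOp_nonneg hr.nonneg 1 one_mem_Ioc
    have h3 : Intermittent.rightOp r 1 * (1 / 729) ≤
        Intermittent.transferList l (Intermittent.rightOp r) x := by
      refine le_trans ?_ (transferList_mono l (r := fun _ => Intermittent.rightOp r 1 * 1)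
        (fun y hy => ?_) x hx)
      · rw [transferList_const_mul l _ fun _ => 1]
        exact mul_le_mul_of_nonneg_left (le_transferList_one hβ0 hβ hl' hx) h0
      · rw [mul_one]
        exact rightOp_anti hr.anti hy one_mem_Ioc hy.2
    have h4 : (2 : ℝ) ^ (1 + β) ≤ 4 := by
      calc (2 : ℝ) ^ (1 + β) ≤ 2 ^ (2 : ℝ) :=
            Real.rpow_le_rpow_of_exponent_le (by norm_num) (by linarith)
        _ = 4 := by norm_num
    have h5 := mass_leftOp_add_rightOp a hr.int
    have h6 : Intermittent.transferList (a :: l) r x =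
        Intermittent.transferList l (Intermittent.leftOp a r) x +
          Intermittent.transferList l (Intermittent.rightOp r) x := by
      have := transferList_add l (Intermittent.leftOp a r) (Intermittent.rightOp r)
      exact congrFun this x
    rw [h6]
    simp only [leftList]
    have h7 : mass (Intermittent.rightOp r) ≤ 4 * Intermittent.rightOp r 1 :=
      h2.trans (mul_le_mul_of_nonneg_right h4 h0)
    linarith

/-- The points whose first iterates along the list all use the left branch. -/
def Trapped : List ℝ≥0 → I → Prop
  | [], _ => True
  | a :: l, x => (x : ℝ) < 1 / 2 ∧ Trapped l (pmMap a x)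

open Classical in
lemma mass_leftList (l : List ℝ≥0) (r : ℝ → ℝ) :
    mass (leftList l r) = ∫ x : I, if Trapped l x then r x else 0 := by
  induction l generalizing r with
  | nil => simp [leftList, Trapped, mass]
  | cons a l ih =>
    have h := integral_leftOp_mul a r fun x => if Trapped l x then 1 else 0
    simp only [leftList]
    rw [ih]
    simp only [mul_ite, mul_one, mul_zero] at h
    rw [h]
    refine integral_congr_ae (ae_of_all _ fun x => ?_)
    have hT : Trapped (a :: l) x ↔ (x : ℝ) < 1 / 2 ∧ Trapped l (pmMap a x) := Iff.rfl
    beta_reduce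
    by_cases h1 : (x : ℝ) < 1 / 2
    · by_cases h2 : Trapped l (pmMap a x)
      · rw [if_pos h1, if_pos h2, if_pos (hT.2 ⟨h1, h2⟩)]
      · rw [if_pos h1, if_neg h2, if_neg fun h => h2 (hT.1 h).2]
    · rw [if_neg h1, if_neg fun h => h1 (hT.1 h).1]

/-- The expansion gained in one step by an interval of length `Δ`. -/
lemma rpow_neg_add_le {β Δ δ : ℝ} (hβ0 : 0 < β) (hβ : β < 1 / 3) (hΔ0 : 0 < Δ) (hΔ : Δ ≤ 1 / 2)
    (h : Δ * (1 + (2 * Δ) ^ β) ≤ δ) : δ ^ (-β) + β / 2 ≤ Δ ^ (-β) := by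
  have hw0 : 0 < (2 * Δ) ^ β := Real.rpow_pos_of_pos (by linarith) _
  have hw1 : (2 * Δ) ^ β ≤ 1 := Real.rpow_le_one (by linarith) (by linarith) hβ0.le
  have hw : (2 * Δ) ^ β = 2 ^ β * Δ ^ β := Real.mul_rpow two_pos.le hΔ0.le
  set w := (2 * Δ) ^ β
  have hY : 0 < Δ ^ (-β) := Real.rpow_pos_of_pos hΔ0 _
  have h1 : δ ^ (-β) ≤ Δ ^ (-β) * (1 + w) ^ (-β) := by
    rw [← Real.mul_rpow hΔ0.le (by linarith)]
    exact Real.rpow_le_rpow_of_nonpos (by positivity) h (by linarith)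
  have h2 : (1 + w) ^ (-β) ≤ 1 - β * w / 2 := by
    have e : (1 + w) ^ (-β) = (1 + -(w / (1 + w))) ^ β := by
      rw [Real.rpow_neg (by linarith), ← Real.inv_rpow (by linarith)]
      congr 1
      field_simp
      ring
    rw [e]
    have h3 : w / (1 + w) ≤ 1 := by rw [div_le_one (by linarith)]; linarith
    refine (rpow_one_add_le_one_add_mul_self (by linarith) hβ0.le (by linarith)).trans ?_
    have h4 : w / 2 ≤ w / (1 + w) := by gcongr; linarith
    nlinarith
  have h3 : 1 ≤ Δ ^ (-β) * w := by
    rw [hw, Real.rpow_neg hΔ0.le]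
    have := (Real.rpow_pos_of_pos hΔ0 β).ne'
    have h5 : (1 : ℝ) ≤ 2 ^ β := Real.one_le_rpow (by norm_num) hβ0.le
    calc (1 : ℝ) ≤ 2 ^ β := h5
      _ = _ := by field_simp
  nlinarith

lemma le_leftMap {β : ℝ} {a : ℝ≥0} (ha : (a : ℝ) ≤ β) {x : ℝ} (hx0 : 0 < x) (hx : x ≤ 1 / 2) :
    x * (1 + (2 * x) ^ β) ≤ leftMap a x := by
  unfold leftMap
  rw [← Real.mul_rpow two_pos.le hx0.le]
  have := Real.rpow_le_rpow_of_exponent_ge (show 0 < 2 * x by linarith) (by linarith) ha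
  gcongr

lemma Trapped.le {β : ℝ} (hβ0 : 0 < β) (hβ : β < 1 / 3) {l : List ℝ≥0}
    (hl : ∀ a ∈ l, (a : ℝ) ≤ β) {x : I} (hx : (0 : ℝ) < x) (h : Trapped l x) :
    1 + β / 2 * l.length ≤ (x : ℝ) ^ (-β) := by
  induction l generalizing x with
  | nil =>
    simpa using Real.one_le_rpow_of_pos_of_le_one_of_nonpos hx x.2.2 (neg_nonpos.2 hβ0.le)
  | cons a l ih =>
    have h1 := le_leftMap (hl a List.mem_cons_self) hx h.1.le
    have h2 := rpow_neg_add_le hβ0 hβ hx h.1.le h1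
    rw [← coe_pmMap_of_lt h.1] at h1 h2
    have h3 : (0 : ℝ) < pmMap a x := lt_of_lt_of_le (by positivity) h1
    have h4 := ih (fun c hc => hl c (List.mem_cons_of_mem _ hc)) h3 h.2
    simp only [List.length_cons]
    push_cast
    linarith

/-- The mass trapped near the neutral fixed point decays polynomially. -/
lemma mass_leftList_le {β γ : ℝ} (hβ0 : 0 < β) (hβ : β < 1 / 3) (hγ0 : 0 ≤ γ)
    (hγ : β * (γ + 1) < 1) {l : List ℝ≥0} (hl : ∀ a ∈ l, (a : ℝ) ≤ β) {r : ℝ → ℝ}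
    (h0 : ∀ x ∈ Set.Ioc (0 : ℝ) 1, 0 ≤ r x)
    (hr : ∀ x ∈ Set.Ioc (0 : ℝ) 1, r x ≤ 3 * x ^ (-β)) :
    mass (leftList l r) ≤
      3 * (1 - β * (γ + 1))⁻¹ * (β / 2) ^ (-γ) * ((l.length : ℝ) + 1) ^ (-γ) := by
  classical
  rw [mass_leftList]
  set n : ℝ := (l.length : ℝ)
  have hn : 0 ≤ n := Nat.cast_nonneg _
  set D : ℝ := (β / 2) ^ (-γ) * (n + 1) ^ (-γ) with hD
  have hD' : D = (β / 2 * (n + 1)) ^ (-γ) := by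
    rw [hD, Real.mul_rpow (by positivity) (by positivity)]
  have h1 : ∫ x : I, (if Trapped l x then r x else 0) ≤
      ∫ x : I, 3 * D * (x : ℝ) ^ (-(β * (γ + 1))) := by
    refine integral_mono_of_nonneg ?_ ((integrable_rpow_unitInterval hγ).const_mul _) ?_
    · filter_upwards [ae_mem_Ioc] with x hx
      simp only [Pi.zero_apply]
      split_ifs
      exacts [h0 x hx, le_rfl]
    · filter_upwards [ae_mem_Ioc] with x hx
      have hX : 0 < (x : ℝ) ^ (-β) := Real.rpow_pos_of_pos hx.1 _
      split_ifs with ht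
      · have h2 := ht.le hβ0 hβ hl hx.1
        have h3 : β / 2 * (n + 1) ≤ (x : ℝ) ^ (-β) := by
          change 1 + β / 2 * n ≤ _ at h2
          linarith
        have h4 : 1 ≤ ((x : ℝ) ^ (-β)) ^ γ * D := by
          rw [hD', Real.rpow_neg (by positivity : 0 ≤ β / 2 * (n + 1)), ← div_eq_mul_inv,
            le_div_iff₀ (by positivity), one_mul]
          exact Real.rpow_le_rpow (by positivity) h3 hγ0
        have h5 : (x : ℝ) ^ (-(β * (γ + 1))) = (x : ℝ) ^ (-β) * ((x : ℝ) ^ (-β)) ^ γ := by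
          rw [← Real.rpow_mul hx.1.le, ← Real.rpow_add hx.1]
          congr 1
          ring
        rw [h5]
        calc r x ≤ 3 * (x : ℝ) ^ (-β) * 1 := by rw [mul_one]; exact hr x hx
          _ ≤ 3 * (x : ℝ) ^ (-β) * (((x : ℝ) ^ (-β)) ^ γ * D) :=
            mul_le_mul_of_nonneg_left h4 (by positivity)
          _ = _ := by ring
      · have : 0 ≤ D := by rw [hD']; positivity
        have := Real.rpow_nonneg hx.1.le (-(β * (γ + 1)))
        positivity
  have h2 := mass_rpow hγ
  rw [mass] at h2
  rw [integral_const_mul, h2] at h1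
  refine h1.trans_eq ?_
  rw [hD]
  ring

lemma leftOp_sum {ι : Type*} (t : Finset ι) (a : ℝ≥0) (r : ι → ℝ → ℝ) :
    leftOp a (fun x => ∑ i ∈ t, r i x) = fun x => ∑ i ∈ t, leftOp a (r i) x := by
  funext x
  simp only [leftOp, Finset.sum_div]

lemma leftList_sum {ι : Type*} (t : Finset ι) (l : List ℝ≥0) (r : ι → ℝ → ℝ) :
    leftList l (fun x => ∑ i ∈ t, r i x) = fun x => ∑ i ∈ t, leftList l (r i) x := by
  induction l generalizing r with
  | nil => rfl
  | cons a l ih => simp only [leftList, leftOp_sum, ih]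

lemma Reg.leftList {b : ℝ} {l : List ℝ≥0} (hl : ∀ a ∈ l, 1 + (a : ℝ) ≤ b) {r : ℝ → ℝ}
    (hr : Reg b r) : Reg b (leftList l r) := by
  induction l generalizing r with
  | nil => exact hr
  | cons a l ih =>
    exact ih (fun c hc => hl c (List.mem_cons_of_mem _ hc))
      (hr.leftOp (hl a List.mem_cons_self))

lemma mass_sum {ι : Type*} (t : Finset ι) {r : ι → ℝ → ℝ}
    (hr : ∀ i ∈ t, Integrable fun x : I => r i x) :
    mass (fun x => ∑ i ∈ t, r i x) = ∑ i ∈ t, mass (r i) :=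
  integral_finsetSum t hr

lemma Reg.mass_nonneg {b : ℝ} {r : ℝ → ℝ} (hr : Reg b r) : 0 ≤ mass r := by
  refine integral_nonneg_of_ae ?_
  filter_upwards [ae_mem_Ioc] with x hx using hr.nonneg x hx

lemma mass_sub_const {r : ℝ → ℝ} (hr : Integrable fun x : I => r x) (θ : ℝ) :
    mass (fun x => r x - θ) = mass r - θ := by
  simp only [mass]
  rw [integral_sub hr (integrable_const _)]
  simp

lemma mass_abs_transferList_le (l : List ℝ≥0) {r : ℝ → ℝ} (hr : Integrable fun x : I => r x) :
    mass (fun x => |transferList l r x|) ≤ mass (fun x => |r x|) := by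
  have h := mass_transferList l (r := fun x => |r x|) hr.abs
  rw [← h]
  refine mass_mono (integrable_transferList l hr).abs (integrable_transferList l hr.abs)
    fun x hx => abs_le.2 ⟨?_, transferList_mono l (fun y _ => le_abs_self _) x hx⟩
  have h1 := transferList_mono l (r := fun y => (-1) * |r y|) (s := r)
    (fun y _ => by linarith [neg_abs_le (r y)]) x hx
  rw [transferList_const_mul] at h1
  linarith

/-- A pair of families of regular densities with equal masses, whose sums are dominated. -/
structure Coupled {ι : Type*} [Fintype ι] (β : ℝ) (r r' : ι → ℝ → ℝ) (G : ℝ → ℝ) (m : ℝ) :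
    Prop where
  reg : ∀ i, Reg (1 + β) (r i)
  reg' : ∀ i, Reg (1 + β) (r' i)
  mass_eq : ∀ i, mass (r i) = mass (r' i)
  le : ∀ x ∈ Set.Ioc (0 : ℝ) 1, ∑ i, r i x ≤ G x
  le' : ∀ x ∈ Set.Ioc (0 : ℝ) 1, ∑ i, r' i x ≤ G x
  dom : Dominated β G
  total : ∑ i, mass (r i) ≤ m

/-- The constant in the bound on the trapped mass. -/
noncomputable def trapConst (β γ : ℝ) : ℝ := 3 * (1 - β * (γ + 1))⁻¹ * (β / 2) ^ (-γ)

lemma trapConst_pos {β γ : ℝ} (hβ0 : 0 < β) (hγ : β * (γ + 1) < 1) : 0 < trapConst β γ := by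
  have : 0 < (1 - β * (γ + 1))⁻¹ := inv_pos.2 (by linarith)
  unfold trapConst
  positivity

lemma sum_mass_leftList_le {ι : Type*} [Fintype ι] {β γ : ℝ} (hβ0 : 0 < β) (hβ : β < 1 / 3)
    (hγ0 : 0 ≤ γ) (hγ : β * (γ + 1) < 1) {l : List ℝ≥0} (hl : ∀ a ∈ l, (a : ℝ) ≤ β)
    {r : ι → ℝ → ℝ} (hr : ∀ i, Reg (1 + β) (r i)) {G : ℝ → ℝ} (hG : Dominated β G)
    (hle : ∀ x ∈ Set.Ioc (0 : ℝ) 1, ∑ i, r i x ≤ G x) :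
    ∑ i, mass (leftList l (r i)) ≤ trapConst β γ * ((l.length : ℝ) + 1) ^ (-γ) := by
  rw [← mass_sum Finset.univ fun i _ =>
    ((hr i).leftList (l := l) fun a ha => by linarith [hl a ha]).int, ← leftList_sum]
  exact mass_leftList_le hβ0 hβ hγ0 hγ hl
    (fun x hx => Finset.sum_nonneg fun i _ => (hr i).nonneg x hx)
    (fun x hx => (hle x hx).trans (hG.le x hx))

section Coupling

variable {ι : Type*} [Fintype ι] {β γ : ℝ} {r r' : ι → ℝ → ℝ} {G : ℝ → ℝ} {m : ℝ}

/-- One coupling step: a fixed fraction of the mass of both families is matched. -/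
lemma Coupled.step (hβ0 : 0 < β) (hβ : β < 1 / 3) (hγ0 : 0 ≤ γ) (hγ : β * (γ + 1) < 1)
    (hc : Coupled β r r' G m) {l : List ℝ≥0} (hl : ∀ a ∈ l, (a : ℝ) ≤ β) {a : ℝ≥0}
    (ha : (a : ℝ) ≤ β) (hm : trapConst β γ * ((l.length : ℝ) + 1) ^ (-γ) ≤ m / 4) :
    ∃ s s' G', Coupled β s s' G' ((1 - 1 / 23328) * m) ∧ ∀ (i : ι) (x : ℝ),
      transferList (l ++ [a]) (r i) x - transferList (l ++ [a]) (r' i) x = s i x - s' i x := by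
  have hl' : ∀ a ∈ l, 1 + (a : ℝ) ≤ 1 + β := fun a ha => by linarith [hl a ha]
  set t : ι → ℝ := fun i => mass (leftList l (r i)) with ht
  set t' : ι → ℝ := fun i => mass (leftList l (r' i)) with ht'
  have hts : ∑ i, t i ≤ m / 4 :=
    (sum_mass_leftList_le hβ0 hβ hγ0 hγ hl hc.reg hc.dom hc.le).trans hm
  have hts' : ∑ i, t' i ≤ m / 4 :=
    (sum_mass_leftList_le hβ0 hβ hγ0 hγ hl hc.reg' hc.dom hc.le').trans hm
  have ht0 : ∀ i, 0 ≤ t i := fun i => ((hc.reg i).leftList hl').mass_nonneg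
  have ht0' : ∀ i, 0 ≤ t' i := fun i => ((hc.reg' i).leftList hl').mass_nonneg
  set θ : ι → ℝ := fun i => 1 / 11664 * max 0 (mass (r i) - t i - t' i) with hθ
  have hθ0 : ∀ i, 0 ≤ θ i := fun i => by positivity
  have hθ1 : ∀ i, θ i ≤ transferList l (r i) 1 / 4 := by
    intro i
    have h1 := (hc.reg i).escape hβ0 hβ hl one_mem_Ioc
    have h2 := ((hc.reg i).transferList hl').nonneg 1 one_mem_Ioc
    have h3 : max 0 (mass (r i) - t i - t' i) ≤ 2916 * transferList l (r i) 1 :=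
      max_le (by positivity) (by linarith [ht0' i])
    simp only [hθ]
    linarith
  have hθ1' : ∀ i, θ i ≤ transferList l (r' i) 1 / 4 := by
    intro i
    have h1 := (hc.reg' i).escape hβ0 hβ hl one_mem_Ioc
    have h2 := ((hc.reg' i).transferList hl').nonneg 1 one_mem_Ioc
    have h3 : max 0 (mass (r i) - t i - t' i) ≤ 2916 * transferList l (r' i) 1 :=
      max_le (by positivity) (by linarith [ht0 i, hc.mass_eq i])
    simp only [hθ]
    linarith
  have happ : ∀ u : ℝ → ℝ, transferList (l ++ [a]) u = transferOp a (transferList l u) :=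
    fun u => transferList_append l [a] u
  have hlist : ∀ c ∈ l ++ [a], (c : ℝ) ≤ β := by
    intro c hc
    rcases List.mem_append.1 hc with h | h
    · exact hl c h
    · rw [List.mem_singleton.1 h]
      exact ha
  have hdom : ∀ u : ι → ℝ → ℝ, (∀ x ∈ Set.Ioc (0 : ℝ) 1, ∑ i, u i x ≤ G x) →
      ∀ x ∈ Set.Ioc (0 : ℝ) 1, ∑ i, (transferOp a (transferList l (u i)) x - θ i) ≤
        transferList (l ++ [a]) G x := by
    intro u hu x hx
    have h1 := transferList_mono (l ++ [a]) hu x hx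
    rw [transferList_sum] at h1
    refine le_trans (Finset.sum_le_sum fun i _ => ?_) h1
    rw [happ]
    linarith [hθ0 i]
  have hmass : ∀ u : ℝ → ℝ, (Integrable fun x : I => u x) → ∀ θ : ℝ,
      mass (fun x => transferOp a (transferList l u) x - θ) = mass u - θ := by
    intro u hu θ
    rw [mass_sub_const (integrable_transferOp a (integrable_transferList l hu)),
      mass_transferOp a (integrable_transferList l hu), mass_transferList l hu]
  refine ⟨fun i x => transferOp a (transferList l (r i)) x - θ i,
    fun i x => transferOp a (transferList l (r' i)) x - θ i, transferList (l ++ [a]) G,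
    ⟨fun i => ?_, fun i => ?_, fun i => ?_, hdom r hc.le, hdom r' hc.le',
      hc.dom.transferList hβ0 hβ hlist, ?_⟩, fun i x => ?_⟩
  · exact ((hc.reg i).transferList hl').transferOp_sub (by linarith) (hθ0 i) (hθ1 i)
  · exact ((hc.reg' i).transferList hl').transferOp_sub (by linarith) (hθ0 i) (hθ1' i)
  · rw [hmass _ (hc.reg i).int, hmass _ (hc.reg' i).int, hc.mass_eq]
  · have h1 : ∑ i, mass (fun x => transferOp a (transferList l (r i)) x - θ i) =
        ∑ i, mass (r i) - ∑ i, θ i := by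
      rw [← Finset.sum_sub_distrib]
      exact Finset.sum_congr rfl fun i _ => hmass _ (hc.reg i).int _
    have h2 : 1 / 11664 * (∑ i, mass (r i) - ∑ i, t i - ∑ i, t' i) ≤ ∑ i, θ i := by
      rw [← Finset.sum_sub_distrib, ← Finset.sum_sub_distrib, Finset.mul_sum]
      refine Finset.sum_le_sum fun i _ => ?_
      simp only [hθ]
      gcongr
      exact le_max_right _ _
    have h3 := hc.total
    rw [h1]
    linarith
  · rw [happ, happ]
    ring

lemma Coupled.sum_mass_abs_le (hc : Coupled β r r' G m) :
    ∑ i, mass (fun x => |r i x - r' i x|) ≤ 2 * m := by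
  have h : ∀ i, mass (fun x => |r i x - r' i x|) ≤ 2 * mass (r i) := by
    intro i
    have h1 : mass (fun x => r i x + r' i x) = 2 * mass (r i) := by
      rw [two_mul]
      conv_rhs => rw [hc.mass_eq i]
      conv_rhs => enter [1]; rw [← hc.mass_eq i]
      exact integral_add (hc.reg i).int (hc.reg' i).int
    rw [← h1]
    refine mass_mono ((hc.reg i).int.sub (hc.reg' i).int).abs ((hc.reg i).int.add (hc.reg' i).int)
      fun x hx => abs_le.2 ⟨?_, ?_⟩
    · linarith [(hc.reg i).nonneg x hx]
    · linarith [(hc.reg' i).nonneg x hx]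
  calc _ ≤ ∑ i, 2 * mass (r i) := Finset.sum_le_sum fun i _ => h i
    _ = 2 * ∑ i, mass (r i) := by rw [Finset.mul_sum]
    _ ≤ _ := by linarith [hc.total]

lemma Coupled.iterate (hβ0 : 0 < β) (hβ : β < 1 / 3) (hγ0 : 0 ≤ γ) (hγ : β * (γ + 1) < 1)
    {n : ℕ → ℕ}
    (hn : ∀ J, trapConst β γ * ((n J : ℝ) + 1) ^ (-γ) ≤ (1 - 1 / 23328) ^ J / 4)
    (hc : Coupled β r r' G 1) (J : ℕ) {l : List ℝ≥0} (hl : ∀ a ∈ l, (a : ℝ) ≤ β)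
    (hlen : l.length = ∑ j ∈ Finset.range J, (n j + 1)) :
    ∃ s s' G', Coupled β s s' G' ((1 - 1 / 23328) ^ J) ∧ ∀ (i : ι) (x : ℝ),
      transferList l (r i) x - transferList l (r' i) x = s i x - s' i x := by
  induction J generalizing l with
  | zero =>
    rw [Finset.sum_range_zero, List.length_eq_zero_iff] at hlen
    subst hlen
    exact ⟨r, r', G, by simpa using hc, fun i x => rfl⟩
  | succ J ih =>
    rw [Finset.sum_range_succ] at hlen
    set k := ∑ j ∈ Finset.range J, (n j + 1)
    obtain ⟨s, s', G', h1, h2⟩ := ih (l := l.take k)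
      (fun a ha => hl a (List.mem_of_mem_take ha)) (by simp [hlen])
    have hd : (l.drop k).length = n J + 1 := by simp [hlen]
    rcases List.eq_nil_or_concat (l.drop k) with h | ⟨l', a, h⟩
    · simp [h] at hd
    rw [List.concat_eq_append] at h
    have hl' : l'.length = n J := by
      rw [h, List.length_append] at hd
      simpa using hd
    have hmem : ∀ c ∈ l' ++ [a], (c : ℝ) ≤ β := fun c hc' => by
      rw [← h] at hc'
      exact hl c (List.mem_of_mem_drop hc')
    obtain ⟨u, u', G'', h3, h4⟩ := h1.step hβ0 hβ hγ0 hγ (l := l') (a := a)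
      (fun c hc' => hmem c (List.mem_append_left _ hc')) (hmem a (by simp))
      (by rw [hl']; exact hn J)
    refine ⟨u, u', G'', by rw [pow_succ']; exact h3, fun i x => ?_⟩
    rw [← h4 i x]
    have hsplit : l = l.take k ++ (l' ++ [a]) := by rw [← h, List.take_append_drop]
    rw [hsplit, transferList_append (l.take k), transferList_append (l.take k)]
    have e1 := congrFun (transferList_sub (l' ++ [a]) (transferList (l.take k) (r i))
      (transferList (l.take k) (r' i))) x
    have e2 := congrFun (transferList_sub (l' ++ [a]) (s i) (s' i)) x
    rw [← e1, ← e2]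
    congr 1
    funext y
    exact h2 i y

end Coupling

/-- Polynomial loss of memory, uniformly over families of regular densities. -/
theorem exists_coupling_bound {β γ : ℝ} (hβ0 : 0 < β) (hβ : β < 1 / 3) (hγ0 : 0 < γ)
    (hγ : β * (γ + 1) < 1) :
    ∃ C : ℝ, 0 < C ∧ ∀ {ι : Type} [Fintype ι] {r r' : ι → ℝ → ℝ} {G : ℝ → ℝ},
      Coupled β r r' G 1 → ∀ l : List ℝ≥0, (∀ a ∈ l, (a : ℝ) ≤ β) →
      ∑ i, mass (fun x => |transferList l (r i) x - transferList l (r' i) x|) ≤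
        C * ((l.length : ℝ) + 1) ^ (-γ) := by
  set q : ℝ := 1 - 1 / 23328 with hq
  have hq0 : 0 < q := by norm_num [hq]
  have hq1 : q < 1 := by norm_num [hq]
  set s : ℝ := q ^ (-γ⁻¹) with hs
  have hs1 : 1 < s := Real.one_lt_rpow_of_pos_of_lt_one_of_neg hq0 hq1 (by simpa using hγ0)
  have hsq : ∀ J : ℕ, (s ^ J) ^ (-γ) = q ^ J := by
    intro J
    rw [hs, ← Real.rpow_natCast, ← Real.rpow_natCast, ← Real.rpow_mul hq0.le,
      ← Real.rpow_mul hq0.le]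
    congr 1
    field_simp
  have hK := trapConst_pos hβ0 hγ
  set K := trapConst β γ
  set c₁ : ℝ := (4 * K) ^ γ⁻¹ with hc₁
  have hc₁0 : 0 < c₁ := by positivity
  set n : ℕ → ℕ := fun J => ⌈c₁ * s ^ J⌉₊ with hn
  have hnJ : ∀ J, K * ((n J : ℝ) + 1) ^ (-γ) ≤ q ^ J / 4 := by
    intro J
    have h1 : c₁ * s ^ J ≤ (n J : ℝ) + 1 := (Nat.le_ceil _).trans (by linarith)
    have h2 : ((n J : ℝ) + 1) ^ (-γ) ≤ (c₁ * s ^ J) ^ (-γ) :=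
      Real.rpow_le_rpow_of_nonpos (by positivity) h1 (by linarith)
    have h3 : (c₁ * s ^ J) ^ (-γ) = (4 * K)⁻¹ * q ^ J := by
      rw [Real.mul_rpow hc₁0.le (by positivity), hsq, hc₁, ← Real.rpow_mul (by positivity)]
      congr 1
      rw [mul_neg, inv_mul_cancel₀ hγ0.ne', Real.rpow_neg_one]
    calc K * ((n J : ℝ) + 1) ^ (-γ) ≤ K * ((4 * K)⁻¹ * q ^ J) := by rw [← h3]; gcongr
      _ = q ^ J / 4 := by field_simp
  set c₂ : ℝ := (c₁ + 2) / (s - 1) + 1 with hc₂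
  have hs1' : 0 < s - 1 := by linarith
  have hc₂1 : 1 ≤ c₂ := by
    have : 0 ≤ (c₁ + 2) / (s - 1) := by positivity
    linarith
  have hc₂s : c₁ + 2 ≤ c₂ * (s - 1) := by
    rw [hc₂, add_mul, div_mul_cancel₀ _ hs1'.ne']
    linarith
  have ht : ∀ J : ℕ, ((∑ j ∈ Finset.range J, (n j + 1) : ℕ) : ℝ) ≤ c₂ * (s ^ J - 1) := by
    intro J
    induction J with
    | zero => simp
    | succ J ih =>
      rw [Finset.sum_range_succ]
      push_cast at ih ⊢
      have h1 : (n J : ℝ) ≤ c₁ * s ^ J + 1 := (Nat.ceil_lt_add_one (by positivity)).le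
      have h2 : (1 : ℝ) ≤ s ^ J := one_le_pow₀ hs1.le
      have h3 : (c₁ + 2) * s ^ J ≤ c₂ * (s - 1) * s ^ J := by gcongr
      rw [pow_succ]
      nlinarith
  refine ⟨2 * (c₂ * s) ^ γ, by positivity, ?_⟩
  intro ι _ r r' G hc l hl
  set N : ℝ := (l.length : ℝ) with hN
  have hN0 : 0 ≤ N := Nat.cast_nonneg _
  obtain ⟨J, hJ1, hJ2⟩ := exists_nat_pow_near (x := (N + c₂) / c₂) (y := s)
    (by rw [le_div_iff₀ (by linarith)]; linarith) hs1
  set k := ∑ j ∈ Finset.range J, (n j + 1) with hk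
  have hkN : k ≤ l.length := by
    have h1 := ht J
    rw [le_div_iff₀ (by linarith)] at hJ1
    have : (k : ℝ) ≤ N := by linarith
    rw [hN] at this
    exact_mod_cast this
  obtain ⟨u, u', G', h1, h2⟩ := hc.iterate hβ0 hβ hγ0.le hγ hnJ J (l := l.take k)
    (fun a ha => hl a (List.mem_of_mem_take ha)) (by rw [List.length_take, min_eq_left hkN])
  have h3 : ∀ i, mass (fun x => |transferList l (r i) x - transferList l (r' i) x|) ≤
      mass (fun x => |u i x - u' i x|) := by
    intro i
    refine le_trans (le_of_eq ?_) (mass_abs_transferList_le (l.drop k)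
      (r := fun x => u i x - u' i x) ((h1.reg i).int.sub (h1.reg' i).int))
    congr 1
    funext x
    congr 1
    have e : (fun x => u i x - u' i x) = fun x =>
        transferList (l.take k) (r i) x - transferList (l.take k) (r' i) x := by
      funext y
      exact (h2 i y).symm
    rw [e, transferList_sub, ← transferList_append, ← transferList_append, List.take_append_drop]
  refine (Finset.sum_le_sum fun i _ => h3 i).trans (h1.sum_mass_abs_le.trans ?_)
  rw [mul_assoc]
  refine mul_le_mul_of_nonneg_left ?_ two_pos.le
  rw [← hsq]
  have h4 : (N + 1) / (c₂ * s) ≤ s ^ J := by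
    rw [div_lt_iff₀ (by linarith), pow_succ] at hJ2
    rw [div_le_iff₀ (by positivity)]
    nlinarith
  refine (Real.rpow_le_rpow_of_nonpos (by positivity) h4 (by linarith)).trans_eq ?_
  rw [Real.div_rpow (by positivity) (by positivity), Real.rpow_neg (by positivity : 0 ≤ c₂ * s),
    div_inv_eq_mul, mul_comm]

/-- Two points have the same itinerary along the list. -/
def SameItinerary : List ℝ≥0 → I → I → Prop
  | [], _, _ => True
  | a :: l, x, x' =>
    ((x : ℝ) < 1 / 2 ↔ (x' : ℝ) < 1 / 2) ∧ SameItinerary l (pmMap a x) (pmMap a x')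

lemma SameItinerary.symm {l : List ℝ≥0} {x x' : I} (h : SameItinerary l x x') :
    SameItinerary l x' x := by
  induction l generalizing x x' with
  | nil => trivial
  | cons a l ih => exact ⟨h.1.symm, ih h.2⟩

lemma leftMap_sub_le {a : ℝ≥0} {x y : ℝ} (hy : 0 ≤ y) (hyx : y ≤ x) :
    leftMap a (x - y) ≤ leftMap a x - leftMap a y := by
  have h1 : y ^ (a : ℝ) ≤ x ^ (a : ℝ) := Real.rpow_le_rpow hy hyx a.2
  have h2 : (x - y) ^ (a : ℝ) ≤ x ^ (a : ℝ) :=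
    Real.rpow_le_rpow (by linarith) (by linarith) a.2
  have h3 : y * y ^ (a : ℝ) ≤ y * x ^ (a : ℝ) := mul_le_mul_of_nonneg_left h1 hy
  have h4 : (x - y) * (x - y) ^ (a : ℝ) ≤ (x - y) * x ^ (a : ℝ) :=
    mul_le_mul_of_nonneg_left h2 (by linarith)
  have h5 : (0 : ℝ) < 2 ^ (a : ℝ) := by positivity
  have h6 : 2 ^ (a : ℝ) * ((x - y) * (x - y) ^ (a : ℝ)) ≤
      2 ^ (a : ℝ) * (x * x ^ (a : ℝ) - y * y ^ (a : ℝ)) :=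
    mul_le_mul_of_nonneg_left (by linarith) h5.le
  unfold leftMap
  linarith

lemma le_pmMap_sub {β : ℝ} (hβ0 : 0 < β) {a : ℝ≥0} (ha : (a : ℝ) ≤ β) {x x' : I}
    (hxx : (x' : ℝ) < x) (h : (x : ℝ) < 1 / 2 ↔ (x' : ℝ) < 1 / 2) :
    (x : ℝ) - x' ≤ 1 / 2 ∧
      ((x : ℝ) - x') * (1 + (2 * ((x : ℝ) - x')) ^ β) ≤ (pmMap a x : ℝ) - pmMap a x' := by
  have hx0 := x.2.1
  have hx1 := x.2.2
  have hx'0 := x'.2.1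
  by_cases hx : (x : ℝ) < 1 / 2
  · have hle : (x : ℝ) - x' ≤ 1 / 2 := by linarith
    refine ⟨hle, ?_⟩
    rw [coe_pmMap_of_lt hx, coe_pmMap_of_lt (h.1 hx)]
    exact (le_leftMap ha (by linarith) hle).trans (leftMap_sub_le hx'0 hxx.le)
  · have hx' : ¬ (x' : ℝ) < 1 / 2 := fun h' => hx (h.2 h')
    rw [coe_pmMap_of_not_lt hx, coe_pmMap_of_not_lt hx']
    rw [not_lt] at hx hx'
    have hle : (x : ℝ) - x' ≤ 1 / 2 := by linarith
    refine ⟨hle, ?_⟩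
    have : (2 * ((x : ℝ) - x')) ^ β ≤ 1 := Real.rpow_le_one (by linarith) (by linarith) hβ0.le
    nlinarith

lemma SameItinerary.le_of_lt {β : ℝ} (hβ0 : 0 < β) (hβ : β < 1 / 3) {l : List ℝ≥0}
    (hl : ∀ a ∈ l, (a : ℝ) ≤ β) {x x' : I} (hxx : (x' : ℝ) < x) (h : SameItinerary l x x') :
    1 + β / 2 * l.length ≤ ((x : ℝ) - x') ^ (-β) := by
  induction l generalizing x x' with
  | nil =>
    have := x.2.2
    have := x'.2.1
    simpa using Real.one_le_rpow_of_pos_of_le_one_of_nonpos (sub_pos.2 hxx) (by linarith)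
      (neg_nonpos.2 hβ0.le)
  | cons a l ih =>
    obtain ⟨h1, h2⟩ := le_pmMap_sub hβ0 (hl a List.mem_cons_self) hxx h.1
    have h3 := rpow_neg_add_le hβ0 hβ (sub_pos.2 hxx) h1 h2
    have h4 : (pmMap a x' : ℝ) < pmMap a x := by
      have h0 : 0 < (x : ℝ) - x' := sub_pos.2 hxx
      have : 0 < ((x : ℝ) - x') * (1 + (2 * ((x : ℝ) - x')) ^ β) := by positivity
      linarith
    have h5 := ih (fun c hc => hl c (List.mem_cons_of_mem _ hc)) h4 h.2
    simp only [List.length_cons]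
    push_cast
    linarith

lemma SameItinerary.dist_le {β : ℝ} (hβ0 : 0 < β) (hβ : β < 1 / 3) {l : List ℝ≥0}
    (hl : ∀ a ∈ l, (a : ℝ) ≤ β) {x x' : I} (h : SameItinerary l x x') :
    dist x x' ≤ (β / 2) ^ (-β⁻¹) * ((l.length : ℝ) + 1) ^ (-β⁻¹) := by
  rw [Subtype.dist_eq, Real.dist_eq]
  wlog hxx : (x' : ℝ) < x generalizing x x'
  · rcases (not_lt.1 hxx).lt_or_eq with h1 | h1
    · rw [abs_sub_comm]
      exact this h.symm h1
    · rw [h1, sub_self, abs_zero]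
      positivity
  rw [abs_of_pos (sub_pos.2 hxx)]
  have h1 := h.le_of_lt hβ0 hβ hl hxx
  have h0 : 0 < (x : ℝ) - x' := sub_pos.2 hxx
  have h2 : β / 2 * ((l.length : ℝ) + 1) ≤ ((x : ℝ) - x') ^ (-β) := by linarith
  have h3 := Real.rpow_le_rpow_of_nonpos (by positivity) h2
    (show -β⁻¹ ≤ 0 by simpa using hβ0.le)
  rw [← Real.rpow_mul h0.le, neg_mul_neg, mul_inv_cancel₀ hβ0.ne', Real.rpow_one,
    Real.mul_rpow (by positivity) (by positivity)] at h3
  exact h3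

lemma SameItinerary.drop {l : List ℝ≥0} {x x' : I} (h : SameItinerary l x x') (i : ℕ) :
    SameItinerary (l.drop i) (compList (l.take i) x) (compList (l.take i) x') := by
  induction l generalizing x x' i with
  | nil => simp [SameItinerary]
  | cons a l ih =>
    cases i with
    | zero => exact h
    | succ i => exact ih h.2 i

/-- Points with the same itinerary have orbits that stay close. -/
lemma SameItinerary.sum_dist_le {β γ : ℝ} (hβ0 : 0 < β) (hβ : β < 1 / 3) (hγ0 : 0 ≤ γ)
    (hγ : β * (γ + 1) < 1) {l : List ℝ≥0} (hl : ∀ a ∈ l, (a : ℝ) ≤ β) {x x' : I}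
    (h : SameItinerary l x x') {q k : ℕ} (hq : l.length = q + k) :
    ∑ i ∈ Finset.range q, dist (compList (l.take i) x) (compList (l.take i) x') ≤
      (β / 2) ^ (-β⁻¹) * (∑' j : ℕ, ((j : ℝ) + 1) ^ (-(β⁻¹ - γ))) * ((k : ℝ) + 1) ^ (-γ) := by
  have hp : 1 < β⁻¹ - γ := by
    have : γ + 1 < β⁻¹ := by
      rw [lt_inv_comm₀ (by linarith) hβ0, lt_inv_comm₀ hβ0 (by linarith)]
      rw [← one_div, lt_div_iff₀ hβ0]
      linarith
    linarith
  have hsum : Summable fun j : ℕ => ((j : ℝ) + 1) ^ (-(β⁻¹ - γ)) := by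
    have := (summable_nat_add_iff 1).2 (Real.summable_nat_rpow.2 (neg_lt_neg hp))
    simpa using this
  have hterm : ∀ i ∈ Finset.range q,
      dist (compList (l.take i) x) (compList (l.take i) x') ≤
        (β / 2) ^ (-β⁻¹) * (((k : ℝ) + 1) ^ (-γ) * (((q - 1 - i : ℕ) : ℝ) + 1) ^ (-(β⁻¹ - γ))) := by
    intro i hi
    rw [Finset.mem_range] at hi
    have h1 := (h.drop i).dist_le hβ0 hβ fun a ha => hl a (List.mem_of_mem_drop ha)
    refine h1.trans ?_
    have hn : (((l.drop i).length : ℕ) : ℝ) + 1 = ((k : ℝ) + 1) + (((q - 1 - i : ℕ) : ℝ) + 1) := by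
      have : (l.drop i).length = k + (q - 1 - i) + 1 := by
        rw [List.length_drop]
        omega
      rw [this]
      push_cast
      ring
    rw [hn]
    set u : ℝ := (k : ℝ) + 1
    set v : ℝ := ((q - 1 - i : ℕ) : ℝ) + 1
    have hu : 0 < u := by positivity
    have hv : 0 < v := by positivity
    refine mul_le_mul_of_nonneg_left ?_ (by positivity)
    have e : -β⁻¹ = -γ + -(β⁻¹ - γ) := by ring
    rw [e, Real.rpow_add (by positivity)]
    exact mul_le_mul (Real.rpow_le_rpow_of_nonpos hu (by linarith) (by linarith))
      (Real.rpow_le_rpow_of_nonpos hv (by linarith) (by linarith)) (by positivity) (by positivity)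
  refine (Finset.sum_le_sum hterm).trans ?_
  rw [← Finset.mul_sum, ← Finset.mul_sum,
    Finset.sum_range_reflect (fun j : ℕ => ((j : ℝ) + 1) ^ (-(β⁻¹ - γ))) q]
  have h2 := hsum.sum_le_tsum (Finset.range q) fun j _ => by positivity
  have h3 : (0 : ℝ) ≤ (β / 2) ^ (-β⁻¹) * ((k : ℝ) + 1) ^ (-γ) := by positivity
  have h4 := mul_le_mul_of_nonneg_left h2 h3
  linarith

/-- The partition into cells of equal itinerary, with the densities carried by the cells. -/
lemma exists_cells {b : ℝ} (l : List ℝ≥0) (hl : ∀ a ∈ l, 1 + (a : ℝ) ≤ b) :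
    ∃ (ι : Type) (_ : Fintype ι) (_ : DecidableEq ι) (cell : I → ι),
      (∀ i, MeasurableSet {x | cell x = i}) ∧
      (∀ x x', cell x = cell x' → SameItinerary l x x') ∧
      ∀ g : ℝ → ℝ, Reg b g → ∃ R : ι → ℝ → ℝ, (∀ i, Reg b (R i)) ∧
        (∀ x, ∑ i, R i x = transferList l g x) ∧
        ∀ i (B : I → ℝ), ∫ x : I, R i x * B x =
          ∫ x : I, g x * (if cell x = i then B (compList l x) else 0) := by
  induction l with
  | nil =>
    refine ⟨Unit, inferInstance, inferInstance, fun _ => (), fun _ => by simp,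
      fun _ _ _ => trivial, fun g hg => ⟨fun _ => g, fun _ => hg, fun x => by simp [transferList],
        fun i B => by simp [compList]⟩⟩
  | cons a l ih =>
    obtain ⟨ι, _, _, cell, h1, h2, h3⟩ := ih fun c hc => hl c (List.mem_cons_of_mem _ hc)
    have ha := hl a List.mem_cons_self
    refine ⟨Bool × ι, inferInstance, inferInstance,
      fun x => (decide ((x : ℝ) < 1 / 2), cell (pmMap a x)), ?_, ?_, ?_⟩
    · rintro ⟨c, i⟩
      have : {x : I | (decide ((x : ℝ) < 1 / 2), cell (pmMap a x)) = (c, i)} =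
          {x : I | decide ((x : ℝ) < 1 / 2) = c} ∩ pmMap a ⁻¹' {x | cell x = i} := by
        ext x
        simp
      rw [this]
      refine MeasurableSet.inter ?_ (measurable_pmMap a (h1 i))
      cases c
      · convert measurable_lt_half.compl using 1
        ext x
        simp
      · simpa using measurable_lt_half
    · intro x x' hx
      rw [Prod.mk.injEq, decide_eq_decide] at hx
      exact ⟨hx.1, h2 _ _ hx.2⟩
    · intro g hg
      obtain ⟨R₁, hR₁, hs₁, hB₁⟩ := h3 _ (hg.leftOp ha)
      obtain ⟨R₂, hR₂, hs₂, hB₂⟩ := h3 _ (hg.rightOp (by linarith [a.2]))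
      refine ⟨fun p => if p.1 then R₁ p.2 else R₂ p.2, ?_, ?_, ?_⟩
      · rintro ⟨c, i⟩
        cases c
        · exact hR₂ i
        · exact hR₁ i
      · intro x
        rw [Fintype.sum_prod_type, Fintype.sum_bool]
        simp only [if_true, Bool.false_eq_true, if_false]
        rw [hs₁, hs₂]
        exact (congrFun (transferList_add l (leftOp a g) (rightOp g)) x).symm
      · rintro ⟨c, i⟩ B
        cases c
        · simp only [Bool.false_eq_true, if_false]
          rw [hB₂, integral_rightOp_mul a]
          refine integral_congr_ae (ae_of_all _ fun x => ?_)
          by_cases hx : (x : ℝ) < 1 / 2 <;>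
            simp [-one_div, hx, compList]
        · simp only [if_true]
          rw [hB₁, integral_leftOp_mul a]
          refine integral_congr_ae (ae_of_all _ fun x => ?_)
          by_cases hx : (x : ℝ) < 1 / 2 <;>
            simp [-one_div, hx, compList]

lemma HasConeDensity.exists_reg {β : ℝ} (hβ0 : 0 < β) (hβ : β < 1 / 3) {μ : Measure I}
    [IsProbabilityMeasure μ] (h : HasConeDensity β μ) :
    ∃ g : ℝ → ℝ, Reg (1 + β) g ∧ Dominated β g ∧ mass g = 1 ∧
      ∀ F : I → ℝ, ∫ x, F x ∂μ = ∫ x : I, g x * F x := by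
  obtain ⟨g, ⟨-, hgi, hg0, hga, hgm, hgb⟩, hμ⟩ := h
  have hext : ∀ x ∈ Set.Ioo (0 : ℝ) 1, realExt (fun x : I => g x) x = g x := fun x hx => by
    rw [realExt, Set.projIcc_of_mem _ (Set.Ioo_subset_Icc_self hx)]
  have hint : Integrable fun x : I => g x := by
    rw [integrable_unitInterval]
    exact (hgi.mono_set Set.Ioo_subset_Ioc_self).congr_fun (fun x hx => (hext x hx).symm)
      measurableSet_Ioo
  have hmassg : mass g = ∫ y in Set.Ioc (0 : ℝ) 1, g y := by
    rw [mass, integral_unitInterval, setIntegral_congr_fun measurableSet_Ioo hext,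
      integral_Ioc_eq_integral_Ioo]
  have hF : ∀ F : I → ℝ, ∫ x, F x ∂μ = ∫ x : I, g x * F x := by
    intro F
    rw [hμ, integral_withDensity_eq_integral_toReal_smul₀ hint.aemeasurable.ennreal_ofReal
      (ae_of_all _ fun x => ENNReal.ofReal_lt_top)]
    refine integral_congr_ae ?_
    filter_upwards [ae_mem_Ioc] with x hx
    rw [ENNReal.toReal_ofReal (hg0 x hx), smul_eq_mul]
  have hm : mass g = 1 := by
    have := hF fun _ => 1
    simpa [mass] using this.symm
  rw [hm] at hmassg
  refine ⟨g, ⟨hg0, hga, by rwa [add_comm], hint⟩, ⟨hg0, hga, hint, hm.le, fun x hx => ?_⟩, hm, hF⟩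
  have h1 := hgb x hx
  rw [← hmassg, mul_one] at h1
  refine h1.trans (mul_le_mul_of_nonneg_right ?_ (Real.rpow_nonneg hx.1.le _))
  have h2 : (2 : ℝ) ^ β ≤ 9 / 7 := by
    calc (2 : ℝ) ^ β ≤ 2 ^ (1 / 3 : ℝ) :=
          Real.rpow_le_rpow_of_exponent_le (by norm_num) hβ.le
      _ ≤ ((9 / 7 : ℝ) ^ (3 : ℝ)) ^ (1 / 3 : ℝ) :=
          Real.rpow_le_rpow (by norm_num) (by norm_num) (by norm_num)
      _ = 9 / 7 := by rw [← Real.rpow_mul (by norm_num)]; norm_num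
  nlinarith

/-- The parameters `α (j + 1), …, α (j + n)`. -/
def paramList (α : ℕ → ℝ≥0) (j n : ℕ) : List ℝ≥0 := (List.range n).map fun i => α (j + i + 1)

@[simp]
lemma length_paramList (α : ℕ → ℝ≥0) (j n : ℕ) : (paramList α j n).length = n := by
  simp [paramList]

lemma paramList_succ (α : ℕ → ℝ≥0) (j n : ℕ) :
    paramList α j (n + 1) = paramList α j n ++ [α (j + n + 1)] := by
  simp [paramList, List.range_succ]

lemma paramList_le {β : ℝ} {α : ℕ → ℝ≥0} (hα : ∀ n, 1 ≤ n → (α n : ℝ) ≤ β) (j n : ℕ) :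
    ∀ a ∈ paramList α j n, (a : ℝ) ≤ β := by
  intro a ha
  obtain ⟨i, -, rfl⟩ := List.mem_map.1 ha
  exact hα _ (by omega)

lemma take_paramList (α : ℕ → ℝ≥0) (j : ℕ) {i n : ℕ} (h : i ≤ n) :
    (paramList α j n).take i = paramList α j i := by
  simp [paramList, ← List.map_take, List.take_range, h]

lemma comp_add (α : ℕ → ℝ≥0) (j n : ℕ) (x : I) :
    comp α (j + n) x = compList (paramList α j n) (comp α j x) := by
  induction n with
  | zero => rfl
  | succ n ih =>
    rw [paramList_succ, compList_append, ← ih]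
    rfl

lemma comp_eq_compList (α : ℕ → ℝ≥0) (n : ℕ) (x : I) :
    comp α n x = compList (paramList α 0 n) x := by
  have := comp_add α 0 n x
  rwa [zero_add] at this

lemma measurable_comp (α : ℕ → ℝ≥0) (n : ℕ) : Measurable (comp α n) := by
  have : comp α n = compList (paramList α 0 n) := funext fun x => comp_eq_compList α n x
  rw [this]
  exact measurable_compList _

lemma integrable_mul_of_bounded {r : ℝ → ℝ} (hr : Integrable fun x : I => r x) {B : I → ℝ}
    (hB : Measurable B) {b : ℝ} (hb : ∀ x, |B x| ≤ b) : Integrable fun x : I => r x * B x :=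
  hr.mul_bdd hB.aestronglyMeasurable (ae_of_all _ hb)

lemma integral_transferList_mul (l : List ℝ≥0) {r : ℝ → ℝ} (hr : Integrable fun x : I => r x)
    {B : I → ℝ} (hB : Measurable B) {b : ℝ} (hb : ∀ x, |B x| ≤ b) :
    ∫ x : I, transferList l r x * B x = ∫ x : I, r x * B (compList l x) := by
  induction l generalizing r with
  | nil => rfl
  | cons a l ih =>
    simp only [transferList, compList]
    rw [ih (integrable_transferOp a hr)]
    exact integral_transferOp_mul a (B := fun x => B (compList l x))
      (integrable_mul_of_bounded hr (hB.comp ((measurable_compList l).comp (measurable_pmMap a)))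
        fun x => hb _)

lemma integrable_of_bounded {μ : Measure I} [IsProbabilityMeasure μ] {F : I → ℝ}
    (hF : Measurable F) {b : ℝ} (hb : ∀ x, |F x| ≤ b) : Integrable F μ :=
  Integrable.of_bound hF.aestronglyMeasurable b (ae_of_all _ hb)

lemma abs_integral_le_of_bounded {μ : Measure I} [IsProbabilityMeasure μ] {F : I → ℝ} {b : ℝ}
    (hb : ∀ x, |F x| ≤ b) : |∫ x, F x ∂μ| ≤ b := by
  simpa using norm_integral_le_of_norm_le_const (μ := μ) (f := F) (ae_of_all _ hb)

lemma half_add_one_rpow_le {γ : ℝ} (hγ0 : 0 ≤ γ) {k j : ℕ} (hj : k ≤ 2 * j + 1) :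
    ((j : ℝ) + 1) ^ (-γ) ≤ 2 ^ γ * ((k : ℝ) + 1) ^ (-γ) := by
  have h1 : ((k : ℝ) + 1) / 2 ≤ (j : ℝ) + 1 := by
    have : (k : ℝ) ≤ 2 * j + 1 := by exact_mod_cast hj
    linarith
  refine (Real.rpow_le_rpow_of_nonpos (by positivity) h1 (by linarith)).trans_eq ?_
  rw [Real.div_rpow (by positivity) two_pos.le, Real.rpow_neg two_pos.le, div_inv_eq_mul, mul_comm]

/-- Decorrelation between the distant past and the future of the orbit. -/
theorem exists_decorrelation {β γ : ℝ} (hβ0 : 0 < β) (hβ : β < 1 / 3) (hγ0 : 0 < γ)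
    (hγ : β * (γ + 1) < 1) :
    ∃ C : ℝ, 0 < C ∧ ∀ (α : ℕ → ℝ≥0), (∀ n, 1 ≤ n → (α n : ℝ) ≤ β) →
      ∀ (μ : Measure I) [IsProbabilityMeasure μ], HasConeDensity β μ →
      ∀ (q k : ℕ) (Γ : I → I → ℝ) (b : ℝ), Measurable (Function.uncurry Γ) →
      (∀ x y, |Γ x y| ≤ b) →
      (∀ x x' y, |Γ x y - Γ x' y| ≤
        b * ∑ i ∈ Finset.range q, dist (comp α i x) (comp α i x')) →
      |∫ x, Γ x (comp α (q + k) x) ∂μ - ∫ x, ∫ x', Γ x (comp α (q + k) x') ∂μ ∂μ| ≤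
        C * b * ((k : ℝ) + 1) ^ (-γ) := by
  obtain ⟨C₁, hC₁, hcoup⟩ := exists_coupling_bound hβ0 hβ hγ0 hγ
  set C₂ : ℝ := (β / 2) ^ (-β⁻¹) * (∑' j : ℕ, ((j : ℝ) + 1) ^ (-(β⁻¹ - γ))) with hC₂
  have hC₂0 : 0 ≤ C₂ := mul_nonneg (by positivity) (tsum_nonneg fun j => by positivity)
  refine ⟨(C₁ + 2 * C₂) * 2 ^ γ, by positivity, ?_⟩
  intro α hα μ _ hμ q k Γ b hΓm hΓb hΓl
  obtain ⟨g, hg, hgd, hgm, hgF⟩ := hμ.exists_reg hβ0 hβ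
  have hb0 : 0 ≤ b := (abs_nonneg _).trans (hΓb 0 0)
  set k₁ := k / 2 with hk₁
  set k₂ := k - k / 2 with hk₂
  have hk : q + k = q + k₁ + k₂ := by omega
  set l := paramList α 0 (q + k₁) with hl
  set l' := paramList α (q + k₁) k₂ with hl'
  have hlβ : ∀ a ∈ l, (a : ℝ) ≤ β := paramList_le hα _ _
  have hl'β : ∀ a ∈ l', (a : ℝ) ≤ β := paramList_le hα _ _
  have hcomp : ∀ x, comp α (q + k) x = compList l' (compList l x) := fun x => by
    rw [hk, comp_add, comp_eq_compList]
  obtain ⟨ι, _, _, cell, hcm, hcs, hcR⟩ := exists_cells (b := 1 + β) l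
    fun a ha => by linarith [hlβ a ha]
  obtain ⟨R, hR, hRs, hRB⟩ := hcR g hg
  have hGam : ∀ x, Measurable (Γ x) := fun x => hΓm.of_uncurry_left
  -- a representative of every nonempty cell
  have hrep : ∃ rep : ι → I, ∀ x, cell (rep (cell x)) = cell x := by
    classical
    refine ⟨fun i => if h : ∃ x, cell x = i then h.choose else 0, fun x => ?_⟩
    have h : ∃ x', cell x' = cell x := ⟨x, rfl⟩
    simp only [h, dite_true]
    exact h.choose_spec
  obtain ⟨rep, hrep⟩ := hrep
  set ε : ℝ := b * (C₂ * ((k₁ : ℝ) + 1) ^ (-γ)) with hε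
  have happrox : ∀ x y, |Γ x y - Γ (rep (cell x)) y| ≤ ε := by
    intro x y
    refine (hΓl _ _ _).trans (mul_le_mul_of_nonneg_left ?_ hb0)
    have h1 := (hcs x (rep (cell x)) (hrep x).symm).sum_dist_le hβ0 hβ hγ0.le hγ hlβ
      (q := q) (k := k₁) (by simp [hl])
    refine le_trans (le_of_eq (Finset.sum_congr rfl fun i hi => ?_)) h1
    rw [hl, take_paramList α 0 (by have := Finset.mem_range.1 hi; omega), ← comp_eq_compList,
      ← comp_eq_compList]
  have hdecomp : ∀ (x : I) (Φ : ι → ℝ), Φ (cell x) = ∑ i, if cell x = i then Φ i else 0 := by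
    intro x Φ
    simp
  have hmeas : ∀ Φ : ι → I → ℝ, (∀ i, Measurable (Φ i)) → Measurable fun x => Φ (cell x) x := by
    intro Φ hΦ
    have : (fun x => Φ (cell x) x) = fun x => ∑ i, if cell x = i then Φ i x else 0 :=
      funext fun x => hdecomp x fun i => Φ i x
    rw [this]
    exact Finset.measurable_sum _ fun i _ => Measurable.ite (hcm i) (hΦ i) measurable_const
  have hsumint : ∀ (Φ : ι → I → ℝ), (∀ i, Measurable (Φ i)) → (∀ i x, |Φ i x| ≤ b) →
      ∫ x, Φ (cell x) (compList l x) ∂μ = ∑ i, ∫ x : I, R i x * Φ i x := by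
    intro Φ hΦ hΦb
    rw [hgF]
    simp only [hRB]
    rw [← integral_finsetSum]
    · refine integral_congr_ae (ae_of_all _ fun x => ?_)
      beta_reduce
      rw [← Finset.mul_sum, ← hdecomp x fun i => Φ i (compList l x)]
    · intro i _
      refine integrable_mul_of_bounded hg.int (b := b) ?_ fun x => ?_
      · exact Measurable.ite (hcm i) ((hΦ i).comp (measurable_compList l)) measurable_const
      · split_ifs
        · exact hΦb _ _
        · simpa using hb0
  set G := transferList l g with hG
  have hGreg : Reg (1 + β) G := hg.transferList fun a ha => by linarith [hlβ a ha]
  have hGm : mass G = 1 := (mass_transferList l hg.int).trans hgm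
  have hmsum : ∑ i, mass (R i) = 1 := by
    rw [← mass_sum Finset.univ fun i _ => (hR i).int, ← hGm]
    congr 1
    exact funext hRs
  have hcoupled : Coupled β R (fun i x => mass (R i) * G x) G 1 := by
    refine ⟨hR, fun i => hGreg.const_mul (hR i).mass_nonneg, fun i => ?_, fun x _ => (hRs x).le,
      fun x _ => ?_, hgd.transferList hβ0 hβ hlβ, hmsum.le⟩
    · have : mass (fun x => mass (R i) * G x) = mass (R i) * mass G := integral_const_mul _ _
      rw [this, hGm, mul_one]
    · rw [← Finset.sum_mul, hmsum, one_mul]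
  have hB := hcoup hcoupled l' hl'β
  rw [hl', length_paramList, ← hl'] at hB
  -- the two step-function approximations
  have h1 : ∫ x, Γ (rep (cell x)) (comp α (q + k) x) ∂μ =
      ∑ i, ∫ x : I, transferList l' (R i) x * Γ (rep i) x := by
    simp only [hcomp]
    rw [hsumint (fun i y => Γ (rep i) (compList l' y))
      (fun i => (hGam _).comp (measurable_compList l')) fun i x => hΓb _ _]
    refine Finset.sum_congr rfl fun i _ => ?_
    rw [integral_transferList_mul l' (hR i).int (hGam _) (hΓb _)]
  have h2 : ∫ x, ∫ x', Γ (rep (cell x)) (comp α (q + k) x') ∂μ ∂μ =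
      ∑ i, ∫ x : I, transferList l' (fun x => mass (R i) * G x) x * Γ (rep i) x := by
    rw [hsumint (fun i _ => ∫ x', Γ (rep i) (comp α (q + k) x') ∂μ) (fun i => measurable_const)
      fun i x => abs_integral_le_of_bounded fun x' => hΓb _ _]
    refine Finset.sum_congr rfl fun i _ => ?_
    rw [integral_mul_const, transferList_const_mul]
    simp only [mul_assoc]
    rw [integral_const_mul, integral_transferList_mul l' hGreg.int (hGam _) (hΓb _), hG,
      integral_transferList_mul l hg.int (B := fun x => Γ (rep i) (compList l' x))
        ((hGam _).comp (measurable_compList l')) (b := b)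
        (fun x => hΓb _ _), hgF]
    simp only [hcomp]
    rfl
  have h3 : |∫ x, Γ (rep (cell x)) (comp α (q + k) x) ∂μ -
      ∫ x, ∫ x', Γ (rep (cell x)) (comp α (q + k) x') ∂μ ∂μ| ≤
        b * (C₁ * ((k₂ : ℝ) + 1) ^ (-γ)) := by
    rw [h1, h2, ← Finset.sum_sub_distrib]
    refine (Finset.abs_sum_le_sum_abs _ _).trans (le_trans ?_ (mul_le_mul_of_nonneg_left hB hb0))
    rw [Finset.mul_sum]
    refine Finset.sum_le_sum fun i _ => ?_
    have i1 := integrable_transferList l' (hcoupled.reg i).int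
    have i2 := integrable_transferList l' (r := fun x => mass (R i) * G x) (hcoupled.reg' i).int
    rw [← integral_sub (integrable_mul_of_bounded i1 (hGam _) (hΓb _))
      (integrable_mul_of_bounded i2 (hGam _) (hΓb _))]
    set m := mass (R i)
    rw [mass, ← integral_const_mul]
    refine (abs_integral_le_integral_abs).trans (integral_mono ?_ ?_ fun x => ?_)
    · exact ((integrable_mul_of_bounded i1 (hGam _) (hΓb _)).sub
        (integrable_mul_of_bounded i2 (hGam _) (hΓb _))).abs
    · exact (i1.sub i2).abs.const_mul b
    · beta_reduce
      rw [← sub_mul, abs_mul, mul_comm]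
      exact mul_le_mul_of_nonneg_right (hΓb _ _) (abs_nonneg _)
  have hm1 : Measurable fun x => Γ x (comp α (q + k) x) :=
    hΓm.comp (measurable_id.prodMk (measurable_comp α _))
  have hm2 : Measurable fun x => Γ (rep (cell x)) (comp α (q + k) x) :=
    hmeas (fun i x => Γ (rep i) (comp α (q + k) x)) fun i => (hGam _).comp (measurable_comp α _)
  have h4 : |∫ x, Γ x (comp α (q + k) x) ∂μ - ∫ x, Γ (rep (cell x)) (comp α (q + k) x) ∂μ| ≤
      ε := by
    rw [← integral_sub (integrable_of_bounded hm1 fun x => hΓb _ _)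
      (integrable_of_bounded hm2 fun x => hΓb _ _)]
    exact abs_integral_le_of_bounded fun x => happrox _ _
  have hm3 : Measurable fun x => ∫ x', Γ x (comp α (q + k) x') ∂μ := by
    have : Measurable (Function.uncurry fun x x' => Γ x (comp α (q + k) x')) :=
      hΓm.comp (measurable_fst.prodMk ((measurable_comp α _).comp measurable_snd))
    exact this.stronglyMeasurable.integral_prod_right.measurable
  have hm4 : Measurable fun x => ∫ x', Γ (rep (cell x)) (comp α (q + k) x') ∂μ :=
    hmeas (fun i _ => ∫ x', Γ (rep i) (comp α (q + k) x') ∂μ) fun i => measurable_const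
  have h5 : |∫ x, ∫ x', Γ (rep (cell x)) (comp α (q + k) x') ∂μ ∂μ -
      ∫ x, ∫ x', Γ x (comp α (q + k) x') ∂μ ∂μ| ≤ ε := by
    rw [abs_sub_comm, ← integral_sub
      (integrable_of_bounded hm3 fun x => abs_integral_le_of_bounded fun x' => hΓb _ _)
      (integrable_of_bounded hm4 fun x => abs_integral_le_of_bounded fun x' => hΓb _ _)]
    refine abs_integral_le_of_bounded fun x => ?_
    have hi : ∀ z, Integrable (fun x' => Γ z (comp α (q + k) x')) μ := fun z =>
      integrable_of_bounded ((hGam z).comp (measurable_comp α _)) fun x => hΓb _ _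
    rw [← integral_sub (hi _) (hi _)]
    exact abs_integral_le_of_bounded fun x' => happrox _ _
  have h6 := half_add_one_rpow_le hγ0.le (k := k) (j := k₁) (by omega)
  have h7 := half_add_one_rpow_le hγ0.le (k := k) (j := k₂) (by omega)
  set D := (2 : ℝ) ^ γ * ((k : ℝ) + 1) ^ (-γ) with hD
  have h8 : ε ≤ b * (C₂ * D) := by rw [hε]; gcongr
  have h9 : b * (C₁ * ((k₂ : ℝ) + 1) ^ (-γ)) ≤ b * (C₁ * D) := by gcongr
  have h10 : (C₁ + 2 * C₂) * 2 ^ γ * b * ((k : ℝ) + 1) ^ (-γ) =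
      b * (C₁ * D) + 2 * (b * (C₂ * D)) := by rw [hD]; ring
  rw [h10]
  rw [abs_le] at h3 h4 h5 ⊢
  constructor <;> linarith [h3.1, h3.2, h4.1, h4.2, h5.1, h5.2]

/-- Functions of a sequence that are bounded by `b` and Lipschitz with constant `b` in each of the
coordinates in `S`, and that do not depend on the other coordinates. -/
structure BoundedLip (b : ℝ) (S : Finset ℕ) (Q : (ℕ → I) → ℝ) : Prop where
  bound : ∀ ω, |Q ω| ≤ b
  lip : ∀ ω ω', |Q ω - Q ω'| ≤ b * ∑ i ∈ S, dist (ω i) (ω' i)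

lemma BoundedLip.nonneg {b : ℝ} {S : Finset ℕ} {Q : (ℕ → I) → ℝ} (h : BoundedLip b S Q) : 0 ≤ b :=
  (abs_nonneg _).trans (h.bound fun _ => 0)

lemma BoundedLip.continuous {b : ℝ} {S : Finset ℕ} {Q : (ℕ → I) → ℝ} (h : BoundedLip b S Q) :
    Continuous Q := by
  rw [continuous_iff_continuousAt]
  intro ω
  rw [ContinuousAt, tendsto_iff_dist_tendsto_zero]
  have h1 : Filter.Tendsto (fun ω' : ℕ → I => b * ∑ i ∈ S, dist (ω' i) (ω i)) (nhds ω) (nhds 0) := by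
    have : Continuous fun ω' : ℕ → I => b * ∑ i ∈ S, dist (ω' i) (ω i) := by fun_prop
    have h2 := this.tendsto ω
    simpa using h2
  exact squeeze_zero (fun _ => dist_nonneg) (fun ω' => by rw [Real.dist_eq]; exact h.lip ω' ω) h1

lemma BoundedLip.measurable {b : ℝ} {S : Finset ℕ} {Q : (ℕ → I) → ℝ} (h : BoundedLip b S Q) :
    Measurable Q := h.continuous.measurable

lemma BoundedLip.eq_of_eqOn {b : ℝ} {S : Finset ℕ} {Q : (ℕ → I) → ℝ} (h : BoundedLip b S Q)
    {ω ω' : ℕ → I} (hω : ∀ i ∈ S, ω i = ω' i) : Q ω = Q ω' := by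
  have h1 := h.lip ω ω'
  rw [Finset.sum_eq_zero fun i hi => by rw [hω i hi, dist_self], mul_zero] at h1
  exact sub_eq_zero.1 (abs_nonpos_iff.1 h1)

lemma BoundedLip.lip_le {b : ℝ} {S T : Finset ℕ} {Q : (ℕ → I) → ℝ} (h : BoundedLip b S Q)
    {ω ω' : ℕ → I} {D : ℕ → ℝ} (hD0 : ∀ i, 0 ≤ D i)
    (hT : ∀ i ∈ S, i ∈ T → dist (ω i) (ω' i) ≤ D i)
    (hT' : ∀ i ∈ S, i ∉ T → ω i = ω' i) : |Q ω - Q ω'| ≤ b * ∑ i ∈ T, D i := by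
  refine (h.lip ω ω').trans (mul_le_mul_of_nonneg_left ?_ h.nonneg)
  calc ∑ i ∈ S, dist (ω i) (ω' i) = ∑ i ∈ S with i ∈ T, dist (ω i) (ω' i) := by
        rw [Finset.sum_filter]
        refine Finset.sum_congr rfl fun i hi => ?_
        split_ifs with h1
        · rfl
        · rw [hT' i hi h1, dist_self]
    _ ≤ ∑ i ∈ S with i ∈ T, D i := Finset.sum_le_sum fun i hi => by
        rw [Finset.mem_filter] at hi
        exact hT i hi.1 hi.2
    _ ≤ ∑ i ∈ T, D i := Finset.sum_le_sum_of_subset_of_nonneg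
        (fun i hi => (Finset.mem_filter.1 hi).2) fun i _ _ => hD0 i

/-- The orbit of a point. -/
noncomputable def orbit (α : ℕ → ℝ≥0) (x : I) : ℕ → I := fun i => comp α i x

/-- The sequence that follows the orbit of `x` up to time `J` and starts from `y` at time `J`. -/
noncomputable def splice (α : ℕ → ℝ≥0) (J : ℕ) (x y : I) : ℕ → I :=
  fun i => if i < J then comp α i x else compList (paramList α J (i - J)) y

lemma splice_self (α : ℕ → ℝ≥0) (J : ℕ) (x : I) : splice α J x (comp α J x) = orbit α x := by
  funext i
  simp only [splice, orbit]
  split_ifs with h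
  · rfl
  · rw [← comp_add, Nat.add_sub_cancel' (not_lt.1 h)]

lemma measurable_orbit (α : ℕ → ℝ≥0) : Measurable (orbit α) :=
  measurable_pi_iff.2 fun i => measurable_comp α i

lemma measurable_splice (α : ℕ → ℝ≥0) (J : ℕ) :
    Measurable fun z : I × I => splice α J z.1 z.2 := by
  refine measurable_pi_iff.2 fun i => ?_
  simp only [splice]
  split_ifs
  · exact (measurable_comp α i).comp measurable_fst
  · exact (measurable_compList _).comp measurable_snd

/-- Polynomial mixing of the law `ν` of a sequence: a centred functional of the coordinates in a
window `[s, e]` is nearly uncorrelated with functionals of the coordinates at distance at least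
`k` from the window. -/
def Mixing (ν : Measure (ℕ → I)) (γ C : ℝ) : Prop :=
  ∀ (s e k : ℕ) (b₁ b₂ : ℝ) (S₁ S₂ : Finset ℕ) (χ Q : (ℕ → I) → ℝ), BoundedLip b₁ S₁ χ →
    BoundedLip b₂ S₂ Q → (∀ i ∈ S₁, s ≤ i ∧ i ≤ e) → s ≤ e →
    (∀ i ∈ S₂, i + k ≤ s ∨ e + k ≤ i) → ∫ ω, χ ω ∂ν = 0 →
    |∫ ω, χ ω * Q ω ∂ν| ≤ C * b₁ * b₂ * ((k : ℝ) + 1) ^ (-γ)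

lemma abs_mul_sub_mul_le {a a' c c' A B : ℝ} (ha : |a| ≤ A) (hc : |c'| ≤ B) :
    |a * c - a' * c'| ≤ A * |c - c'| + B * |a - a'| := by
  have h : a * c - a' * c' = a * (c - c') + (a - a') * c' := by ring
  rw [h]
  refine (abs_add_le _ _).trans ?_
  rw [abs_mul, abs_mul, mul_comm B]
  gcongr

theorem exists_mixing {β γ : ℝ} (hβ0 : 0 < β) (hβ : β < 1 / 3) (hγ0 : 0 < γ)
    (hγ : β * (γ + 1) < 1) :
    ∃ C : ℝ, 0 < C ∧ ∀ (α : ℕ → ℝ≥0), (∀ n, 1 ≤ n → (α n : ℝ) ≤ β) →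
      ∀ (μ : Measure I) [IsProbabilityMeasure μ], HasConeDensity β μ →
      Mixing (μ.map (orbit α)) γ C := by
  obtain ⟨C, hC, hdec⟩ := exists_decorrelation hβ0 hβ hγ0 hγ
  refine ⟨3 * C * 2 ^ γ + 1, by positivity, ?_⟩
  intro α hα μ _ hμ s e k' b₁ b₂ S₁ S₂ χ Q hχ hQ hS₁ hse hS₂ hχ0
  rw [integral_map (measurable_orbit α).aemeasurable hχ.measurable.aestronglyMeasurable] at hχ0
  rw [integral_map (f := fun ω => χ ω * Q ω) (measurable_orbit α).aemeasurable
    (hχ.measurable.mul hQ.measurable).aestronglyMeasurable]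
  have hb₁ := hχ.nonneg
  have hb₂ := hQ.nonneg
  rcases Nat.eq_zero_or_pos k' with rfl | hk'
  · have h1 : |∫ x, χ (orbit α x) * Q (orbit α x) ∂μ| ≤ b₁ * b₂ :=
      abs_integral_le_of_bounded fun x => by
        rw [abs_mul]
        exact mul_le_mul (hχ.bound _) (hQ.bound _) (abs_nonneg _) hb₁
    have h2 : 0 ≤ 3 * C * 2 ^ γ * (b₁ * b₂) := by positivity
    simp only [Nat.cast_zero, zero_add, Real.one_rpow, mul_one]
    linarith
  obtain ⟨k, rfl⟩ : ∃ k, k' = k + 1 := ⟨k' - 1, by omega⟩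
  set J := e + 1 + k with hJ
  have hfar : ∀ i ∈ S₂, i < J → i + k < s := fun i hi hiJ => by
    rcases hS₂ i hi with h | h <;> omega
  have hpast : ∀ x x' y, |Q (splice α J x y) - Q (splice α J x' y)| ≤
      b₂ * ∑ i ∈ Finset.range (s - k), dist (comp α i x) (comp α i x') := by
    intro x x' y
    refine hQ.lip_le (fun i => dist_nonneg) (fun i hi hi' => ?_) fun i hi hi' => ?_
    · have : i < J := by
        rw [Finset.mem_range] at hi'
        omega
      simp only [splice, this, if_true]
      exact le_rfl
    · rw [Finset.mem_range] at hi'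
      have : ¬ i < J := fun h => hi' (by have := hfar i hi h; omega)
      simp only [splice, this, if_false]
  have hχpast : ∀ x x' y, |χ (splice α J x y) - χ (splice α J x' y)| ≤
      b₁ * ∑ i ∈ Finset.range (e + 1), dist (comp α i x) (comp α i x') := by
    intro x x' y
    refine hχ.lip_le (fun i => dist_nonneg) (fun i hi hi' => ?_) fun i hi hi' => ?_
    · have : i < J := by
        rw [Finset.mem_range] at hi'
        omega
      simp only [splice, this, if_true]
      exact le_rfl
    · rw [Finset.mem_range] at hi'
      have := hS₁ i hi
      omega
  have hχsplice : ∀ x y, χ (splice α J x y) = χ (orbit α x) := fun x y =>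
    hχ.eq_of_eqOn fun i hi => by
      have : i < J := by
        have := hS₁ i hi
        omega
      simp only [splice, orbit, this, if_true]
  have hsp := measurable_splice α J
  -- separate the future
  have h1 := hdec α hα μ hμ (e + 1) k (fun x y => χ (splice α J x y) * Q (splice α J x y))
    (2 * (b₁ * b₂)) ((hχ.measurable.comp hsp).mul (hQ.measurable.comp hsp))
    (fun x y => by
      rw [abs_mul]
      have := mul_le_mul (hχ.bound (splice α J x y)) (hQ.bound (splice α J x y)) (abs_nonneg _) hb₁
      nlinarith [mul_nonneg hb₁ hb₂])
    (fun x x' y => by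
      refine (abs_mul_sub_mul_le (hχ.bound _) (hQ.bound _)).trans ?_
      have e1 := mul_le_mul_of_nonneg_left (hpast x x' y) hb₁
      have e2 := mul_le_mul_of_nonneg_left (hχpast x x' y) hb₂
      have e3 : ∑ i ∈ Finset.range (s - k), dist (comp α i x) (comp α i x') ≤
          ∑ i ∈ Finset.range (e + 1), dist (comp α i x) (comp α i x') :=
        Finset.sum_le_sum_of_subset_of_nonneg (Finset.range_subset_range.2 (by omega))
          fun i _ _ => dist_nonneg
      have e4 := mul_le_mul_of_nonneg_left e3 (mul_nonneg hb₁ hb₂)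
      linarith)
  rw [← hJ] at h1
  simp only [splice_self, hχsplice] at h1
  -- separate the past
  have h2 : ∀ y, |∫ x, χ (orbit α x) * Q (splice α J x y) ∂μ| ≤
      C * (b₁ * b₂) * ((k : ℝ) + 1) ^ (-γ) := by
    intro y
    have hspy : Measurable fun x => splice α J x y := hsp.comp (measurable_id.prodMk measurable_const)
    by_cases hks : k ≤ s
    · set tail : I → ℕ → I := fun z i => compList (paramList α s (i - s)) z with htail
      have htm : Measurable tail := measurable_pi_iff.2 fun i => measurable_compList _
      have htχ : ∀ x, χ (tail (comp α s x)) = χ (orbit α x) := fun x =>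
        hχ.eq_of_eqOn fun i hi => by
          simp only [htail, orbit]
          rw [← comp_add, Nat.add_sub_cancel' (hS₁ i hi).1]
      have h3 := hdec α hα μ hμ (s - k) k (fun x z => χ (tail z) * Q (splice α J x y)) (b₁ * b₂)
        (((hχ.measurable.comp htm).comp measurable_snd).mul
          ((hQ.measurable.comp hspy).comp measurable_fst))
        (fun x z => by
          rw [abs_mul]
          exact mul_le_mul (hχ.bound _) (hQ.bound _) (abs_nonneg _) hb₁)
        (fun x x' z => by
          rw [← mul_sub, abs_mul, mul_assoc]
          exact mul_le_mul (hχ.bound _) (hpast x x' y) (abs_nonneg _) hb₁)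
      rw [Nat.sub_add_cancel hks] at h3
      simp only [htχ, integral_mul_const, hχ0, zero_mul, integral_zero, sub_zero] at h3
      exact h3
    · have h3 : ∀ x, Q (splice α J x y) = Q (splice α J 0 y) := fun x => by
        have := hpast x 0 y
        rw [Nat.sub_eq_zero_of_le (by omega), Finset.sum_range_zero, mul_zero] at this
        exact sub_eq_zero.1 (abs_nonpos_iff.1 this)
      simp only [h3, integral_mul_const, hχ0, zero_mul, abs_zero]
      positivity
  have h3 : ∫ x, ∫ x', χ (orbit α x) * Q (splice α J x (comp α J x')) ∂μ ∂μ =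
      ∫ x', ∫ x, χ (orbit α x) * Q (splice α J x (comp α J x')) ∂μ ∂μ := by
    refine integral_integral_swap ?_
    refine Integrable.of_bound (C := b₁ * b₂) (Measurable.aestronglyMeasurable ?_)
      (ae_of_all _ fun z => ?_)
    · exact ((hχ.measurable.comp (measurable_orbit α)).comp measurable_fst).mul
        (hQ.measurable.comp
          (hsp.comp (measurable_fst.prodMk ((measurable_comp α J).comp measurable_snd))))
    · rw [Function.uncurry, Real.norm_eq_abs, abs_mul]
      exact mul_le_mul (hχ.bound _) (hQ.bound _) (abs_nonneg _) hb₁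
  have h4 : |∫ x', ∫ x, χ (orbit α x) * Q (splice α J x (comp α J x')) ∂μ ∂μ| ≤
      C * (b₁ * b₂) * ((k : ℝ) + 1) ^ (-γ) := abs_integral_le_of_bounded fun x' => h2 _
  rw [h3] at h1
  have h5 := half_add_one_rpow_le hγ0.le (k := k + 1) (j := k) (by omega)
  set D := (((k + 1 : ℕ) : ℝ) + 1) ^ (-γ)
  have hD : 0 ≤ D := by positivity
  have h6 : 3 * (C * (b₁ * b₂)) * ((k : ℝ) + 1) ^ (-γ) ≤ 3 * (C * (b₁ * b₂)) * (2 ^ γ * D) := by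
    gcongr
  have h7 : 0 ≤ b₁ * b₂ * D := by positivity
  rw [abs_le] at h1 h4 ⊢
  constructor <;> nlinarith [h1.1, h1.2, h4.1, h4.2]

lemma BoundedLip.mono {b b' : ℝ} {S S' : Finset ℕ} {Q : (ℕ → I) → ℝ} (h : BoundedLip b S Q)
    (hb : b ≤ b') (hS : S ⊆ S') : BoundedLip b' S' Q where
  bound ω := (h.bound ω).trans hb
  lip ω ω' := (h.lip ω ω').trans <| mul_le_mul hb
    (Finset.sum_le_sum_of_subset_of_nonneg hS fun _ _ _ => dist_nonneg)
    (Finset.sum_nonneg fun _ _ => dist_nonneg) (h.nonneg.trans hb)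

lemma BoundedLip.mul {b₁ b₂ : ℝ} {S : Finset ℕ} {Q₁ Q₂ : (ℕ → I) → ℝ}
    (h₁ : BoundedLip b₁ S Q₁) (h₂ : BoundedLip b₂ S Q₂) :
    BoundedLip (2 * (b₁ * b₂)) S (fun ω => Q₁ ω * Q₂ ω) where
  bound ω := by
    rw [abs_mul]
    have := mul_le_mul (h₁.bound ω) (h₂.bound ω) (abs_nonneg _) h₁.nonneg
    have := mul_nonneg h₁.nonneg h₂.nonneg
    linarith
  lip ω ω' := by
    refine (abs_mul_sub_mul_le (h₁.bound ω) (h₂.bound ω')).trans ?_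
    have e1 := mul_le_mul_of_nonneg_left (h₂.lip ω ω') h₁.nonneg
    have e2 := mul_le_mul_of_nonneg_left (h₁.lip ω ω') h₂.nonneg
    linarith

lemma BoundedLip.sub_const {b c : ℝ} {S : Finset ℕ} {Q : (ℕ → I) → ℝ} (h : BoundedLip b S Q)
    (hc : |c| ≤ b) : BoundedLip (2 * b) S (fun ω => Q ω - c) where
  bound ω := by
    have := h.bound ω
    have := abs_sub (Q ω) c
    linarith
  lip ω ω' := by
    have h1 := h.lip ω ω'
    have h2 := (abs_nonneg _).trans h1
    rw [sub_sub_sub_cancel_right]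
    linarith

lemma integrable_of_continuous {ν : Measure (ℕ → I)} [IsProbabilityMeasure ν] {F : (ℕ → I) → ℝ}
    (hF : Continuous F) : Integrable F ν :=
  hF.integrable_of_hasCompactSupport (HasCompactSupport.of_compactSpace F)

lemma abs_integral_le_of_forall {Ω : Type*} [MeasurableSpace Ω] {ν : Measure Ω}
    [IsProbabilityMeasure ν] {F : Ω → ℝ} {b : ℝ} (hb : ∀ ω, |F ω| ≤ b) : |∫ ω, F ω ∂ν| ≤ b := by
  simpa using norm_integral_le_of_norm_le_const (μ := ν) (f := F) (ae_of_all _ hb)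

section Taylor

variable {E : Type*} [NormedAddCommGroup E] [NormedSpace ℝ E]

/-- Bounded functions with bounded and Lipschitz derivative. -/
structure SmoothBounded (M : ℝ) (p : E → ℝ) : Prop where
  diff : Differentiable ℝ p
  bound : ∀ w, |p w| ≤ M
  fderiv_le : ∀ w, ‖fderiv ℝ p w‖ ≤ M
  fderiv_lip : ∀ w w', ‖fderiv ℝ p w - fderiv ℝ p w'‖ ≤ M * ‖w - w'‖

variable {M : ℝ} {p : E → ℝ}

lemma SmoothBounded.nonneg (hp : SmoothBounded M p) : 0 ≤ M :=
  (norm_nonneg _).trans (hp.fderiv_le 0)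

lemma SmoothBounded.continuous_fderiv (hp : SmoothBounded M p) : Continuous (fderiv ℝ p) := by
  have : LipschitzWith (Real.toNNReal M) (fderiv ℝ p) := LipschitzWith.of_dist_le_mul fun w w' => by
    rw [dist_eq_norm, dist_eq_norm, Real.coe_toNNReal _ hp.nonneg]
    exact hp.fderiv_lip w w'
  exact this.continuous

/-- The first-order Taylor remainder. -/
noncomputable def taylorRem (p : E → ℝ) (w δ : E) : ℝ := p (w + δ) - p w - fderiv ℝ p w δ

lemma SmoothBounded.taylor_aux (hp : SmoothBounded M p) (w δ δ' : E) {R : ℝ} (hδ : ‖δ‖ ≤ R)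
    (hδ' : ‖δ'‖ ≤ R) :
    |p (w + δ) - p (w + δ') - fderiv ℝ p w (δ - δ')| ≤ M * R * ‖δ - δ'‖ := by
  have h := (convex_closedBall w R).norm_image_sub_le_of_norm_fderiv_le' (𝕜 := ℝ) (f := p)
    (φ := fderiv ℝ p w) (C := M * R) (x := w + δ') (y := w + δ)
    (fun x _ => hp.diff x)
    (fun x hx => (hp.fderiv_lip x w).trans (mul_le_mul_of_nonneg_left
      (by simpa [dist_eq_norm] using hx) hp.nonneg))
    (by simpa using hδ') (by simpa using hδ)
  simpa using h

lemma SmoothBounded.abs_taylorRem_le (hp : SmoothBounded M p) (w δ : E) {R : ℝ} (hδ : ‖δ‖ ≤ R) :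
    |taylorRem p w δ| ≤ M * R * R := by
  have h := hp.taylor_aux w δ 0 hδ (by simpa using (norm_nonneg _).trans hδ)
  have hR := (norm_nonneg _).trans hδ
  simp only [add_zero, sub_zero] at h
  exact h.trans (mul_le_mul_of_nonneg_left hδ (mul_nonneg hp.nonneg hR))

lemma SmoothBounded.abs_taylorRem_sub_le (hp : SmoothBounded M p) (w w' δ δ' : E) {R : ℝ}
    (hδ : ‖δ‖ ≤ R) (hδ' : ‖δ'‖ ≤ R) :
    |taylorRem p w δ - taylorRem p w' δ'| ≤ M * R * (‖δ - δ'‖ + 2 * ‖w - w'‖) := by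
  have h1 := hp.taylor_aux w δ δ' hδ hδ'
  have hk : ∀ z, HasFDerivAt (fun z => p (w + z) - p (w' + z))
      (fderiv ℝ p (w + z) - fderiv ℝ p (w' + z)) z := fun z => by
    have e : ∀ u : E, HasFDerivAt (fun z => p (u + z)) (fderiv ℝ p (u + z)) z := fun u => by
      have := (hp.diff (u + z)).hasFDerivAt.comp z ((hasFDerivAt_id z).const_add u)
      rw [ContinuousLinearMap.comp_id] at this
      exact this
    exact (e w).sub (e w')
  have h2 := (convex_univ (𝕜 := ℝ) (E := E)).norm_image_sub_le_of_norm_hasFDerivWithin_le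
    (f := fun z => p (w + z) - p (w' + z)) (C := M * ‖w - w'‖) (x := 0) (y := δ')
    (fun z _ => (hk z).hasFDerivWithinAt)
    (fun z _ => by simpa using hp.fderiv_lip (w + z) (w' + z)) (Set.mem_univ _) (Set.mem_univ _)
  simp only [add_zero, sub_zero, Real.norm_eq_abs] at h2
  have h3 : |(fderiv ℝ p w - fderiv ℝ p w') δ'| ≤ M * ‖w - w'‖ * ‖δ'‖ :=
    (ContinuousLinearMap.le_opNorm _ _).trans
      (mul_le_mul_of_nonneg_right (hp.fderiv_lip w w') (norm_nonneg _))
  have h4 : M * ‖w - w'‖ * ‖δ'‖ ≤ M * ‖w - w'‖ * R :=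
    mul_le_mul_of_nonneg_left hδ' (mul_nonneg hp.nonneg (norm_nonneg _))
  have e : taylorRem p w δ - taylorRem p w' δ' =
      (p (w + δ) - p (w + δ') - fderiv ℝ p w (δ - δ')) +
      (p (w + δ') - p (w' + δ') - (p w - p w')) - (fderiv ℝ p w - fderiv ℝ p w') δ' := by
    simp only [taylorRem, map_sub, sub_apply]
    ring
  rw [e]
  refine (abs_sub _ _).trans ?_
  refine (add_le_add_left (abs_add_le _ _) _).trans ?_
  linarith

end Taylor

section Blocks

/-- The times in `[0, N)` at distance at least `m` from `n`. -/
def farTimes (N n m : ℕ) : Finset ℕ := {i ∈ Finset.range N | i + m ≤ n ∨ n + m ≤ i}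

/-- The times in `[0, N)` at distance exactly `m` from `n`. -/
def sphereTimes (N n m : ℕ) : Finset ℕ := {i ∈ Finset.range N | i + m = n ∨ n + m = i}

lemma farTimes_zero (N n : ℕ) : farTimes N n 0 = Finset.range N :=
  Finset.filter_true_of_mem fun i _ => by omega

lemma farTimes_eq_empty {N n m : ℕ} (hn : n < N) (hm : N ≤ m) : farTimes N n m = ∅ :=
  Finset.filter_false_of_mem fun i hi => by
    rw [Finset.mem_range] at hi
    omega

lemma farTimes_eq_union (N n m : ℕ) :
    farTimes N n m = farTimes N n (m + 1) ∪ sphereTimes N n m := by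
  ext i
  simp only [farTimes, sphereTimes, Finset.mem_union, Finset.mem_filter, Finset.mem_range]
  omega

lemma disjoint_farTimes_sphereTimes (N n m : ℕ) :
    Disjoint (farTimes N n (m + 1)) (sphereTimes N n m) := by
  rw [Finset.disjoint_left]
  intro i
  simp only [farTimes, sphereTimes, Finset.mem_filter, Finset.mem_range]
  omega

lemma sphereTimes_subset (N n m : ℕ) : sphereTimes N n m ⊆ farTimes N n m := by
  rw [farTimes_eq_union]
  exact Finset.subset_union_right

lemma farTimes_anti (N n : ℕ) {m m' : ℕ} (h : m ≤ m') : farTimes N n m' ⊆ farTimes N n m := by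
  intro i
  simp only [farTimes, Finset.mem_filter]
  exact fun hi => ⟨hi.1, by omega⟩

lemma card_sphereTimes_le (N n m : ℕ) : (sphereTimes N n m).card ≤ 2 := by
  refine (Finset.card_le_card (t := {n - m, n + m}) fun i hi => ?_).trans Finset.card_le_two
  simp only [sphereTimes, Finset.mem_filter] at hi
  simp only [Finset.mem_insert, Finset.mem_singleton]
  omega

variable {d : ℕ}

/-- The partial sum of the process `v` over a set of times. -/
def blockSum (v : ℕ → I → Fin d → ℝ) (T : Finset ℕ) (ω : ℕ → I) : Fin d → ℝ :=
  ∑ i ∈ T, v i (ω i)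

/-- Uniformly bounded and Lipschitz observables. -/
structure UniformLip (A : ℝ) (v : ℕ → I → Fin d → ℝ) : Prop where
  bound : ∀ i y, ‖v i y‖ ≤ A
  lip : ∀ i y y', ‖v i y - v i y'‖ ≤ A * dist y y'

variable {A : ℝ} {v : ℕ → I → Fin d → ℝ}

lemma UniformLip.nonneg (hv : UniformLip A v) : 0 ≤ A := (norm_nonneg _).trans (hv.bound 0 0)

lemma UniformLip.continuous (hv : UniformLip A v) (i : ℕ) : Continuous (v i) := by
  have : LipschitzWith (Real.toNNReal A) (v i) := LipschitzWith.of_dist_le_mul fun w w' => by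
    rw [dist_eq_norm, Real.coe_toNNReal _ hv.nonneg]
    exact hv.lip i w w'
  exact this.continuous

lemma UniformLip.continuous_blockSum (hv : UniformLip A v) (T : Finset ℕ) :
    Continuous (blockSum v T) :=
  continuous_finsetSum _ fun i _ => (hv.continuous i).comp (continuous_apply i)

lemma UniformLip.blockSum_sub_le (hv : UniformLip A v) (T : Finset ℕ) (ω ω' : ℕ → I) :
    ‖blockSum v T ω - blockSum v T ω'‖ ≤ A * ∑ i ∈ T, dist (ω i) (ω' i) := by
  rw [blockSum, blockSum, ← Finset.sum_sub_distrib, Finset.mul_sum]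
  exact norm_sum_le_of_le _ fun i _ => hv.lip i _ _

lemma blockSum_farTimes (v : ℕ → I → Fin d → ℝ) (N n m : ℕ) (ω : ℕ → I) :
    blockSum v (farTimes N n m) ω =
      blockSum v (farTimes N n (m + 1)) ω + blockSum v (sphereTimes N n m) ω := by
  rw [farTimes_eq_union]
  exact Finset.sum_union (disjoint_farTimes_sphereTimes N n m)

lemma UniformLip.blockSum_sphere_le (hv : UniformLip A v) (N n m : ℕ) (ω : ℕ → I) :
    ‖blockSum v (sphereTimes N n m) ω‖ ≤ 2 * A := by
  refine (norm_sum_le_of_le _ fun i _ => hv.bound i (ω i)).trans ?_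
  rw [Finset.sum_const, nsmul_eq_mul]
  have : ((sphereTimes N n m).card : ℝ) ≤ 2 := by exact_mod_cast card_sphereTimes_le N n m
  exact mul_le_mul_of_nonneg_right this hv.nonneg

lemma UniformLip.blockSum_far_sub_le (hv : UniformLip A v) (N n m k : ℕ) (ω : ℕ → I) :
    ‖blockSum v (farTimes N n m) ω - blockSum v (farTimes N n (m + k)) ω‖ ≤ 2 * A * k := by
  induction k with
  | zero => simp
  | succ k ih =>
    have h1 := blockSum_farTimes v N n (m + k) ω
    have h2 := hv.blockSum_sphere_le N n (m + k) ω
    have e : blockSum v (farTimes N n m) ω - blockSum v (farTimes N n (m + (k + 1))) ω =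
        (blockSum v (farTimes N n m) ω - blockSum v (farTimes N n (m + k)) ω) +
          blockSum v (sphereTimes N n (m + k)) ω := by
      rw [h1]
      simp only [← add_assoc]
      abel
    rw [e]
    refine (norm_add_le _ _).trans ?_
    push_cast
    linarith

lemma UniformLip.boundedLip_coord (hv : UniformLip A v) (n : ℕ) (a : Fin d) :
    BoundedLip A {n} (fun ω => v n (ω n) a) where
  bound ω := (norm_le_pi_norm (v n (ω n)) a).trans (hv.bound n _)
  lip ω ω' := by
    rw [Finset.sum_singleton]
    exact (norm_le_pi_norm (v n (ω n) - v n (ω' n)) a).trans (hv.lip n _ _)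

lemma UniformLip.boundedLip_sphere (hv : UniformLip A v) (N n m : ℕ) (b : Fin d) :
    BoundedLip (2 * A) (sphereTimes N n m) (fun ω => blockSum v (sphereTimes N n m) ω b) where
  bound ω := (norm_le_pi_norm _ b).trans (hv.blockSum_sphere_le N n m ω)
  lip ω ω' := by
    have h1 := (norm_le_pi_norm (blockSum v (sphereTimes N n m) ω -
      blockSum v (sphereTimes N n m) ω') b).trans (hv.blockSum_sub_le _ ω ω')
    have h2 := (norm_nonneg _).trans (hv.blockSum_sub_le (sphereTimes N n m) ω ω')
    rw [Pi.sub_apply, Real.norm_eq_abs] at h1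
    linarith

end Blocks

variable {d : ℕ}

/-- The partial derivative of `p` in the direction of the `b`-th coordinate. -/
noncomputable def partialDeriv (p : (Fin d → ℝ) → ℝ) (b : Fin d) (w : Fin d → ℝ) : ℝ :=
  fderiv ℝ p w (Pi.single b 1)

lemma fderiv_eq_sum_partialDeriv (p : (Fin d → ℝ) → ℝ) (w δ : Fin d → ℝ) :
    fderiv ℝ p w δ = ∑ b, δ b * partialDeriv p b w := by
  conv_lhs => rw [← Finset.univ_sum_single δ, map_sum]
  refine Finset.sum_congr rfl fun b _ => ?_
  rw [partialDeriv, ← smul_eq_mul, ← map_smul]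
  congr 1
  rw [← Pi.single_smul, smul_eq_mul, mul_one]

lemma norm_apply_single_le (f : (Fin d → ℝ) →L[ℝ] ℝ) (b : Fin d) :
    |f (Pi.single b 1)| ≤ ‖f‖ := by
  have h := f.le_opNorm (Pi.single b 1)
  rwa [Pi.norm_single, norm_one, mul_one] at h

section Stein

variable {A M ε γ C : ℝ} {v : ℕ → I → Fin d → ℝ} {p : (Fin d → ℝ) → ℝ}

lemma SmoothBounded.abs_partialDeriv_le (hp : SmoothBounded M p) (b : Fin d) (w : Fin d → ℝ) :
    |partialDeriv p b w| ≤ M := (norm_apply_single_le _ b).trans (hp.fderiv_le w)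

lemma SmoothBounded.abs_partialDeriv_sub_le (hp : SmoothBounded M p) (b : Fin d)
    (w w' : Fin d → ℝ) : |partialDeriv p b w - partialDeriv p b w'| ≤ M * ‖w - w'‖ :=
  (norm_apply_single_le (fderiv ℝ p w - fderiv ℝ p w') b).trans (hp.fderiv_lip w w')

lemma SmoothBounded.continuous_partialDeriv (hp : SmoothBounded M p) (b : Fin d) :
    Continuous (partialDeriv p b) :=
  hp.continuous_fderiv.clm_apply continuous_const

/-- The normalised partial sum. -/
def normSum (ε : ℝ) (v : ℕ → I → Fin d → ℝ) (T : Finset ℕ) (ω : ℕ → I) : Fin d → ℝ :=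
  ε • blockSum v T ω

lemma UniformLip.continuous_normSum (hv : UniformLip A v) (T : Finset ℕ) :
    Continuous (normSum ε v T) := (hv.continuous_blockSum T).const_smul ε

lemma UniformLip.normSum_sub_le (hv : UniformLip A v) (hε : 0 ≤ ε) (T : Finset ℕ) (ω ω' : ℕ → I) :
    ‖normSum ε v T ω - normSum ε v T ω'‖ ≤ ε * (A * ∑ i ∈ T, dist (ω i) (ω' i)) := by
  rw [normSum, normSum, ← smul_sub, norm_smul, Real.norm_of_nonneg hε]
  exact mul_le_mul_of_nonneg_left (hv.blockSum_sub_le T ω ω') hε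

lemma UniformLip.normSum_far_sub_le (hv : UniformLip A v) (hε : 0 ≤ ε) (N n m k : ℕ) (ω : ℕ → I) :
    ‖normSum ε v (farTimes N n m) ω - normSum ε v (farTimes N n (m + k)) ω‖ ≤
      ε * (2 * A * k) := by
  rw [normSum, normSum, ← smul_sub, norm_smul, Real.norm_of_nonneg hε]
  exact mul_le_mul_of_nonneg_left (hv.blockSum_far_sub_le N n m k ω) hε

lemma UniformLip.normSum_sphere_le (hv : UniformLip A v) (hε : 0 ≤ ε) (N n m : ℕ) (ω : ℕ → I) :
    ‖normSum ε v (sphereTimes N n m) ω‖ ≤ ε * (2 * A) := by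
  rw [normSum, norm_smul, Real.norm_of_nonneg hε]
  exact mul_le_mul_of_nonneg_left (hv.blockSum_sphere_le N n m ω) hε

lemma normSum_farTimes (ε : ℝ) (v : ℕ → I → Fin d → ℝ) (N n m : ℕ) (ω : ℕ → I) :
    normSum ε v (farTimes N n m) ω =
      normSum ε v (farTimes N n (m + 1)) ω + normSum ε v (sphereTimes N n m) ω := by
  rw [normSum, blockSum_farTimes, smul_add]
  rfl

lemma boundedLip_taylorRem (hv : UniformLip A v) (hp : SmoothBounded M p) (hε : 0 ≤ ε)
    (N n m : ℕ) :
    BoundedLip (4 * M * A ^ 2 * ε ^ 2) (farTimes N n m) (fun ω =>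
      taylorRem p (normSum ε v (farTimes N n (m + 1)) ω) (normSum ε v (sphereTimes N n m) ω)) where
  bound ω := by
    refine (hp.abs_taylorRem_le _ _ (hv.normSum_sphere_le hε N n m ω)).trans_eq ?_
    ring
  lip ω ω' := by
    refine (hp.abs_taylorRem_sub_le _ _ _ _ (hv.normSum_sphere_le hε N n m ω)
      (hv.normSum_sphere_le hε N n m ω')).trans ?_
    have h1 := hv.normSum_sub_le hε (sphereTimes N n m) ω ω'
    have h2 := hv.normSum_sub_le hε (farTimes N n (m + 1)) ω ω'
    have h3 : ∑ i ∈ farTimes N n m, dist (ω i) (ω' i) =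
        ∑ i ∈ farTimes N n (m + 1), dist (ω i) (ω' i) +
          ∑ i ∈ sphereTimes N n m, dist (ω i) (ω' i) := by
      rw [farTimes_eq_union]
      exact Finset.sum_union (disjoint_farTimes_sphereTimes N n m)
    have h4 : 0 ≤ ∑ i ∈ sphereTimes N n m, dist (ω i) (ω' i) :=
      Finset.sum_nonneg fun _ _ => dist_nonneg
    have hA := hv.nonneg
    have hM := hp.nonneg
    rw [h3]
    have h5 : ‖normSum ε v (sphereTimes N n m) ω - normSum ε v (sphereTimes N n m) ω'‖ +
        2 * ‖normSum ε v (farTimes N n (m + 1)) ω - normSum ε v (farTimes N n (m + 1)) ω'‖ ≤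
        2 * (ε * A) * (∑ i ∈ farTimes N n (m + 1), dist (ω i) (ω' i) +
          ∑ i ∈ sphereTimes N n m, dist (ω i) (ω' i)) := by
      have : 0 ≤ ε * A * ∑ i ∈ sphereTimes N n m, dist (ω i) (ω' i) := by positivity
      linarith
    refine (mul_le_mul_of_nonneg_left h5 (by positivity)).trans_eq ?_
    ring

lemma boundedLip_partialDeriv_sub (hv : UniformLip A v) (hp : SmoothBounded M p) (hε : 0 ≤ ε)
    (N n m k : ℕ) (b : Fin d) {B : ℝ} (hk : (k : ℝ) ≤ B) (hB : 1 ≤ B) :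
    BoundedLip (2 * M * A * ε * B) (farTimes N n m) (fun ω =>
      partialDeriv p b (normSum ε v (farTimes N n m) ω) -
        partialDeriv p b (normSum ε v (farTimes N n (m + k)) ω)) where
  bound ω := by
    have hA := hv.nonneg
    have hM := hp.nonneg
    refine (hp.abs_partialDeriv_sub_le b _ _).trans ?_
    refine (mul_le_mul_of_nonneg_left (hv.normSum_far_sub_le hε N n m k ω) hM).trans ?_
    have : M * (ε * (2 * A * k)) = 2 * M * A * ε * k := by ring
    rw [this]
    gcongr
  lip ω ω' := by
    have hA := hv.nonneg
    have hM := hp.nonneg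
    set s := ∑ i ∈ farTimes N n m, dist (ω i) (ω' i) with hs
    have hs0 : 0 ≤ s := Finset.sum_nonneg fun _ _ => dist_nonneg
    have key : ∀ T ⊆ farTimes N n m, |partialDeriv p b (normSum ε v T ω) -
        partialDeriv p b (normSum ε v T ω')| ≤ M * (ε * (A * s)) := by
      intro T hT
      refine (hp.abs_partialDeriv_sub_le b _ _).trans (mul_le_mul_of_nonneg_left ?_ hM)
      refine (hv.normSum_sub_le hε T ω ω').trans ?_
      have : ∑ i ∈ T, dist (ω i) (ω' i) ≤ s :=
        Finset.sum_le_sum_of_subset_of_nonneg hT fun _ _ _ => dist_nonneg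
      gcongr
    have h1 := key _ (Finset.Subset.refl _)
    have h2 := key _ (farTimes_anti N n (Nat.le_add_right m k))
    rw [sub_sub_sub_comm]
    refine (abs_sub _ _).trans ((add_le_add h1 h2).trans ?_)
    have h3 : 2 * M * A * ε * s * 1 ≤ 2 * M * A * ε * s * B :=
      mul_le_mul_of_nonneg_left hB (by positivity)
    linarith

variable {ν : Measure (ℕ → I)}

lemma Mixing.single_le (hmix : Mixing ν γ C) (hv : UniformLip A v)
    (hv0 : ∀ i a, ∫ ω, v i (ω i) a ∂ν = 0) {N n m : ℕ} (a : Fin d) {b₂ : ℝ} {Q : (ℕ → I) → ℝ}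
    (hQ : BoundedLip b₂ (farTimes N n m) Q) :
    |∫ ω, v n (ω n) a * Q ω ∂ν| ≤ C * A * b₂ * ((m : ℝ) + 1) ^ (-γ) := by
  refine hmix n n m A b₂ {n} (farTimes N n m) _ Q (hv.boundedLip_coord n a) hQ ?_ le_rfl ?_
    (hv0 n a)
  · intro i hi
    rw [Finset.mem_singleton] at hi
    omega
  · intro i hi
    exact (Finset.mem_filter.1 hi).2

variable [IsProbabilityMeasure ν]

lemma Mixing.sphere_le (hmix : Mixing ν γ C) (hv : UniformLip A v) (hp : SmoothBounded M p)
    (hε : 0 ≤ ε) {N n m j : ℕ} (hmj : m ≤ j) (a b : Fin d) :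
    |∫ ω, (v n (ω n) a * blockSum v (sphereTimes N n m) ω b -
        ∫ ω, v n (ω n) a * blockSum v (sphereTimes N n m) ω b ∂ν) *
      (partialDeriv p b (normSum ε v (farTimes N n j) ω) -
        partialDeriv p b (normSum ε v (farTimes N n (j + 1)) ω)) ∂ν| ≤
      C * (8 * A ^ 2) * (2 * M * A * ε) * (((j - m : ℕ) : ℝ) + 1) ^ (-γ) := by
  have h1 := ((hv.boundedLip_coord n a).mono le_rfl
    (Finset.subset_union_left (s₂ := sphereTimes N n m))).mul
    ((hv.boundedLip_sphere N n m b).mono le_rfl (Finset.subset_union_right (s₁ := {n})))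
  have h2 := h1.sub_const (abs_integral_le_of_forall (ν := ν) h1.bound)
  have h3 := boundedLip_partialDeriv_sub hv hp hε N n j 1 b (B := 1) (by simp) le_rfl
  have h4 : 2 * (2 * (A * (2 * A))) = 8 * A ^ 2 := by ring
  rw [h4] at h2
  rw [mul_one] at h3
  refine hmix (n - m) (n + m) (j - m) _ _ _ _ _ _ h2 h3 ?_ (by omega) ?_ ?_
  · intro i hi
    rw [Finset.mem_union, Finset.mem_singleton] at hi
    rcases hi with rfl | hi
    · omega
    · have := (Finset.mem_filter.1 hi).2
      omega
  · intro i hi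
    have := (Finset.mem_filter.1 hi).2
    omega
  · rw [integral_sub (integrable_of_continuous h1.continuous) (integrable_const _)]
    simp

/-- The constant `∑ (t + 1) ^ (-γ / 2)`. -/
noncomputable def decaySum (γ : ℝ) : ℝ := ∑' t : ℕ, ((t : ℝ) + 1) ^ (-(γ / 2))

lemma summable_decay (hγ : 2 < γ) : Summable fun t : ℕ => ((t : ℝ) + 1) ^ (-(γ / 2)) := by
  have := (summable_nat_add_iff 1).2 (Real.summable_nat_rpow.2
    (show -(γ / 2) < -1 by linarith))
  simpa using this

lemma sum_decay_le (hγ : 2 < γ) (N : ℕ) :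
    ∑ t ∈ Finset.range N, ((t : ℝ) + 1) ^ (-(γ / 2)) ≤ decaySum γ :=
  (summable_decay hγ).sum_le_tsum _ fun _ _ => by positivity

lemma add_rpow_le (hγ : 2 < γ) {s t : ℝ} (hs : 0 < s) (ht : 0 < t) :
    (s + t) ^ (-γ) ≤ s ^ (-(γ / 2)) * t ^ (-(γ / 2)) := by
  have e : -γ = -(γ / 2) + -(γ / 2) := by ring
  rw [e, Real.rpow_add (by positivity)]
  exact mul_le_mul (Real.rpow_le_rpow_of_nonpos hs (by linarith) (by linarith))
    (Real.rpow_le_rpow_of_nonpos ht (by linarith) (by linarith)) (by positivity) (by positivity)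

lemma mul_rpow_neg_le (hγ : 2 < γ) {s : ℝ} (hs : 1 ≤ s) : s * s ^ (-γ) ≤ s ^ (-(γ / 2)) := by
  have h0 : 0 < s := by linarith
  have : s * s ^ (-γ) = s ^ (1 + -γ) := by rw [Real.rpow_add h0, Real.rpow_one]
  rw [this]
  exact Real.rpow_le_rpow_of_exponent_le hs (by linarith)

/-- The second-order term in the expansion of the Stein functional. -/
lemma Mixing.second_order_le (hmix : Mixing ν γ C) (hC : 0 ≤ C) (hγ : 2 < γ) (hv : UniformLip A v)
    (hv0 : ∀ i a, ∫ ω, v i (ω i) a ∂ν = 0) (hp : SmoothBounded M p) (hε : 0 ≤ ε) {N n m : ℕ}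
    (hn : n < N) (a b : Fin d) :
    |∫ ω, v n (ω n) a * blockSum v (sphereTimes N n m) ω b *
        partialDeriv p b (normSum ε v (farTimes N n (m + 1)) ω) ∂ν -
      (∫ ω, v n (ω n) a * blockSum v (sphereTimes N n m) ω b ∂ν) *
        ∫ ω, partialDeriv p b (normSum ε v (Finset.range N) ω) ∂ν| ≤
      C * M * A ^ 3 * (16 + 16 * decaySum γ) * ε * ((m : ℝ) + 1) ^ (-(γ / 2)) := by
  have hA := hv.nonneg
  have hM := hp.nonneg
  set u : (ℕ → I) → ℝ := fun ω => v n (ω n) a with hu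
  set U : (ℕ → I) → ℝ := fun ω => blockSum v (sphereTimes N n m) ω b with hU
  set P : ℕ → (ℕ → I) → ℝ := fun j ω => partialDeriv p b (normSum ε v (farTimes N n j) ω) with hP
  have hPc : ∀ j, Continuous (P j) := fun j =>
    (hp.continuous_partialDeriv b).comp (hv.continuous_normSum _)
  have huc : Continuous u := (hv.boundedLip_coord n a).continuous
  have hUc : Continuous U := (hv.boundedLip_sphere N n m b).continuous
  set c : ℝ := ∫ ω, u ω * U ω ∂ν with hc
  set D : ℝ := ((m : ℝ) + 1) ^ (-(γ / 2)) with hD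
  have hD0 : 0 ≤ D := by positivity
  have hmD : ((m : ℝ) + 1) * ((m : ℝ) + 1) ^ (-γ) ≤ D := mul_rpow_neg_le hγ (by simp)
  have hP0 : P 0 = fun ω => partialDeriv p b (normSum ε v (Finset.range N) ω) := by
    simp only [hP, farTimes_zero]
  change |∫ ω, u ω * U ω * P (m + 1) ω ∂ν - c * ∫ ω, partialDeriv p b _ ∂ν| ≤ _
  rw [← hP0]
  -- enlarge the neighbourhood
  have h2 : |∫ ω, u ω * ((P (m + 1) ω - P (m + 1 + m) ω) * U ω) ∂ν| ≤
      8 * (C * M * A ^ 3 * ε * D) := by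
    have e1 := (boundedLip_partialDeriv_sub hv hp hε N n (m + 1) m b (B := (m : ℝ) + 1)
      (by linarith) (by simp)).mono le_rfl (farTimes_anti N n (Nat.le_succ m))
    have e2 := (hv.boundedLip_sphere N n m b).mono le_rfl (sphereTimes_subset N n m)
    have e3 := hmix.single_le hv hv0 a (e1.mul e2)
    refine e3.trans ?_
    have e4 : C * A * (2 * (2 * M * A * ε * ((m : ℝ) + 1) * (2 * A))) * ((m : ℝ) + 1) ^ (-γ) =
        8 * (C * M * A ^ 3 * ε) * (((m : ℝ) + 1) * ((m : ℝ) + 1) ^ (-γ)) := by ring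
    rw [e4]
    refine (mul_le_mul_of_nonneg_left hmD (by positivity)).trans_eq ?_
    ring
  -- decorrelate the product of two coordinates from the rest
  have h3 : |∫ ω, (u ω * U ω - c) * P (m + 1 + m) ω ∂ν| ≤
      16 * decaySum γ * (C * M * A ^ 3 * ε * D) := by
    have hend : ∀ ω, P (m + 1 + m + N) ω = partialDeriv p b 0 := fun ω => by
      simp only [hP]
      rw [farTimes_eq_empty hn (by omega)]
      simp [normSum, blockSum]
    have htel : ∀ ω, P (m + 1 + m) ω = (∑ t ∈ Finset.range N,
        (P (m + 1 + m + t) ω - P (m + 1 + m + t + 1) ω)) + partialDeriv p b 0 := fun ω => by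
      have := Finset.sum_range_sub' (fun t => P (m + 1 + m + t) ω) N
      simp only [add_assoc, add_zero] at this hend ⊢
      rw [this, hend]
      ring
    have hcen : ∫ ω, (u ω * U ω - c) ∂ν = 0 := by
      rw [integral_sub (f := fun ω => u ω * U ω) (integrable_of_continuous (huc.mul hUc))
        (integrable_const _)]
      simp [hc]
    have e1 : ∫ ω, (u ω * U ω - c) * P (m + 1 + m) ω ∂ν = ∑ t ∈ Finset.range N,
        ∫ ω, (u ω * U ω - c) * (P (m + 1 + m + t) ω - P (m + 1 + m + t + 1) ω) ∂ν := by
      rw [← integral_finsetSum _ fun t _ => integrable_of_continuous (by fun_prop)]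
      have e2 : ∀ ω, (u ω * U ω - c) * P (m + 1 + m) ω =
          (∑ t ∈ Finset.range N, (u ω * U ω - c) *
            (P (m + 1 + m + t) ω - P (m + 1 + m + t + 1) ω)) +
          (u ω * U ω - c) * partialDeriv p b 0 := fun ω => by
        rw [htel, mul_add, Finset.mul_sum]
      simp only [e2]
      rw [integral_add (integrable_of_continuous (by fun_prop))
        (integrable_of_continuous (by fun_prop)), integral_mul_const, hcen, zero_mul, add_zero]
    rw [e1]
    refine (Finset.abs_sum_le_sum_abs _ _).trans ?_
    have e3 : ∀ t ∈ Finset.range N,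
        |∫ ω, (u ω * U ω - c) * (P (m + 1 + m + t) ω - P (m + 1 + m + t + 1) ω) ∂ν| ≤
          16 * (C * M * A ^ 3 * ε * D) * ((t : ℝ) + 1) ^ (-(γ / 2)) := by
      intro t _
      have e4 := hmix.sphere_le hv hp hε (N := N) (n := n) (m := m) (j := m + 1 + m + t)
        (by omega) a b
      refine e4.trans ?_
      have e5 : (((m + 1 + m + t - m : ℕ) : ℝ) + 1) ^ (-γ) ≤ D * ((t : ℝ) + 1) ^ (-(γ / 2)) := by
        have : ((m + 1 + m + t - m : ℕ) : ℝ) + 1 = ((m : ℝ) + 1) + ((t : ℝ) + 1) := by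
          have : m + 1 + m + t - m = m + 1 + t := by omega
          rw [this]
          push_cast
          ring
        rw [this]
        exact add_rpow_le hγ (by positivity) (by positivity)
      refine (mul_le_mul_of_nonneg_left e5 (by positivity)).trans_eq ?_
      ring
    refine (Finset.sum_le_sum e3).trans ?_
    rw [← Finset.mul_sum]
    refine (mul_le_mul_of_nonneg_left (sum_decay_le hγ N) (by positivity)).trans_eq ?_
    ring
  -- restore the neighbourhood
  have h4 : |c * (∫ ω, P (m + 1 + m) ω ∂ν - ∫ ω, P 0 ω ∂ν)| ≤ 8 * (C * M * A ^ 3 * ε * D) := by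
    have e1 : |c| ≤ C * A * (2 * A) * ((m : ℝ) + 1) ^ (-γ) :=
      hmix.single_le hv hv0 a ((hv.boundedLip_sphere N n m b).mono le_rfl
        (sphereTimes_subset N n m))
    have e2 : |∫ ω, P (m + 1 + m) ω ∂ν - ∫ ω, P 0 ω ∂ν| ≤ M * (ε * (2 * A * (2 * ((m : ℝ) + 1)))) := by
      rw [← integral_sub (integrable_of_continuous (hPc _)) (integrable_of_continuous (hPc _))]
      refine abs_integral_le_of_forall fun ω => ?_
      rw [abs_sub_comm]
      refine (hp.abs_partialDeriv_sub_le b _ _).trans (mul_le_mul_of_nonneg_left ?_ hM)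
      have e3 := hv.normSum_far_sub_le hε N n 0 (m + 1 + m) ω
      rw [zero_add] at e3
      refine e3.trans ?_
      have : ((m + 1 + m : ℕ) : ℝ) ≤ 2 * ((m : ℝ) + 1) := by push_cast; linarith
      gcongr
    rw [abs_mul]
    refine (mul_le_mul e1 e2 (abs_nonneg _) (by positivity)).trans ?_
    have e4 : C * A * (2 * A) * ((m : ℝ) + 1) ^ (-γ) *
        (M * (ε * (2 * A * (2 * ((m : ℝ) + 1))))) =
        8 * (C * M * A ^ 3 * ε) * (((m : ℝ) + 1) * ((m : ℝ) + 1) ^ (-γ)) := by ring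
    rw [e4]
    refine (mul_le_mul_of_nonneg_left hmD (by positivity)).trans_eq ?_
    ring
  have hsplit : ∫ ω, u ω * U ω * P (m + 1) ω ∂ν - c * ∫ ω, P 0 ω ∂ν =
      ∫ ω, u ω * ((P (m + 1) ω - P (m + 1 + m) ω) * U ω) ∂ν +
      ∫ ω, (u ω * U ω - c) * P (m + 1 + m) ω ∂ν +
      c * (∫ ω, P (m + 1 + m) ω ∂ν - ∫ ω, P 0 ω ∂ν) := by
    have e1 : ∫ ω, (u ω * U ω - c) * P (m + 1 + m) ω ∂ν =
        ∫ ω, u ω * U ω * P (m + 1 + m) ω ∂ν - c * ∫ ω, P (m + 1 + m) ω ∂ν := by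
      simp only [sub_mul]
      rw [integral_sub (integrable_of_continuous (by fun_prop))
        (integrable_of_continuous (by fun_prop)), integral_const_mul]
    have e2 : ∫ ω, u ω * ((P (m + 1) ω - P (m + 1 + m) ω) * U ω) ∂ν =
        ∫ ω, u ω * U ω * P (m + 1) ω ∂ν - ∫ ω, u ω * U ω * P (m + 1 + m) ω ∂ν := by
      rw [← integral_sub (integrable_of_continuous (by fun_prop))
        (integrable_of_continuous (by fun_prop))]
      congr with ω
      ring
    rw [e1, e2]
    ring
  rw [hsplit]
  refine (abs_add_le _ _).trans ?_
  refine (add_le_add_left (abs_add_le _ _) _).trans ?_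
  calc _ ≤ 8 * (C * M * A ^ 3 * ε * D) + 16 * decaySum γ * (C * M * A ^ 3 * ε * D) +
        8 * (C * M * A ^ 3 * ε * D) := by linarith
    _ = _ := by ring

/-- The contribution of a pair of a time and a distance to the Stein functional. -/
lemma Mixing.pair_le (hmix : Mixing ν γ C) (hC : 0 ≤ C) (hγ : 2 < γ) (hv : UniformLip A v)
    (hv0 : ∀ i a, ∫ ω, v i (ω i) a ∂ν = 0) (hp : SmoothBounded M p) (hε : 0 ≤ ε) {N n m : ℕ}
    (hn : n < N) (a : Fin d) :
    |∫ ω, v n (ω n) a * (p (normSum ε v (farTimes N n m) ω) -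
        p (normSum ε v (farTimes N n (m + 1)) ω)) ∂ν -
      ε * ∑ b, (∫ ω, v n (ω n) a * blockSum v (sphereTimes N n m) ω b ∂ν) *
        ∫ ω, partialDeriv p b (normSum ε v (Finset.range N) ω) ∂ν| ≤
      C * M * A ^ 3 * (4 + d * (16 + 16 * decaySum γ)) * ε ^ 2 * ((m : ℝ) + 1) ^ (-(γ / 2)) := by
  have hA := hv.nonneg
  have hM := hp.nonneg
  set D : ℝ := ((m : ℝ) + 1) ^ (-(γ / 2)) with hD
  have hD0 : 0 ≤ D := by positivity
  have hpc : Continuous p := hp.diff.continuous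
  have hR := boundedLip_taylorRem hv hp hε N n m
  have h1 := hmix.single_le hv hv0 a hR
  have hmD : ((m : ℝ) + 1) ^ (-γ) ≤ D :=
    Real.rpow_le_rpow_of_exponent_le (by simp) (by linarith)
  have huc : Continuous fun ω : ℕ → I => v n (ω n) a := (hv.boundedLip_coord n a).continuous
  have hvc : ∀ i, Continuous (v i) := hv.continuous
  have hUc : ∀ T, Continuous (blockSum v T) := hv.continuous_blockSum
  have hWc : ∀ T, Continuous (normSum ε v T) := fun T => hv.continuous_normSum T
  have hPc : ∀ b, Continuous (partialDeriv p b) := hp.continuous_partialDeriv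
  have hexp : ∀ ω, v n (ω n) a * (p (normSum ε v (farTimes N n m) ω) -
        p (normSum ε v (farTimes N n (m + 1)) ω)) =
      v n (ω n) a * taylorRem p (normSum ε v (farTimes N n (m + 1)) ω)
        (normSum ε v (sphereTimes N n m) ω) +
      ∑ b, ε * (v n (ω n) a * blockSum v (sphereTimes N n m) ω b *
        partialDeriv p b (normSum ε v (farTimes N n (m + 1)) ω)) := by
    intro ω
    have e : ∑ b, ε * (v n (ω n) a * blockSum v (sphereTimes N n m) ω b *
        partialDeriv p b (normSum ε v (farTimes N n (m + 1)) ω)) =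
        v n (ω n) a * fderiv ℝ p (normSum ε v (farTimes N n (m + 1)) ω)
          (normSum ε v (sphereTimes N n m) ω) := by
      rw [fderiv_eq_sum_partialDeriv, Finset.mul_sum]
      refine Finset.sum_congr rfl fun b _ => ?_
      simp only [normSum, Pi.smul_apply, smul_eq_mul]
      ring
    rw [taylorRem, ← normSum_farTimes, e]
    ring
  simp only [hexp]
  rw [integral_add (f := fun ω => v n (ω n) a * taylorRem p
      (normSum ε v (farTimes N n (m + 1)) ω) (normSum ε v (sphereTimes N n m) ω))
    (integrable_of_continuous (huc.mul hR.continuous)) (integrable_of_continuous (by fun_prop)),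
    integral_finsetSum _ fun b _ => integrable_of_continuous (by fun_prop), add_sub_assoc,
    Finset.mul_sum, ← Finset.sum_sub_distrib]
  refine (abs_add_le _ _).trans ?_
  have h2 : ∀ b ∈ Finset.univ, |∫ ω, ε * (v n (ω n) a * blockSum v (sphereTimes N n m) ω b *
        partialDeriv p b (normSum ε v (farTimes N n (m + 1)) ω)) ∂ν -
      ε * ((∫ ω, v n (ω n) a * blockSum v (sphereTimes N n m) ω b ∂ν) *
        ∫ ω, partialDeriv p b (normSum ε v (Finset.range N) ω) ∂ν)| ≤
      ε * (C * M * A ^ 3 * (16 + 16 * decaySum γ) * ε * D) := by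
    intro b _
    rw [integral_const_mul, ← mul_sub, abs_mul, abs_of_nonneg hε]
    exact mul_le_mul_of_nonneg_left (hmix.second_order_le hC hγ hv hv0 hp hε hn a b) hε
  have h3 := (Finset.abs_sum_le_sum_abs _ _).trans (Finset.sum_le_sum h2)
  rw [Finset.sum_const, Finset.card_univ, Fintype.card_fin, nsmul_eq_mul] at h3
  have h4 : C * A * (4 * M * A ^ 2 * ε ^ 2) * ((m : ℝ) + 1) ^ (-γ) ≤
      C * A * (4 * M * A ^ 2 * ε ^ 2) * D := mul_le_mul_of_nonneg_left hmD (by positivity)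
  calc _ ≤ C * A * (4 * M * A ^ 2 * ε ^ 2) * D +
        d * (ε * (C * M * A ^ 3 * (16 + 16 * decaySum γ) * ε * D)) :=
        add_le_add (h1.trans h4) h3
    _ = _ := by ring

/-- The Stein functional of a normalised sum of a mixing sequence. -/
theorem Mixing.stein_le (hmix : Mixing ν γ C) (hC : 0 ≤ C) (hγ : 2 < γ) (hv : UniformLip A v)
    (hv0 : ∀ i a, ∫ ω, v i (ω i) a ∂ν = 0) (hp : SmoothBounded M p) (hε : 0 ≤ ε) {N : ℕ}
    (hN : N * ε ^ 2 = 1) (a : Fin d) :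
    |∫ ω, normSum ε v (Finset.range N) ω a * p (normSum ε v (Finset.range N) ω) ∂ν -
      ∑ b, (∫ ω, normSum ε v (Finset.range N) ω a * normSum ε v (Finset.range N) ω b ∂ν) *
        ∫ ω, partialDeriv p b (normSum ε v (Finset.range N) ω) ∂ν| ≤
      C * M * A ^ 3 * (4 + d * (16 + 16 * decaySum γ)) * decaySum γ * ε := by
  have hA := hv.nonneg
  have hM := hp.nonneg
  have hZ : 0 ≤ decaySum γ := tsum_nonneg fun _ => by positivity
  have hpc : Continuous p := hp.diff.continuous
  set W := normSum ε v (Finset.range N) with hW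
  have hWc : ∀ T, Continuous (normSum ε v T) := fun T => hv.continuous_normSum T
  have hvc : ∀ i, Continuous (v i) := hv.continuous
  have hWc' : Continuous W := hWc _
  have hWa : ∀ ω, W ω a = ε * ∑ n ∈ Finset.range N, v n (ω n) a := fun ω => by
    simp [hW, normSum, blockSum, Finset.sum_apply]
  have htel : ∀ (F : Finset ℕ → ℝ) n, n < N → F (Finset.range N) =
      ∑ m ∈ Finset.range N, (F (farTimes N n m) - F (farTimes N n (m + 1))) + F ∅ := by
    intro F n hn
    rw [Finset.sum_range_sub' (fun m => F (farTimes N n m)) N, farTimes_zero,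
      farTimes_eq_empty hn le_rfl]
    ring
  have h1 : ∫ ω, W ω a * p (W ω) ∂ν = ∑ n ∈ Finset.range N, ∑ m ∈ Finset.range N,
      ε * ∫ ω, v n (ω n) a * (p (normSum ε v (farTimes N n m) ω) -
        p (normSum ε v (farTimes N n (m + 1)) ω)) ∂ν := by
    have e1 : ∀ ω, W ω a * p (W ω) = ∑ n ∈ Finset.range N, ε * (v n (ω n) a * p (W ω)) := by
      intro ω
      rw [hWa, ← Finset.mul_sum, ← Finset.sum_mul, mul_assoc]
    simp only [e1]
    rw [integral_finsetSum _ fun n _ => integrable_of_continuous (by fun_prop)]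
    refine Finset.sum_congr rfl fun n hn => ?_
    rw [Finset.mem_range] at hn
    rw [integral_const_mul, ← Finset.mul_sum]
    congr 1
    have e2 : ∀ ω, v n (ω n) a * p (W ω) = (∑ m ∈ Finset.range N,
        v n (ω n) a * (p (normSum ε v (farTimes N n m) ω) -
          p (normSum ε v (farTimes N n (m + 1)) ω))) + v n (ω n) a * p 0 := by
      intro ω
      have := htel (fun T => p (normSum ε v T ω)) n hn
      simp only [hW]
      rw [this, mul_add, Finset.mul_sum]
      simp [normSum, blockSum]
    simp only [e2]
    rw [integral_add (integrable_of_continuous (by fun_prop))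
      (integrable_of_continuous (by fun_prop)), integral_mul_const, hv0, zero_mul, add_zero,
      integral_finsetSum _ fun m _ => integrable_of_continuous (by fun_prop)]
  have h2 : ∀ b, ∫ ω, W ω a * W ω b ∂ν = ∑ n ∈ Finset.range N, ∑ m ∈ Finset.range N,
      ε ^ 2 * ∫ ω, v n (ω n) a * blockSum v (sphereTimes N n m) ω b ∂ν := by
    intro b
    have hUc : ∀ T, Continuous (blockSum v T) := hv.continuous_blockSum
    have e1 : ∀ ω, W ω a * W ω b = ∑ n ∈ Finset.range N, ∑ m ∈ Finset.range N,
        ε ^ 2 * (v n (ω n) a * blockSum v (sphereTimes N n m) ω b) := by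
      intro ω
      rw [hWa, mul_assoc, Finset.sum_mul, Finset.mul_sum]
      refine Finset.sum_congr rfl fun n hn => ?_
      rw [Finset.mem_range] at hn
      rw [← Finset.mul_sum, ← Finset.mul_sum]
      have e2 := htel (fun T => blockSum v T ω b) n hn
      have e3 : ∀ m, blockSum v (farTimes N n m) ω b - blockSum v (farTimes N n (m + 1)) ω b =
          blockSum v (sphereTimes N n m) ω b := fun m => by
        rw [blockSum_farTimes v N n m, Pi.add_apply]
        ring
      have e4 : blockSum v ∅ ω b = 0 := by simp [blockSum]
      simp only [e3, e4, add_zero] at e2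
      rw [← e2]
      simp only [hW, normSum, Pi.smul_apply, smul_eq_mul]
      ring
    simp only [e1]
    rw [integral_finsetSum _ fun n _ => integrable_of_continuous (by fun_prop)]
    refine Finset.sum_congr rfl fun n _ => ?_
    rw [integral_finsetSum _ fun m _ => integrable_of_continuous (by fun_prop)]
    exact Finset.sum_congr rfl fun m _ => integral_const_mul _ _
  have h3 : ∫ ω, W ω a * p (W ω) ∂ν - ∑ b, (∫ ω, W ω a * W ω b ∂ν) *
        ∫ ω, partialDeriv p b (W ω) ∂ν =
      ∑ n ∈ Finset.range N, ∑ m ∈ Finset.range N, ε *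
        (∫ ω, v n (ω n) a * (p (normSum ε v (farTimes N n m) ω) -
          p (normSum ε v (farTimes N n (m + 1)) ω)) ∂ν -
        ε * ∑ b, (∫ ω, v n (ω n) a * blockSum v (sphereTimes N n m) ω b ∂ν) *
          ∫ ω, partialDeriv p b (W ω) ∂ν) := by
    have e1 : ∑ b, (∫ ω, W ω a * W ω b ∂ν) * ∫ ω, partialDeriv p b (W ω) ∂ν =
        ∑ n ∈ Finset.range N, ∑ m ∈ Finset.range N, ε * (ε * ∑ b,
          (∫ ω, v n (ω n) a * blockSum v (sphereTimes N n m) ω b ∂ν) *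
          ∫ ω, partialDeriv p b (W ω) ∂ν) := by
      simp only [h2, Finset.sum_mul, Finset.mul_sum]
      rw [Finset.sum_comm]
      refine Finset.sum_congr rfl fun n _ => ?_
      rw [Finset.sum_comm]
      refine Finset.sum_congr rfl fun m _ => Finset.sum_congr rfl fun b _ => ?_
      ring
    rw [h1, e1, ← Finset.sum_sub_distrib]
    refine Finset.sum_congr rfl fun n _ => ?_
    rw [← Finset.sum_sub_distrib]
    exact Finset.sum_congr rfl fun m _ => by ring
  rw [h3]
  set K : ℝ := C * M * A ^ 3 * (4 + d * (16 + 16 * decaySum γ)) with hK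
  have hK0 : 0 ≤ K := by positivity
  have h4 : ∀ n ∈ Finset.range N, |∑ m ∈ Finset.range N, ε *
        (∫ ω, v n (ω n) a * (p (normSum ε v (farTimes N n m) ω) -
          p (normSum ε v (farTimes N n (m + 1)) ω)) ∂ν -
        ε * ∑ b, (∫ ω, v n (ω n) a * blockSum v (sphereTimes N n m) ω b ∂ν) *
          ∫ ω, partialDeriv p b (W ω) ∂ν)| ≤ ε * (K * ε ^ 2 * decaySum γ) := by
    intro n hn
    rw [Finset.mem_range] at hn
    rw [← Finset.mul_sum, abs_mul, abs_of_nonneg hε]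
    refine mul_le_mul_of_nonneg_left ?_ hε
    refine (Finset.abs_sum_le_sum_abs _ _).trans ?_
    refine (Finset.sum_le_sum fun m _ => hmix.pair_le hC hγ hv hv0 hp hε hn a).trans ?_
    rw [← Finset.mul_sum]
    exact mul_le_mul_of_nonneg_left (sum_decay_le hγ N) (by positivity)
  refine (Finset.abs_sum_le_sum_abs _ _).trans ((Finset.sum_le_sum h4).trans_eq ?_)
  rw [Finset.sum_const, Finset.card_range, nsmul_eq_mul]
  calc (N : ℝ) * (ε * (K * ε ^ 2 * decaySum γ)) = (N * ε ^ 2) * (K * decaySum γ * ε) := by ring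
    _ = _ := by rw [hN, one_mul]

end Stein

section GaussianIntegrationByParts

lemma hasDerivAt_gaussianPDFReal_zero_one (x : ℝ) :
    HasDerivAt (gaussianPDFReal 0 1) (-x * gaussianPDFReal 0 1 x) x := by
  have h1 : HasDerivAt (fun x : ℝ => -(x - 0) ^ 2 / (2 * ((1 : ℝ≥0) : ℝ))) (-x) x := by
    have := ((((hasDerivAt_id x).sub_const 0).pow 2).neg).div_const (2 * ((1 : ℝ≥0) : ℝ))
    refine this.congr_deriv ?_
    simp
    ring
  have h2 := h1.exp.const_mul (√(2 * Real.pi * ((1 : ℝ≥0) : ℝ)))⁻¹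
  rw [gaussianPDFReal_def]
  refine h2.congr_deriv ?_
  ring

lemma integrable_mul_gaussianPDFReal : Integrable fun x : ℝ => x * gaussianPDFReal 0 1 x := by
  have h := (integrable_mul_exp_neg_mul_sq (b := 1 / 2) (by norm_num)).const_mul
    (√(2 * Real.pi * ((1 : ℝ≥0) : ℝ)))⁻¹
  refine h.congr (ae_of_all _ fun x => ?_)
  simp only [gaussianPDFReal, sub_zero, NNReal.coe_one, mul_one]
  have : -(1 / 2) * x ^ 2 = -x ^ 2 / 2 := by ring
  rw [this]
  ring

lemma integral_mul_gaussianReal {g g' : ℝ → ℝ} {b b' : ℝ} (hg : ∀ x, HasDerivAt g (g' x) x)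
    (hb : ∀ x, |g x| ≤ b) (hb' : ∀ x, |g' x| ≤ b') (hg' : Continuous g') :
    ∫ x, x * g x ∂(gaussianReal 0 1) = ∫ x, g' x ∂(gaussianReal 0 1) := by
  have hgc : Continuous g := continuous_iff_continuousAt.2 fun x => (hg x).continuousAt
  have hφ := integrable_gaussianPDFReal 0 1
  have h1 : Integrable (g * gaussianPDFReal 0 1) :=
    hφ.bdd_mul hgc.aestronglyMeasurable (ae_of_all _ hb)
  have h2 : Integrable (g' * gaussianPDFReal 0 1) :=
    hφ.bdd_mul hg'.aestronglyMeasurable (ae_of_all _ hb')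
  have h3 : Integrable (g * fun x => -x * gaussianPDFReal 0 1 x) := by
    refine Integrable.bdd_mul ?_ hgc.aestronglyMeasurable (ae_of_all _ hb)
    simpa [neg_mul] using integrable_mul_gaussianPDFReal.neg
  have h := integral_mul_deriv_eq_deriv_mul_of_integrable (u := g) (v := gaussianPDFReal 0 1)
    (u' := g') (fun x _ => hg x) (fun x _ => hasDerivAt_gaussianPDFReal_zero_one x) h3 h2 h1
  rw [integral_gaussianReal_eq_integral_smul one_ne_zero,
    integral_gaussianReal_eq_integral_smul one_ne_zero]
  simp only [smul_eq_mul]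
  have e1 : ∫ x, gaussianPDFReal 0 1 x * (x * g x) =
      -∫ x, g x * (-x * gaussianPDFReal 0 1 x) := by
    rw [← integral_neg]
    congr with x
    ring
  rw [e1, h, neg_neg]
  congr with x
  ring

variable {d : ℕ}

/-- The standard normal distribution on `Fin d → ℝ`. -/
noncomputable def stdNormal (d : ℕ) : Measure (Fin d → ℝ) :=
  Measure.pi fun _ => gaussianReal 0 1

instance : IsProbabilityMeasure (stdNormal d) := by
  unfold stdNormal
  infer_instance

lemma integrable_norm_stdNormal : Integrable (fun z => ‖z‖) (stdNormal d) := by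
  have h : Integrable (fun z : Fin d → ℝ => ∑ i, ‖z i‖) (stdNormal d) := by
    refine integrable_finsetSum _ fun i _ => Integrable.norm ?_
    unfold stdNormal
    exact integrable_comp_eval (f := id) IsGaussian.integrable_id
  refine h.mono' (by fun_prop) (ae_of_all _ fun z => ?_)
  rw [norm_norm]
  exact (pi_norm_le_iff_of_nonneg (Finset.sum_nonneg fun _ _ => norm_nonneg _)).2 fun i =>
    Finset.single_le_sum (f := fun i => ‖z i‖) (fun _ _ => norm_nonneg _) (Finset.mem_univ i)

lemma integral_mul_stdNormal {p : (Fin d → ℝ) → ℝ} {b b' : ℝ} (hp : Differentiable ℝ p)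
    (hb : ∀ z, |p z| ≤ b) (c : Fin d) (hb' : ∀ z, |partialDeriv p c z| ≤ b')
    (hc : Continuous (partialDeriv p c)) :
    ∫ z, z c * p z ∂(stdNormal d) = ∫ z, partialDeriv p c z ∂(stdNormal d) := by
  obtain _ | n := d
  · exact c.elim0
  have hmp := (measurePreserving_piFinSuccAbove
    (fun _ : Fin (n + 1) => gaussianReal 0 1) c).symm
  have hpc := hp.continuous
  have hint : Integrable (fun z : Fin (n + 1) → ℝ => z c * p z) (stdNormal (n + 1)) := by
    refine (integrable_norm_stdNormal.mul_const b).mono'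
      (by fun_prop) (ae_of_all _ fun z => ?_)
    rw [norm_mul]
    exact mul_le_mul (norm_le_pi_norm z c) (hb z) (abs_nonneg _) (norm_nonneg _)
  have hint' : Integrable (partialDeriv p c) (stdNormal (n + 1)) :=
    (integrable_const b').mono' hc.aestronglyMeasurable (ae_of_all _ hb')
  unfold stdNormal at hint hint' ⊢
  rw [← hmp.integral_comp', ← hmp.integral_comp']
  have hint1 := (hmp.integrable_comp_emb (MeasurableEquiv.measurableEmbedding _)).2 hint
  have hint2 := (hmp.integrable_comp_emb (MeasurableEquiv.measurableEmbedding _)).2 hint'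
  refine (integral_prod_symm _ hint1).trans (Eq.trans ?_ (integral_prod_symm _ hint2).symm)
  refine integral_congr_ae (ae_of_all _ fun y => ?_)
  have hx : ∀ x : ℝ, (MeasurableEquiv.piFinSuccAbove (fun _ => ℝ) c).symm (x, y) =
      Function.update (Fin.insertNth c 0 y : Fin (n + 1) → ℝ) c x := by
    intro x
    rw [Fin.update_insertNth]
    rfl
  simp only [Function.comp_apply, hx, Function.update_self]
  have hu : Continuous fun x : ℝ => Function.update (Fin.insertNth c 0 y : Fin (n + 1) → ℝ) c x :=
    continuous_const.update c continuous_id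
  refine integral_mul_gaussianReal (fun x => ?_) (fun x => hb _) (fun x => hb' _) (hc.comp hu)
  exact (hp _).hasFDerivAt.comp_hasDerivAt x (hasDerivAt_update _ c x)

open scoped MatrixOrder in
lemma gaussianExp_eq {S : Matrix (Fin d) (Fin d) ℝ} {h : (Fin d → ℝ) → ℝ} (hh : Continuous h) :
    gaussianExp S h = ∫ z, h ((CFC.sqrt S).mulVec z) ∂(stdNormal d) := by
  unfold gaussianExp multivariateGaussian
  have hc : Continuous fun z : EuclideanSpace ℝ (Fin d) => h (WithLp.ofLp z) := by fun_prop
  rw [integral_map (by fun_prop) hc.aestronglyMeasurable, ← map_pi_eq_stdGaussian,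
    integral_map (by fun_prop) (Continuous.aestronglyMeasurable (by fun_prop))]
  unfold stdNormal
  congr with z
  simp

open scoped MatrixOrder in
lemma sqrt_mul_sqrt_apply {S : Matrix (Fin d) (Fin d) ℝ} (hS : S.PosSemidef) (a b : Fin d) :
    ∑ c, CFC.sqrt S a c * CFC.sqrt S b c = S a b := by
  have h1 : (CFC.sqrt S).IsHermitian := (CFC.sqrt_nonneg S).isSelfAdjoint
  have h2 : ∀ c, CFC.sqrt S b c = CFC.sqrt S c b := fun c => by simpa using h1.apply c b
  simp only [h2]
  rw [← Matrix.mul_apply, CFC.sqrt_mul_sqrt_self _ hS.nonneg]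

end GaussianIntegrationByParts

section Interpolation

variable {d : ℕ} {M : ℝ} {p h : (Fin d → ℝ) → ℝ}

lemma SmoothBounded.hasFDerivAt_comp_affine (hp : SmoothBounded M p) (s : ℝ) (u w : Fin d → ℝ) :
    HasFDerivAt (fun w => p (s • w + u)) (s • fderiv ℝ p (s • w + u)) w := by
  have h1 := (hp.diff (s • w + u)).hasFDerivAt.comp w
    (((hasFDerivAt_id w).const_smul s).add_const u)
  refine h1.congr_fderiv ?_
  ext z
  simp

lemma SmoothBounded.comp_affine (hp : SmoothBounded M p) {s : ℝ} (hs : |s| ≤ 1)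
    (u : Fin d → ℝ) : SmoothBounded M (fun w => p (s • w + u)) where
  diff w := (hp.hasFDerivAt_comp_affine s u w).differentiableAt
  bound w := hp.bound _
  fderiv_le w := by
    rw [(hp.hasFDerivAt_comp_affine s u w).fderiv, norm_smul, Real.norm_eq_abs]
    exact (mul_le_mul hs (hp.fderiv_le _) (norm_nonneg _) zero_le_one).trans_eq (one_mul _)
  fderiv_lip w w' := by
    rw [(hp.hasFDerivAt_comp_affine s u w).fderiv, (hp.hasFDerivAt_comp_affine s u w').fderiv,
      ← smul_sub, norm_smul, Real.norm_eq_abs]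
    have h1 := hp.fderiv_lip (s • w + u) (s • w' + u)
    rw [add_sub_add_right_eq_sub, ← smul_sub, norm_smul, Real.norm_eq_abs] at h1
    have h2 : |s| * ‖w - w'‖ ≤ ‖w - w'‖ := mul_le_of_le_one_left (norm_nonneg _) hs
    exact (mul_le_of_le_one_left (norm_nonneg _) hs).trans
      (h1.trans (mul_le_mul_of_nonneg_left h2 hp.nonneg))

lemma SmoothBounded.partialDeriv_comp_affine (hp : SmoothBounded M p) (s : ℝ) (u : Fin d → ℝ)
    (b : Fin d) (w : Fin d → ℝ) :
    partialDeriv (fun w => p (s • w + u)) b w = s * partialDeriv p b (s • w + u) := by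
  rw [partialDeriv, (hp.hasFDerivAt_comp_affine s u w).fderiv]
  rfl

variable (R : Matrix (Fin d) (Fin d) ℝ)

lemma continuous_mulVec_const : Continuous fun z : Fin d → ℝ => R.mulVec z :=
  continuous_const.matrix_mulVec continuous_id

lemma SmoothBounded.hasFDerivAt_comp_mulVec (hp : SmoothBounded M p) (k : ℝ) (u z : Fin d → ℝ) :
    HasFDerivAt (fun z => p (u + k • R.mulVec z))
      ((fderiv ℝ p (u + k • R.mulVec z)).comp (k • R.mulVecLin.toContinuousLinearMap)) z := by
  have h1 : HasFDerivAt (fun z => u + k • R.mulVec z)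
      (k • R.mulVecLin.toContinuousLinearMap) z :=
    ((R.mulVecLin.toContinuousLinearMap.hasFDerivAt (x := z)).const_smul k).const_add u
  exact (hp.diff (u + k • R.mulVec z)).hasFDerivAt.comp z h1

lemma SmoothBounded.partialDeriv_comp_mulVec (hp : SmoothBounded M p) (k : ℝ) (u z : Fin d → ℝ)
    (c : Fin d) : partialDeriv (fun z => p (u + k • R.mulVec z)) c z =
      k * ∑ b, R b c * partialDeriv p b (u + k • R.mulVec z) := by
  rw [partialDeriv, (hp.hasFDerivAt_comp_mulVec R k u z).fderiv]
  simp only [ContinuousLinearMap.comp_apply, smul_apply, map_smul,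
    LinearMap.coe_toContinuousLinearMap', Matrix.mulVecLin_apply, Matrix.mulVec_single_one,
    smul_eq_mul]
  rw [fderiv_eq_sum_partialDeriv]
  rfl

lemma integrable_stdNormal_of_bounded {F : (Fin d → ℝ) → ℝ} (hF : Continuous F) {b : ℝ}
    (hb : ∀ z, |F z| ≤ b) : Integrable F (stdNormal d) :=
  (integrable_const b).mono' hF.aestronglyMeasurable (ae_of_all _ hb)

lemma SmoothBounded.integral_mulVec_mul (hp : SmoothBounded M p) (k : ℝ) (u : Fin d → ℝ)
    (a : Fin d) :
    ∫ z, R.mulVec z a * p (u + k • R.mulVec z) ∂(stdNormal d) =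
      k * ∑ b, (∑ c, R a c * R b c) *
        ∫ z, partialDeriv p b (u + k • R.mulVec z) ∂(stdNormal d) := by
  have hRc := continuous_mulVec_const R
  have hpc : Continuous p := hp.diff.continuous
  have hPc : ∀ b, Continuous (partialDeriv p b) := hp.continuous_partialDeriv
  have hint : ∀ b, Integrable (fun z => partialDeriv p b (u + k • R.mulVec z)) (stdNormal d) :=
    fun b => integrable_stdNormal_of_bounded (by fun_prop) fun z => hp.abs_partialDeriv_le b _
  have h1 : ∀ c, ∫ z, z c * p (u + k • R.mulVec z) ∂(stdNormal d) =
      k * ∑ b, R b c * ∫ z, partialDeriv p b (u + k • R.mulVec z) ∂(stdNormal d) := by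
    intro c
    rw [integral_mul_stdNormal (p := fun z => p (u + k • R.mulVec z))
      (b' := |k| * ∑ b, |R b c| * M)
      (fun z => (hp.hasFDerivAt_comp_mulVec R k u z).differentiableAt) (fun z => hp.bound _)]
    · simp only [hp.partialDeriv_comp_mulVec R k u]
      rw [integral_const_mul, integral_finsetSum _ fun b _ => (hint b).const_mul _]
      simp only [integral_const_mul]
    · intro z
      rw [hp.partialDeriv_comp_mulVec R k u, abs_mul]
      refine mul_le_mul_of_nonneg_left ?_ (abs_nonneg _)
      refine (Finset.abs_sum_le_sum_abs _ _).trans (Finset.sum_le_sum fun b _ => ?_)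
      rw [abs_mul]
      exact mul_le_mul_of_nonneg_left (hp.abs_partialDeriv_le b _) (abs_nonneg _)
    · have : partialDeriv (fun z => p (u + k • R.mulVec z)) c = fun z =>
          k * ∑ b, R b c * partialDeriv p b (u + k • R.mulVec z) :=
        funext fun z => hp.partialDeriv_comp_mulVec R k u z c
      rw [this]
      fun_prop
  have h2 : ∀ z : Fin d → ℝ, R.mulVec z a * p (u + k • R.mulVec z) =
      ∑ c, R a c * (z c * p (u + k • R.mulVec z)) := by
    intro z
    simp only [← mul_assoc, ← Finset.sum_mul]
    rfl
  simp only [h2]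
  rw [integral_finsetSum]
  · simp only [integral_const_mul, h1, Finset.mul_sum, Finset.sum_mul]
    rw [Finset.sum_comm]
    refine Finset.sum_congr rfl fun b _ => Finset.sum_congr rfl fun c _ => ?_
    ring
  · intro c _
    refine Integrable.const_mul ?_ _
    refine (integrable_norm_stdNormal.mul_const M).mono'
      (Continuous.aestronglyMeasurable (by fun_prop)) (ae_of_all _ fun z => ?_)
    rw [norm_mul]
    exact mul_le_mul (norm_le_pi_norm z c) (hp.bound _) (abs_nonneg _) (norm_nonneg _)

/-- Test functions with bounded derivatives of orders one to three. -/
structure SmoothTest (M : ℝ) (h : (Fin d → ℝ) → ℝ) : Prop where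
  diff : Differentiable ℝ h
  fderiv_le : ∀ w, ‖fderiv ℝ h w‖ ≤ M
  partial_smooth : ∀ a, SmoothBounded M (partialDeriv h a)

lemma SmoothTest.abs_le (hh : SmoothTest M h) (w : Fin d → ℝ) : |h w| ≤ |h 0| + M * ‖w‖ := by
  have h1 := (convex_univ (𝕜 := ℝ) (E := Fin d → ℝ)).norm_image_sub_le_of_norm_fderiv_le
    (f := h) (𝕜 := ℝ) (C := M) (x := 0) (y := w) (fun z _ => hh.diff z)
    (fun z _ => hh.fderiv_le z) (Set.mem_univ _) (Set.mem_univ _)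
  rw [sub_zero, Real.norm_eq_abs] at h1
  have h2 := abs_sub_abs_le_abs_sub (h w) (h 0)
  linarith

variable {ν : Measure (ℕ → I)} [IsProbabilityMeasure ν] {W : (ℕ → I) → Fin d → ℝ}

lemma integrable_prod_of_linear_growth {F : (ℕ → I) × (Fin d → ℝ) → ℝ} (hF : Continuous F)
    {b k : ℝ} (hb : ∀ x, |F x| ≤ b + k * ‖x.2‖) : Integrable F (ν.prod (stdNormal d)) := by
  have h1 : Integrable (fun x : (ℕ → I) × (Fin d → ℝ) => ‖x.2‖) (ν.prod (stdNormal d)) :=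
    integrable_norm_stdNormal.comp_snd ν
  exact ((integrable_const b).add (h1.const_mul k)).mono' hF.aestronglyMeasurable
    (ae_of_all _ hb)

/-- The path from a Gaussian vector to `W`. -/
noncomputable def gaussPath (R : Matrix (Fin d) (Fin d) ℝ) (W : (ℕ → I) → Fin d → ℝ) (θ : ℝ)
    (x : (ℕ → I) × (Fin d → ℝ)) : Fin d → ℝ :=
  Real.sin θ • W x.1 + Real.cos θ • R.mulVec x.2

lemma hasDerivAt_gaussPath (θ : ℝ) (x : (ℕ → I) × (Fin d → ℝ)) :
    HasDerivAt (fun θ => gaussPath R W θ x)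
      (Real.cos θ • W x.1 - Real.sin θ • R.mulVec x.2) θ := by
  have h1 := ((Real.hasDerivAt_sin θ).smul_const (W x.1)).add
    ((Real.hasDerivAt_cos θ).smul_const (R.mulVec x.2))
  rwa [neg_smul, ← sub_eq_add_neg] at h1

lemma continuous_gaussPath (hW : Continuous W) (θ : ℝ) : Continuous (gaussPath R W θ) := by
  have hRc := continuous_mulVec_const R
  unfold gaussPath
  fun_prop

lemma exists_mulVec_le : ∃ k, 0 ≤ k ∧ ∀ z : Fin d → ℝ, ‖R.mulVec z‖ ≤ k * ‖z‖ :=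
  ⟨‖R.mulVecLin.toContinuousLinearMap‖, norm_nonneg _, fun z =>
    R.mulVecLin.toContinuousLinearMap.le_opNorm z⟩

lemma exists_norm_le (hW : Continuous W) : ∃ B, 0 ≤ B ∧ ∀ ω, ‖W ω‖ ≤ B := by
  obtain ⟨B, hB⟩ := (isCompact_range hW).isBounded.exists_norm_le
  exact ⟨B, (norm_nonneg _).trans (hB _ ⟨fun _ => 0, rfl⟩), fun ω => hB _ ⟨ω, rfl⟩⟩

lemma norm_smul_add_smul_le {s c : ℝ} (hs : |s| ≤ 1) (hc : |c| ≤ 1) {u v : Fin d → ℝ} {B k : ℝ}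
    (hu : ‖u‖ ≤ B) (hv : ‖v‖ ≤ k) : ‖s • u + c • v‖ ≤ B + k := by
  refine (norm_add_le _ _).trans (add_le_add ?_ ?_) <;> rw [norm_smul, Real.norm_eq_abs]
  · exact (mul_le_of_le_one_left (norm_nonneg _) hs).trans hu
  · exact (mul_le_of_le_one_left (norm_nonneg _) hc).trans hv

lemma SmoothTest.nonneg (hh : SmoothTest M h) : 0 ≤ M := (norm_nonneg _).trans (hh.fderiv_le 0)

lemma SmoothTest.hasDerivAt_interpolation (hh : SmoothTest M h) (hW : Continuous W) (θ : ℝ) :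
    HasDerivAt (fun θ => ∫ x, h (gaussPath R W θ x) ∂(ν.prod (stdNormal d)))
      (∫ x, fderiv ℝ h (gaussPath R W θ x) (Real.cos θ • W x.1 - Real.sin θ • R.mulVec x.2)
        ∂(ν.prod (stdNormal d))) θ := by
  obtain ⟨k, hk0, hk⟩ := exists_mulVec_le R
  obtain ⟨B, hB0, hB⟩ := exists_norm_le hW
  have hM := hh.nonneg
  have hhc : Continuous h := hh.diff.continuous
  have hPc : ∀ b, Continuous (partialDeriv h b) := fun b => (hh.partial_smooth b).diff.continuous
  have hRc := continuous_mulVec_const R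
  have hXc : ∀ θ, Continuous (gaussPath R W θ) := continuous_gaussPath R hW
  have hbd : ∀ θ (x : (ℕ → I) × (Fin d → ℝ)), ‖gaussPath R W θ x‖ ≤ B + k * ‖x.2‖ := fun θ x =>
    norm_smul_add_smul_le (Real.abs_sin_le_one θ) (Real.abs_cos_le_one θ) (hB _) (hk _)
  have hint : Integrable (fun x : (ℕ → I) × (Fin d → ℝ) => M * (B + k * ‖x.2‖))
      (ν.prod (stdNormal d)) := by
    refine integrable_prod_of_linear_growth (b := M * B) (k := M * k) (by fun_prop) fun x => ?_
    rw [abs_of_nonneg (by positivity)]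
    exact le_of_eq (by ring)
  refine (hasDerivAt_integral_of_dominated_loc_of_deriv_le (s := Set.univ)
    (F := fun θ x => h (gaussPath R W θ x))
    (F' := fun θ x => fderiv ℝ h (gaussPath R W θ x)
      (Real.cos θ • W x.1 - Real.sin θ • R.mulVec x.2)) (bound := fun x => M * (B + k * ‖x.2‖)) Filter.univ_mem
    (Filter.Eventually.of_forall fun θ => (hhc.comp (hXc θ)).aestronglyMeasurable)
    ?_ ?_ (ae_of_all _ fun x θ _ => ?_) hint (ae_of_all _ fun x θ _ => ?_)).2
  · refine integrable_prod_of_linear_growth (b := |h 0| + M * B) (k := M * k)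
      (hhc.comp (hXc θ)) fun x => (hh.abs_le _).trans ?_
    have := mul_le_mul_of_nonneg_left (hbd θ x) hM
    linarith
  · simp only [fderiv_eq_sum_partialDeriv]
    exact Continuous.aestronglyMeasurable (by fun_prop)
  · refine (ContinuousLinearMap.le_opNorm _ _).trans ?_
    refine mul_le_mul (hh.fderiv_le _) ?_ (norm_nonneg _) hM
    rw [sub_eq_add_neg, ← neg_smul]
    exact norm_smul_add_smul_le (Real.abs_cos_le_one θ)
      (by rw [abs_neg]; exact Real.abs_sin_le_one θ) (hB _) (hk _)
  · exact (hh.diff _).hasFDerivAt.comp_hasDerivAt θ (hasDerivAt_gaussPath R θ x)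

lemma SmoothTest.abs_deriv_interpolation_le (hh : SmoothTest M h) (hW : Continuous W) {K : ℝ}
    (hK : ∀ (p : (Fin d → ℝ) → ℝ) a, SmoothBounded M p →
      |∫ ω, W ω a * p (W ω) ∂ν - ∑ b, (∑ c, R a c * R b c) * ∫ ω, partialDeriv p b (W ω) ∂ν| ≤ K)
    (θ : ℝ) :
    |∫ x, fderiv ℝ h (gaussPath R W θ x) (Real.cos θ • W x.1 - Real.sin θ • R.mulVec x.2)
        ∂(ν.prod (stdNormal d))| ≤ d * K := by
  obtain ⟨k, hk0, hk⟩ := exists_mulVec_le R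
  obtain ⟨B, hB0, hB⟩ := exists_norm_le hW
  have hM := hh.nonneg
  have hPc : ∀ b, Continuous (partialDeriv h b) := fun b => (hh.partial_smooth b).diff.continuous
  have hQc : ∀ a b, Continuous (partialDeriv (partialDeriv h a) b) := fun a b =>
    (hh.partial_smooth a).continuous_partialDeriv b
  have hRc := continuous_mulVec_const R
  have hXc : Continuous (gaussPath R W θ) := continuous_gaussPath R hW θ
  have hi1 : ∀ a, Integrable (fun x : (ℕ → I) × (Fin d → ℝ) =>
      W x.1 a * partialDeriv h a (gaussPath R W θ x)) (ν.prod (stdNormal d)) := fun a =>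
    integrable_prod_of_linear_growth (b := B * M) (k := 0) (by fun_prop) fun x => by
      rw [abs_mul, zero_mul, add_zero]
      exact mul_le_mul ((norm_le_pi_norm _ a).trans (hB _)) ((hh.partial_smooth a).bound _)
        (abs_nonneg _) hB0
  have hi2 : ∀ a, Integrable (fun x : (ℕ → I) × (Fin d → ℝ) =>
      R.mulVec x.2 a * partialDeriv h a (gaussPath R W θ x)) (ν.prod (stdNormal d)) := fun a =>
    integrable_prod_of_linear_growth (b := 0) (k := k * M) (by fun_prop) fun x => by
      rw [abs_mul, zero_add, mul_right_comm]
      exact mul_le_mul ((norm_le_pi_norm _ a).trans (hk _)) ((hh.partial_smooth a).bound _)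
        (abs_nonneg _) (by positivity)
  have hi3 : ∀ a b, Integrable (fun x : (ℕ → I) × (Fin d → ℝ) =>
      partialDeriv (partialDeriv h a) b (gaussPath R W θ x)) (ν.prod (stdNormal d)) := fun a b =>
    integrable_prod_of_linear_growth (b := M) (k := 0) (by fun_prop) fun x => by
      rw [zero_mul, add_zero]
      exact (hh.partial_smooth a).abs_partialDeriv_le b _
  have h1 : ∀ a, ∫ x, R.mulVec x.2 a * partialDeriv h a (gaussPath R W θ x)
      ∂(ν.prod (stdNormal d)) = Real.cos θ * ∑ b, (∑ c, R a c * R b c) *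
        ∫ x, partialDeriv (partialDeriv h a) b (gaussPath R W θ x) ∂(ν.prod (stdNormal d)) := by
    intro a
    have e : ∀ ω, ∫ z, R.mulVec z a * partialDeriv h a (gaussPath R W θ (ω, z)) ∂(stdNormal d) =
        Real.cos θ * ∑ b, (∑ c, R a c * R b c) *
          ∫ z, partialDeriv (partialDeriv h a) b (gaussPath R W θ (ω, z)) ∂(stdNormal d) :=
      fun ω => (hh.partial_smooth a).integral_mulVec_mul R (Real.cos θ) (Real.sin θ • W ω) a
    rw [integral_prod _ (hi2 a)]
    simp only [e]
    rw [integral_const_mul, integral_finsetSum _ fun b _ => (hi3 a b).integral_prod_left.const_mul _]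
    congr 1
    refine Finset.sum_congr rfl fun b _ => ?_
    rw [integral_const_mul, integral_prod _ (hi3 a b)]
  have h2 : ∀ a, |∫ x, W x.1 a * partialDeriv h a (gaussPath R W θ x) ∂(ν.prod (stdNormal d)) -
      Real.sin θ * ∑ b, (∑ c, R a c * R b c) *
        ∫ x, partialDeriv (partialDeriv h a) b (gaussPath R W θ x) ∂(ν.prod (stdNormal d))| ≤ K := by
    intro a
    have e : ∫ x, W x.1 a * partialDeriv h a (gaussPath R W θ x) ∂(ν.prod (stdNormal d)) -
      Real.sin θ * ∑ b, (∑ c, R a c * R b c) *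
        ∫ x, partialDeriv (partialDeriv h a) b (gaussPath R W θ x) ∂(ν.prod (stdNormal d)) =
        ∫ z, (∫ ω, W ω a * partialDeriv h a (gaussPath R W θ (ω, z)) ∂ν -
          ∑ b, (∑ c, R a c * R b c) *
            ∫ ω, Real.sin θ * partialDeriv (partialDeriv h a) b (gaussPath R W θ (ω, z)) ∂ν)
          ∂(stdNormal d) := by
      rw [integral_sub (hi1 a).integral_prod_right
        (integrable_finsetSum _ fun b _ =>
          ((hi3 a b).const_mul (Real.sin θ)).integral_prod_right.const_mul _),
        integral_finsetSum _ fun b _ =>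
          ((hi3 a b).const_mul (Real.sin θ)).integral_prod_right.const_mul _,
        integral_prod_symm _ (hi1 a), Finset.mul_sum]
      congr 1
      refine Finset.sum_congr rfl fun b _ => ?_
      simp only [integral_const_mul]
      rw [integral_prod_symm _ (hi3 a b)]
      ring
    rw [e]
    refine abs_integral_le_of_forall fun z => ?_
    have h3 := hK _ a ((hh.partial_smooth a).comp_affine (Real.abs_sin_le_one θ)
      (Real.cos θ • R.mulVec z))
    simp only [(hh.partial_smooth a).partialDeriv_comp_affine] at h3
    exact h3
  have h3 : ∀ x : (ℕ → I) × (Fin d → ℝ),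
      fderiv ℝ h (gaussPath R W θ x) (Real.cos θ • W x.1 - Real.sin θ • R.mulVec x.2) =
      ∑ a, (Real.cos θ * (W x.1 a * partialDeriv h a (gaussPath R W θ x)) -
        Real.sin θ * (R.mulVec x.2 a * partialDeriv h a (gaussPath R W θ x))) := by
    intro x
    rw [fderiv_eq_sum_partialDeriv]
    refine Finset.sum_congr rfl fun a _ => ?_
    simp only [Pi.sub_apply, Pi.smul_apply, smul_eq_mul]
    ring
  simp only [h3]
  rw [integral_finsetSum (f := fun a (x : (ℕ → I) × (Fin d → ℝ)) =>
      Real.cos θ * (W x.1 a * partialDeriv h a (gaussPath R W θ x)) -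
        Real.sin θ * (R.mulVec x.2 a * partialDeriv h a (gaussPath R W θ x))) _
    fun a _ => ((hi1 a).const_mul _).sub ((hi2 a).const_mul _)]
  refine (Finset.abs_sum_le_sum_abs _ _).trans ?_
  refine (Finset.sum_le_card_nsmul _ _ K fun a _ => ?_).trans_eq (by simp)
  rw [integral_sub ((hi1 a).const_mul _) ((hi2 a).const_mul _), integral_const_mul,
    integral_const_mul, h1, mul_left_comm, ← mul_sub, abs_mul]
  exact (mul_le_of_le_one_left (abs_nonneg _) (Real.abs_cos_le_one θ)).trans (h2 a)

/-- Comparison of `W` with a Gaussian vector by means of its Stein functional. -/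
theorem SmoothTest.abs_sub_gaussian_le (hh : SmoothTest M h) (hW : Continuous W) {K : ℝ}
    (hK : ∀ (p : (Fin d → ℝ) → ℝ) a, SmoothBounded M p →
      |∫ ω, W ω a * p (W ω) ∂ν - ∑ b, (∑ c, R a c * R b c) * ∫ ω, partialDeriv p b (W ω) ∂ν| ≤ K) :
    |∫ ω, h (W ω) ∂ν - ∫ z, h (R.mulVec z) ∂(stdNormal d)| ≤ d * K * (Real.pi / 2) := by
  have h1 := (convex_univ (𝕜 := ℝ) (E := ℝ)).norm_image_sub_le_of_norm_hasDerivWithin_le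
    (f := fun θ => ∫ x, h (gaussPath R W θ x) ∂(ν.prod (stdNormal d))) (C := d * K)
    (x := 0) (y := Real.pi / 2)
    (fun θ _ => (hh.hasDerivAt_interpolation R hW θ).hasDerivWithinAt)
    (fun θ _ => hh.abs_deriv_interpolation_le R hW hK θ) (Set.mem_univ _) (Set.mem_univ _)
  have e1 := integral_fun_fst (μ := ν) (ν := stdNormal d) (fun ω => h (W ω))
  have e2 := integral_fun_snd (μ := ν) (ν := stdNormal d) (fun z => h (R.mulVec z))
  simp only [gaussPath, Real.sin_pi_div_two, Real.cos_pi_div_two, Real.sin_zero, Real.cos_zero,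
    one_smul, zero_smul, add_zero, zero_add, e1, e2, probReal_univ, sub_zero,
    Real.norm_eq_abs] at h1
  rwa [abs_of_pos (by positivity : 0 < Real.pi / 2)] at h1

end Interpolation

section Conversion

variable {d : ℕ}

lemma enorm_le_coe_iff {x : ℝ} {L : ℝ≥0} : ‖x‖ₑ ≤ (L : ℝ≥0∞) ↔ |x| ≤ L := by
  rw [enorm_le_coe, ← NNReal.coe_le_coe, coe_nnnorm, Real.norm_eq_abs]

/-- The partial derivative of `h` in the coordinate directions listed by `i`. -/
noncomputable def iterPartial (h : (Fin d → ℝ) → ℝ) {k : ℕ} (i : Fin k → Fin d)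
    (x : Fin d → ℝ) : ℝ :=
  iteratedFDeriv ℝ k h x fun j => Pi.single (i j) 1

variable {h : (Fin d → ℝ) → ℝ}

lemma abs_iterPartial_le {M : ℝ≥0} {k : ℕ} (hM : derivNorm k h ≤ M) (i : Fin k → Fin d)
    (x : Fin d → ℝ) : |iterPartial h i x| ≤ M :=
  enorm_le_coe_iff.1 ((le_iSup₂ (f := fun (i : Fin k → Fin d) (x : Fin d → ℝ) =>
    ‖iteratedFDeriv ℝ k h x (fun j => Pi.single (i j) 1)‖ₑ) i x).trans hM)

lemma ThriceDifferentiable.hasFDerivAt_iterPartial (hh : ThriceDifferentiable h) {k : ℕ}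
    (hk : k < 3) (i : Fin k → Fin d) (x : Fin d → ℝ) :
    HasFDerivAt (iterPartial h i)
      ((ContinuousMultilinearMap.apply ℝ (fun _ : Fin k => Fin d → ℝ) ℝ
        (fun j => Pi.single (i j) 1)).comp (fderiv ℝ (iteratedFDeriv ℝ k h) x)) x :=
  (ContinuousMultilinearMap.apply ℝ (fun _ : Fin k => Fin d → ℝ) ℝ
    (fun j => Pi.single (i j) 1)).hasFDerivAt.comp x (hh k hk x).hasFDerivAt

lemma ThriceDifferentiable.partialDeriv_iterPartial (hh : ThriceDifferentiable h) {k : ℕ}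
    (hk : k < 3) (i : Fin k → Fin d) (b : Fin d) :
    partialDeriv (iterPartial h i) b = iterPartial h (Fin.cons b i : Fin (k + 1) → Fin d) := by
  ext x
  rw [partialDeriv, (hh.hasFDerivAt_iterPartial hk i x).fderiv, iterPartial,
    iteratedFDeriv_succ_apply_left]
  rfl

lemma iterPartial_zero (i : Fin 0 → Fin d) : iterPartial h i = h := by
  ext x
  exact iteratedFDeriv_zero_apply _

lemma norm_le_of_apply_single_le {f : (Fin d → ℝ) →L[ℝ] ℝ} {c : ℝ} (hc : 0 ≤ c)
    (hf : ∀ b, |f (Pi.single b 1)| ≤ c) : ‖f‖ ≤ d * c := by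
  refine f.opNorm_le_bound (by positivity) fun x => ?_
  conv_lhs => rw [← Finset.univ_sum_single x, map_sum]
  refine (norm_sum_le _ _).trans ?_
  have : ∀ b ∈ Finset.univ, ‖f (Pi.single b (x b))‖ ≤ c * ‖x‖ := fun b _ => by
    have e : Pi.single b (x b) = x b • (Pi.single b 1 : Fin d → ℝ) := by
      rw [← Pi.single_smul, smul_eq_mul, mul_one]
    rw [e, map_smul, norm_smul, mul_comm]
    exact mul_le_mul (hf b) (norm_le_pi_norm x b) (norm_nonneg _) hc
  refine (Finset.sum_le_card_nsmul _ _ _ this).trans_eq ?_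
  simp [mul_assoc]

lemma ThriceDifferentiable.smoothTest (hh : ThriceDifferentiable h) (hd : 1 ≤ d) {M : ℝ≥0}
    (hM : ∀ k ∈ Finset.Icc 1 3, derivNorm k h ≤ M) : SmoothTest ((d : ℝ) ^ 2 * M) h := by
  have hd' : (1 : ℝ) ≤ d := by exact_mod_cast hd
  have hM0 : (0 : ℝ) ≤ M := M.2
  have e1 : (M : ℝ) ≤ (d : ℝ) ^ 2 * M := le_mul_of_one_le_left hM0 (one_le_pow₀ hd')
  have e2 : (d : ℝ) * M ≤ (d : ℝ) ^ 2 * M :=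
    mul_le_mul_of_nonneg_right (le_self_pow₀ hd' two_ne_zero) hM0
  have hdiff : ∀ {k : ℕ} (_ : k < 3) (i : Fin k → Fin d), Differentiable ℝ (iterPartial h i) :=
    fun hk i x => (hh.hasFDerivAt_iterPartial hk i x).differentiableAt
  have hbd : ∀ {k : ℕ} (_ : k < 3) (i : Fin k → Fin d) x,
      ‖fderiv ℝ (iterPartial h i) x‖ ≤ d * M := by
    intro k hk i x
    refine norm_le_of_apply_single_le hM0 fun b => ?_
    have := congrFun (hh.partialDeriv_iterPartial hk i b) x
    rw [partialDeriv] at this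
    rw [this]
    exact abs_iterPartial_le (hM _ (Finset.mem_Icc.2 ⟨by omega, by omega⟩)) _ _
  have hlip : ∀ {k : ℕ} (_ : k < 3) (i : Fin k → Fin d) x y,
      |iterPartial h i x - iterPartial h i y| ≤ d * M * ‖x - y‖ := fun hk i x y =>
    (convex_univ (𝕜 := ℝ)).norm_image_sub_le_of_norm_fderiv_le (𝕜 := ℝ)
      (fun z _ => hdiff hk i z) (fun z _ => hbd hk i z) (Set.mem_univ y) (Set.mem_univ x)
  have h0 : iterPartial h (Fin.elim0 : Fin 0 → Fin d) = h := iterPartial_zero _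
  refine ⟨h0 ▸ hdiff (by norm_num) _, fun w => ?_, fun a => ?_⟩
  · have := hbd (by norm_num) (Fin.elim0 : Fin 0 → Fin d) w
    rw [h0] at this
    exact this.trans e2
  · have ha := hh.partialDeriv_iterPartial (by norm_num) (Fin.elim0 : Fin 0 → Fin d) a
    rw [h0] at ha
    rw [ha]
    refine ⟨hdiff (by norm_num) _, fun w => (abs_iterPartial_le (hM 1 (by simp)) _ w).trans e1,
      fun w => (hbd (by norm_num) _ w).trans e2, fun w w' => ?_⟩
    refine (norm_le_of_apply_single_le (c := d * M * ‖w - w'‖) (by positivity)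
      fun b => ?_).trans_eq (by ring)
    have hb := hh.partialDeriv_iterPartial (by norm_num)
      (Fin.cons a Fin.elim0 : Fin 1 → Fin d) b
    have := hlip (by norm_num) (Fin.cons b (Fin.cons a Fin.elim0 : Fin 1 → Fin d)) w w'
    rw [← hb] at this
    exact this

variable {f : I → Fin d → ℝ} {L : ℝ≥0}

lemma abs_le_of_lipNorm_le (hf : lipNorm f ≤ L) (x : I) (a : Fin d) : |f x a| ≤ L :=
  enorm_le_coe_iff.1 ((le_iSup₂ (f := fun (a : Fin d) (x : I) => ‖f x a‖ₑ) a x).trans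
    (le_self_add.trans hf))

lemma abs_sub_le_of_lipNorm_le (hf : lipNorm f ≤ L) (x y : I) (a : Fin d) :
    |f x a - f y a| ≤ L * dist x y := by
  by_cases hxy : x = y
  · simp [hxy]
  have h1 : ‖f x a - f y a‖ₑ / edist x y ≤ L := by
    refine le_trans ?_ (le_add_self.trans hf)
    refine le_trans ?_ (le_iSup₂ (f := fun (a : Fin d) (x : I) =>
      ⨆ (y : I) (_ : x ≠ y), ‖f x a - f y a‖ₑ / edist x y) a x)
    exact le_iSup₂ (f := fun (y : I) (_ : x ≠ y) => ‖f x a - f y a‖ₑ / edist x y) y hxy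
  rw [ENNReal.div_le_iff (edist_pos.2 hxy).ne' (edist_ne_top x y), edist_nndist,
    ← ENNReal.coe_mul] at h1
  simpa using enorm_le_coe_iff.1 h1

/-- The centred observables along the composition. -/
noncomputable def centered (α : ℕ → ℝ≥0) (μ : Measure I) (f : I → Fin d → ℝ) (i : ℕ) (y : I) :
    Fin d → ℝ :=
  f y - ∫ x, f (comp α i x) ∂μ

lemma norm_le_of_lipNorm_le (hf : lipNorm f ≤ L) (x : I) : ‖f x‖ ≤ L :=
  (pi_norm_le_iff_of_nonneg L.2).2 fun a => abs_le_of_lipNorm_le hf x a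

lemma norm_sub_le_of_lipNorm_le (hf : lipNorm f ≤ L) (x y : I) : ‖f x - f y‖ ≤ L * dist x y :=
  (pi_norm_le_iff_of_nonneg (by positivity)).2 fun a => abs_sub_le_of_lipNorm_le hf x y a

lemma continuous_of_lipNorm_le (hf : lipNorm f ≤ L) : Continuous f :=
  (LipschitzWith.of_dist_le_mul fun x y => by
    rw [dist_eq_norm]
    exact norm_sub_le_of_lipNorm_le hf x y : LipschitzWith L f).continuous

variable {α : ℕ → ℝ≥0} {μ : Measure I} [IsProbabilityMeasure μ]

lemma uniformLip_centered (hf : lipNorm f ≤ L) : UniformLip (2 * (L : ℝ)) (centered α μ f) where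
  bound i y := by
    have h1 : ‖∫ x, f (comp α i x) ∂μ‖ ≤ L := by
      simpa using norm_integral_le_of_norm_le_const (μ := μ)
        (ae_of_all _ fun x => norm_le_of_lipNorm_le hf (comp α i x))
    refine (norm_sub_le _ _).trans ?_
    have := norm_le_of_lipNorm_le hf y
    linarith
  lip i y y' := by
    rw [centered, centered, sub_sub_sub_cancel_right]
    refine (norm_sub_le_of_lipNorm_le hf y y').trans ?_
    have : 0 ≤ (L : ℝ) * dist y y' := by positivity
    linarith

lemma integrable_comp_orbit (hf : lipNorm f ≤ L) (i : ℕ) :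
    Integrable (fun x => f (comp α i x)) μ :=
  (integrable_const (L : ℝ)).mono'
    ((continuous_of_lipNorm_le hf).measurable.comp (measurable_comp α i)).aestronglyMeasurable
    (ae_of_all _ fun _ => norm_le_of_lipNorm_le hf _)

lemma integral_centered (hf : lipNorm f ≤ L) (i : ℕ) (a : Fin d) :
    ∫ ω, centered α μ f i (ω i) a ∂(μ.map (orbit α)) = 0 := by
  have hc : Continuous fun ω : ℕ → I => centered α μ f i (ω i) a :=
    ((uniformLip_centered hf).boundedLip_coord i a).continuous
  rw [integral_map (measurable_orbit α).aemeasurable hc.aestronglyMeasurable]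
  have h1 := integrable_comp_orbit (α := α) (μ := μ) hf i
  have h2 : Integrable (fun x => f (comp α i x) a) μ := h1.eval a
  have h3 : (∫ x, f (comp α i x) ∂μ) a = ∫ x, f (comp α i x) a ∂μ :=
    eval_integral (fun b => h1.eval b) a
  change ∫ x, (f (comp α i x) a - (∫ x, f (comp α i x) ∂μ) a) ∂μ = 0
  rw [integral_sub h2 (integrable_const _), h3]
  simp

lemma integral_comp_W (hf : lipNorm f ≤ L) (N : ℕ) {F : (Fin d → ℝ) → ℝ} (hF : Continuous F) :
    ∫ x, F (W α μ f N x) ∂μ = ∫ ω, F (normSum (1 / √(N : ℝ)) (centered α μ f)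
      (Finset.range N) ω) ∂(μ.map (orbit α)) := by
  have hc : Continuous fun ω => F (normSum (1 / √(N : ℝ)) (centered α μ f) (Finset.range N) ω) :=
    hF.comp ((uniformLip_centered hf).continuous_normSum _)
  rw [integral_map (measurable_orbit α).aemeasurable hc.aestronglyMeasurable]
  rfl

/-- Normal approximation with the rate `N ^ (-1 / 2)`. -/
theorem exists_normal_approximation {β : ℝ} (hβ0 : 0 < β) (hβ : β < 1 / 3) (hd : 1 ≤ d)
    (L M : ℝ≥0) :
    ∃ K : ℝ, 0 ≤ K ∧ ∀ (α : ℕ → ℝ≥0), (∀ n, 1 ≤ n → (α n : ℝ) ≤ β) →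
      ∀ (μ : Measure I), IsProbabilityMeasure μ → HasConeDensity β μ →
      ∀ (N : ℕ), 2 ≤ N → ∀ (f : I → Fin d → ℝ), lipNorm f ≤ L → (covMat α μ f N).PosDef →
      ∀ (h : (Fin d → ℝ) → ℝ), ThriceDifferentiable h →
        (∀ k ∈ Finset.Icc 1 3, derivNorm k h ≤ M) →
        |(∫ x, h (W α μ f N x) ∂μ) - gaussianExp (covMat α μ f N) h| ≤ K * (1 / √(N : ℝ)) := by
  set γ : ℝ := (1 / β + 1) / 2 with hγdef
  have hβγ : β * (γ + 1) < 1 := by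
    have : β * (γ + 1) = 1 / 2 + 3 / 2 * β := by
      rw [hγdef]
      field_simp
      ring
    linarith
  have hγ : 2 < γ := by
    have : 3 < 1 / β := by rw [lt_div_iff₀ hβ0]; linarith
    linarith
  obtain ⟨C, hC, hmix⟩ := exists_mixing hβ0 (by linarith) (by linarith : 0 < γ) hβγ
  have hZ : 0 ≤ decaySum γ := tsum_nonneg fun _ => by positivity
  refine ⟨d * (C * ((d : ℝ) ^ 2 * M) * (2 * (L : ℝ)) ^ 3 * (4 + d * (16 + 16 * decaySum γ)) *
    decaySum γ) * (Real.pi / 2), by positivity, ?_⟩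
  intro α hα μ hμ hdens N hN f hf hS h hh hM
  have hν : IsProbabilityMeasure (μ.map (orbit α)) :=
    Measure.isProbabilityMeasure_map (measurable_orbit α).aemeasurable
  have hv : UniformLip (2 * (L : ℝ)) (centered α μ f) := uniformLip_centered hf
  have htest := hh.smoothTest hd hM
  have hN0 : (0 : ℝ) < N := by exact_mod_cast (by omega : 0 < N)
  have hεN : (N : ℝ) * (1 / √(N : ℝ)) ^ 2 = 1 := by
    rw [div_pow, Real.sq_sqrt hN0.le, one_pow, mul_one_div_cancel hN0.ne']
  rw [integral_comp_W hf N htest.diff.continuous, gaussianExp_eq htest.diff.continuous]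
  refine (htest.abs_sub_gaussian_le _ (hv.continuous_normSum _)
    (K := C * ((d : ℝ) ^ 2 * M) * (2 * (L : ℝ)) ^ 3 * (4 + d * (16 + 16 * decaySum γ)) *
      decaySum γ * (1 / √(N : ℝ))) fun p a hp => ?_).trans_eq (by ring)
  have hcov : ∀ b, covMat α μ f N a b =
      ∫ ω, normSum (1 / √(N : ℝ)) (centered α μ f) (Finset.range N) ω a *
        normSum (1 / √(N : ℝ)) (centered α μ f) (Finset.range N) ω b ∂(μ.map (orbit α)) :=
    fun b => integral_comp_W hf N (F := fun w => w a * w b) (by fun_prop)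
  have h1 := (hmix α hα μ hdens).stein_le hC.le hγ hv (integral_centered hf) hp (by positivity)
    hεN a
  simp only [sqrt_mul_sqrt_apply hS.posSemidef, hcov]
  exact h1

lemma one_div_sqrt_le {β : ℝ} (hβ0 : 0 < β) {N : ℕ} (hN : 2 ≤ N) :
    1 / √(N : ℝ) ≤
      (Real.log 2 ^ (1 / β))⁻¹ * (N : ℝ) ^ (β - 1 / 2) * Real.log N ^ (1 / β) := by
  have hN2 : (2 : ℝ) ≤ N := by exact_mod_cast hN
  have hl2 : 0 < Real.log 2 := Real.log_pos (by norm_num)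
  have h1 : 1 / √(N : ℝ) ≤ (N : ℝ) ^ (β - 1 / 2) := by
    rw [Real.sqrt_eq_rpow, one_div, ← Real.rpow_neg (by linarith)]
    exact Real.rpow_le_rpow_of_exponent_le (by linarith) (by linarith)
  have h2 : Real.log 2 ^ (1 / β) ≤ Real.log N ^ (1 / β) :=
    Real.rpow_le_rpow hl2.le (Real.log_le_log (by norm_num) hN2) (by positivity)
  have h3 : 1 ≤ (Real.log 2 ^ (1 / β))⁻¹ * Real.log N ^ (1 / β) := by
    rwa [inv_mul_eq_div, one_le_div (by positivity)]
  calc 1 / √(N : ℝ) ≤ (N : ℝ) ^ (β - 1 / 2) * 1 := by rwa [mul_one]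
    _ ≤ (N : ℝ) ^ (β - 1 / 2) * ((Real.log 2 ^ (1 / β))⁻¹ * Real.log N ^ (1 / β)) :=
      mul_le_mul_of_nonneg_left h3 (by positivity)
    _ = _ := by ring

end Conversion

end Intermittent

theorem theorem1 (β : ℝ) (hβ0 : 0 < β) (hβ : β < 1 / 3) (d : ℕ) (hd : 1 ≤ d) (L M : ℝ≥0) :
    ∃ C : ℝ, 0 < C ∧
      ∀ (α : ℕ → ℝ≥0), (∀ n, 1 ≤ n → (α n : ℝ) ≤ β) →
      ∀ (μ : Measure I), IsProbabilityMeasure μ → Intermittent.HasConeDensity β μ →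
      ∀ (N : ℕ), 2 ≤ N →
      ∀ (f : I → Fin d → ℝ), Intermittent.lipNorm f ≤ L →
        (Intermittent.covMat α μ f N).PosDef →
      ∀ (h : (Fin d → ℝ) → ℝ), Intermittent.ThriceDifferentiable h →
        (∀ k ∈ Finset.Icc 1 3, Intermittent.derivNorm k h ≤ M) →
        |(∫ x, h (Intermittent.W α μ f N x) ∂μ) -
            Intermittent.gaussianExp (Intermittent.covMat α μ f N) h|
          ≤ C * (N : ℝ) ^ (β - 1 / 2) * Real.log N ^ (1 / β) := by
  obtain ⟨K, hK0, hK⟩ := Intermittent.exists_normal_approximation hβ0 hβ hd L M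
  have hl2 : 0 < Real.log 2 := Real.log_pos (by norm_num)
  refine ⟨(K + 1) * (Real.log 2 ^ (1 / β))⁻¹, by positivity, ?_⟩
  intro α hα μ hμ hdens N hN f hf hS h hh hM
  refine (hK α hα μ hμ hdens N hN f hf hS h hh hM).trans ?_
  calc K * (1 / √(N : ℝ)) ≤ (K + 1) * (1 / √(N : ℝ)) := by gcongr; linarith
    _ ≤ (K + 1) * ((Real.log 2 ^ (1 / β))⁻¹ * (N : ℝ) ^ (β - 1 / 2) * Real.log N ^ (1 / β)) :=
      mul_le_mul_of_nonneg_left (Intermittent.one_div_sqrt_le hβ0 hN) (by positivity)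
    _ = _ := by ring
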